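/- A \emph{quantum permutation group} is a triple $\mathbb G=(C(\mathbb G),u,\Delta)$, where $C(\mathbb G)$ is a unital $C^*$-algebra generated by the entries of a magic unitary $u=(u_{ij})$ indexed by a finite non-empty set (the $u_{ij}$ are self-adjoint projections, and every row and every column of $u$ sums to $1$) and $\Delta\colon C(\mathbb G)\to C(\mathbb G)\otimes_{\min} C(\mathbb G)$ is a unital $*$-homomorphism with $\Delta(u_{ij})=\sum_k u_{ik}\otimes u_{kj}$. Two of them are \emph{isomorphic} if there is a $*$-isomorphism of the $C^*$-algebras that intertwines the comultiplications $\Delta$. Let $\mathbb 1$ be the trivial quantum group ($C(\mathbb 1)=\mathbb C$, $u=(1)$). For $n\ge 1$ let $\mathbb S_n^+$ be the quantum symmetric group, given by the universal $C^*$-algebra generated by the entries of an $n\times n$ magic unitary. For a finite simple graph $X$ with non-empty vertex set $V$, the \emph{quantum automorphism group} $\mathrm{Qut}(X)$ is given by the universal $C^*$-algebra generated by the entries of a magic unitary $(u_{ij})_{i,j\in V}$ with $u_{ij}u_{kl}=0$ whenever exactly one of $ik$, $jl$ is an edge of $X$. The \emph{free product} $\mathbb G*\mathbb H$ is given by the unital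 free product $C(\mathbb G)*C(\mathbb H)$ with fundamental representation $u\oplus v$. The \emph{free wreath product} $\mathbb G\wr_*\mathbb H$, where the fundamental representation $v$ of $\mathbb H$ has size $n$, is given by $(C(\mathbb G)^{*n}*C(\mathbb H))/\langle u^{(a)}_{ij}v_{ab}=v_{ab}u^{(a)}_{ij}\rangle$, where $u^{(a)}$ is the copy of $u$ in the $a$-th factor, with fundamental representation $w_{ia,jb}=u^{(a)}_{ij}v_{ab}$. \textbf{Theorem.} Let $\mathcal T$ be the class of all quantum permutation groups that are isomorphic to $\mathrm{Qut}(T)$ for some finite tree $T$. Then $\mathcal T$ is the smallest class of quantum permutation groups that is closed under isomorphism and satisfies: (i) $\mathbb 1\in\mathcal T$; (ii) if $\mathbb G,\mathbb H\in\mathcal T$, then $\mathbb G*\mathbb H\in\mathcal T$; (iii) if $\mathbb G\in\mathcal T$ and $n\ge 1$, then $\mathbb G\wr_*\mathbb S_n^+\in\mathcal T$. -/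

import Mathlib

noncomputable section

open scoped TensorProduct CStarAlgebra

set_option linter.unusedSectionVars false

namespace QAut

/-! ### C*-seminorms and the associated C*-algebras -/

/-- A C*-seminorm on a unital complex *-algebra. -/
structure CStarSeminorm (R : Type*) [Ring R] [StarRing R] [Algebra ℂ R] extends
    Seminorm ℂ R where
  mul_le' : ∀ x y, toFun (x * y) ≤ toFun x * toFun y
  star_mul_self' : ∀ x, toFun (star x * x) = toFun x * toFun x

namespace CStarSeminorm

variable {R : Type*} [Ring R] [StarRing R] [Algebra ℂ R]

instance : CoeFun (CStarSeminorm R) (fun _ => R → ℝ) := ⟨fun p => p.toSeminorm⟩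

variable (p : CStarSeminorm R)

lemma nonneg (x : R) : 0 ≤ p x := apply_nonneg p.toSeminorm x
lemma mul_le (x y : R) : p (x * y) ≤ p x * p y := p.mul_le' x y
lemma star_mul_self (x : R) : p (star x * x) = p x * p x := p.star_mul_self' x
lemma add_le (x y : R) : p (x + y) ≤ p x + p y := map_add_le_add p.toSeminorm x y
lemma map_smul (c : ℂ) (x : R) : p (c • x) = ‖c‖ * p x := map_smul_eq_mul p.toSeminorm c x

lemma le_star (x : R) : p x ≤ p (star x) := by
  rcases (p.nonneg x).eq_or_lt with h | h
  · rw [← h]; exact p.nonneg _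
  · have := p.mul_le (star x) x
    rw [p.star_mul_self] at this
    exact le_of_mul_le_mul_right this h

lemma map_star (x : R) : p (star x) = p x :=
  le_antisymm (by simpa using p.le_star (star x)) (p.le_star x)

lemma eq_of_sub {x y : R} (h : p (x - y) = 0) : p x = p y := by
  have h1 := abs_sub_map_le_sub p.toSeminorm x y
  have h2 : |p x - p y| ≤ 0 := h1.trans h.le
  exact sub_eq_zero.1 (abs_eq_zero.1 (le_antisymm h2 (abs_nonneg _)))

/-- The C*-seminorm `x ↦ ‖f x‖` given by a *-homomorphism to a C*-algebra. -/
def ofHom {D : Type*} [CStarAlgebra D] (f : R →⋆ₐ[ℂ] D) : CStarSeminorm R where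
  toSeminorm := (normSeminorm ℂ D).comp f.toAlgHom.toLinearMap
  mul_le' x y := by
    change ‖f (x * y)‖ ≤ ‖f x‖ * ‖f y‖
    rw [map_mul]; exact norm_mul_le _ _
  star_mul_self' x := by
    change ‖f (star x * x)‖ = ‖f x‖ * ‖f x‖
    rw [map_mul, StarHomClass.map_star f]; exact CStarRing.norm_star_mul_self

@[simp] lemma ofHom_apply {D : Type*} [CStarAlgebra D] (f : R →⋆ₐ[ℂ] D) (x : R) :
    ofHom f x = ‖f x‖ := rfl

/-- The pointwise supremum of a pointwise bounded set of C*-seminorms. -/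
def sup (S : Set (CStarSeminorm R)) (hS : ∀ x, ∃ C : ℝ, ∀ p ∈ S, p x ≤ C) :
    CStarSeminorm R :=
  have hb (x : R) : BddAbove (Set.range fun q : S => q.1 x) := by
    obtain ⟨C, hC⟩ := hS x
    exact ⟨C, by rintro _ ⟨q, rfl⟩; exact hC q.1 q.2⟩
  have h0 (x : R) : 0 ≤ ⨆ q : S, q.1 x := Real.iSup_nonneg fun q => q.1.nonneg x
  have hle (x : R) (q : S) : q.1 x ≤ ⨆ q : S, q.1 x := le_ciSup (hb x) q
  have hmul (x y : R) : (⨆ q : S, q.1 (x * y)) ≤ (⨆ q : S, q.1 x) * ⨆ q : S, q.1 y :=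
    Real.iSup_le (fun q => (q.1.mul_le x y).trans
      (mul_le_mul (hle x q) (hle y q) (q.1.nonneg y) (h0 x))) (mul_nonneg (h0 x) (h0 y))
  { toSeminorm := Seminorm.ofSMulLE (fun x => ⨆ q : S, q.1 x)
      (by
        have : ∀ q : S, q.1 (0 : R) = 0 := fun q => map_zero q.1.toSeminorm
        simp [this])
      (fun x y => Real.iSup_le (fun q => (q.1.add_le x y).trans
        (add_le_add (hle x q) (hle y q))) (add_nonneg (h0 x) (h0 y)))
      (fun c x => Real.iSup_le (fun q => by
        rw [q.1.map_smul]; exact mul_le_mul_of_nonneg_left (hle x q) (norm_nonneg c))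
        (mul_nonneg (norm_nonneg c) (h0 x)))
    mul_le' := hmul
    star_mul_self' := fun x => by
      change (⨆ q : S, q.1 (star x * x)) = (⨆ q : S, q.1 x) * ⨆ q : S, q.1 x
      apply le_antisymm
      · exact Real.iSup_le (fun q => by
          rw [q.1.star_mul_self]
          exact mul_le_mul (hle x q) (hle x q) (q.1.nonneg x) (h0 x)) (mul_nonneg (h0 x) (h0 x))
      · have h1 : (⨆ q : S, q.1 x) ≤ √(⨆ q : S, q.1 (star x * x)) :=
          Real.iSup_le (fun q => by
            apply Real.le_sqrt_of_sq_le
            rw [sq, ← q.1.star_mul_self]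
            exact hle _ q) (Real.sqrt_nonneg _)
        calc _ ≤ √(⨆ q : S, q.1 (star x * x)) * √(⨆ q : S, q.1 (star x * x)) :=
              mul_le_mul h1 h1 (h0 x) (Real.sqrt_nonneg _)
          _ = _ := Real.mul_self_sqrt (h0 _) }

lemma sup_apply (S : Set (CStarSeminorm R)) (hS : ∀ x, ∃ C : ℝ, ∀ p ∈ S, p x ≤ C) (x : R) :
    sup S hS x = ⨆ q : S, q.1 x := rfl

lemma le_sup {S : Set (CStarSeminorm R)} (hS : ∀ x, ∃ C : ℝ, ∀ p ∈ S, p x ≤ C)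
    {q : CStarSeminorm R} (hq : q ∈ S) (x : R) : q x ≤ sup S hS x := by
  obtain ⟨C, hC⟩ := hS x
  exact le_ciSup (f := fun q : S => q.1 x)
    ⟨C, by rintro _ ⟨q, rfl⟩; exact hC q.1 q.2⟩ ⟨q, hq⟩

lemma sup_le {S : Set (CStarSeminorm R)} (hS : ∀ x, ∃ C : ℝ, ∀ p ∈ S, p x ≤ C)
    {x : R} {C : ℝ} (hC : 0 ≤ C) (h : ∀ q ∈ S, q x ≤ C) : sup S hS x ≤ C :=
  Real.iSup_le (fun q => h q.1 q.2) hC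

/-- The *-algebra `R`, seminormed by `p`. -/
def Pre (_p : CStarSeminorm R) : Type _ := R

instance : Ring p.Pre := inferInstanceAs (Ring R)
instance : StarRing p.Pre := inferInstanceAs (StarRing R)
instance : Algebra ℂ p.Pre := inferInstanceAs (Algebra ℂ R)
instance [StarModule ℂ R] : StarModule ℂ p.Pre := inferInstanceAs (StarModule ℂ R)

instance : SeminormedRing p.Pre :=
  { (inferInstance : Ring p.Pre),
    AddGroupSeminorm.toSeminormedAddCommGroup (E := p.Pre) p.toSeminorm.toAddGroupSeminorm with
    norm_mul_le := p.mul_le }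

lemma norm_pre (x : p.Pre) : ‖x‖ = p x := rfl

instance : NormedAlgebra ℂ p.Pre where
  norm_smul_le c x := (p.map_smul c x).le

instance : NormedStarGroup p.Pre := ⟨fun x => (p.map_star x).le⟩

/-- The C*-algebra obtained from `R` by separation and completion with respect to `p`. -/
def Compl : Type _ := UniformSpace.Completion p.Pre

instance : NormedRing p.Compl := inferInstanceAs (NormedRing (UniformSpace.Completion p.Pre))
instance : Algebra ℂ p.Compl := inferInstanceAs (Algebra ℂ (UniformSpace.Completion p.Pre))
instance : CompleteSpace p.Compl :=
  inferInstanceAs (CompleteSpace (UniformSpace.Completion p.Pre))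

/-- The canonical map from `R` to the completion. -/
def incl (x : R) : p.Compl := ((show p.Pre from x : p.Pre) : UniformSpace.Completion p.Pre)

lemma norm_incl (x : R) : ‖p.incl x‖ = p x := UniformSpace.Completion.norm_coe (E := p.Pre) x
lemma incl_add (x y : R) : p.incl (x + y) = p.incl x + p.incl y :=
  UniformSpace.Completion.coe_add (α := p.Pre) x y
lemma incl_mul (x y : R) : p.incl (x * y) = p.incl x * p.incl y :=
  UniformSpace.Completion.coe_mul (α := p.Pre) x y
lemma incl_one : p.incl 1 = 1 := UniformSpace.Completion.coe_one p.Pre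
lemma incl_algebraMap (c : ℂ) : p.incl (algebraMap ℂ R c) = algebraMap ℂ p.Compl c := rfl
lemma incl_smul (c : ℂ) (x : R) : p.incl (c • x) = c • p.incl x := by
  rw [Algebra.smul_def, incl_mul, incl_algebraMap, ← Algebra.smul_def]

lemma continuous_incl : Continuous (fun x : p.Pre => p.incl x) :=
  UniformSpace.Completion.continuous_coe p.Pre

@[elab_as_elim]
lemma induction_on {P : p.Compl → Prop} (x : p.Compl)
    (hp : IsClosed {x | P x}) (ih : ∀ a : R, P (p.incl a)) : P x :=
  UniformSpace.Completion.induction_on (α := p.Pre) x hp ih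

@[elab_as_elim]
lemma induction_on₂ {P : p.Compl → p.Compl → Prop} (x y : p.Compl)
    (hp : IsClosed {x : p.Compl × p.Compl | P x.1 x.2})
    (ih : ∀ a b : R, P (p.incl a) (p.incl b)) : P x y :=
  UniformSpace.Completion.induction_on₂ (α := p.Pre) (β := p.Pre) x y hp ih

instance : NormedAlgebra ℂ p.Compl where
  norm_smul_le c x := by
    induction x using p.induction_on with
    | hp =>
      simp only [Algebra.smul_def]
      exact isClosed_le (by fun_prop) (by fun_prop)
    | ih a => rw [← incl_smul, norm_incl, norm_incl, p.map_smul]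

instance : Star p.Compl := ⟨UniformSpace.Completion.map (α := p.Pre) (β := p.Pre) star⟩

lemma uniformContinuous_star : UniformContinuous (star : p.Pre → p.Pre) :=
  (starNormedAddGroupHom (E := p.Pre)).uniformContinuous

lemma continuous_star : Continuous (star : p.Compl → p.Compl) :=
  UniformSpace.Completion.continuous_map

lemma incl_star (x : R) : p.incl (star x) = star (p.incl x) :=
  (UniformSpace.Completion.map_coe p.uniformContinuous_star x).symm

instance : ContinuousStar p.Compl := ⟨p.continuous_star⟩

instance : StarRing p.Compl where
  star_involutive x := by
    induction x using p.induction_on with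
    | hp => exact isClosed_eq (by fun_prop) (by fun_prop)
    | ih a => rw [← incl_star, ← incl_star, star_star]
  star_mul x y := by
    induction x, y using p.induction_on₂ with
    | hp => exact isClosed_eq (by fun_prop) (by fun_prop)
    | ih a b => simp only [← incl_star, ← incl_mul, star_mul]
  star_add x y := by
    induction x, y using p.induction_on₂ with
    | hp => exact isClosed_eq (by fun_prop) (by fun_prop)
    | ih a b => simp only [← incl_star, ← incl_add, star_add]

instance : CStarRing p.Compl where
  norm_mul_self_le x := by
    induction x using p.induction_on with
    | hp => exact isClosed_le (by fun_prop) (by fun_prop)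
    | ih a => rw [← incl_star, ← incl_mul, norm_incl, norm_incl, p.star_mul_self]

instance [StarModule ℂ R] : StarModule ℂ p.Compl where
  star_smul c x := by
    induction x using p.induction_on with
    | hp =>
      simp only [Algebra.smul_def]
      exact isClosed_eq (by fun_prop) (by fun_prop)
    | ih a => rw [← incl_star, ← incl_smul, ← incl_smul, ← incl_star, star_smul]

instance instCStarAlgebra [StarModule ℂ R] : CStarAlgebra p.Compl where

/-- The canonical *-homomorphism with dense range from `R` to the completion. -/
def inclHom : R →⋆ₐ[ℂ] p.Compl where
  toFun := p.incl
  map_one' := p.incl_one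
  map_mul' := p.incl_mul
  map_zero' := by simpa using p.incl_smul 0 0
  map_add' := p.incl_add
  commutes' := p.incl_algebraMap
  map_star' := p.incl_star

@[simp] lemma inclHom_apply (x : R) : p.inclHom x = p.incl x := rfl

/-- A *-homomorphism dominated by `p` extends to the completion. -/
def lift {D : Type*} [CStarAlgebra D] (f : R →⋆ₐ[ℂ] D) (hf : ∀ x, ‖f x‖ ≤ p x) :
    p.Compl →⋆ₐ[ℂ] D :=
  let g : p.Pre →+* D := (f : R →+* D)
  have hg : UniformContinuous g :=
    uniformContinuous_addMonoidHom_of_continuous (f := g.toAddMonoidHom)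
      (AddMonoidHomClass.continuous_of_bound g.toAddMonoidHom 1 fun x => by
        rw [one_mul]; exact hf x)
  let F : p.Compl → D := UniformSpace.Completion.extension g
  have hF : Continuous F := UniformSpace.Completion.continuous_extension
  have hin (x : R) : F (p.incl x) = f x := UniformSpace.Completion.extension_coe hg x
  { toFun := F
    map_one' := by rw [← incl_one, hin, map_one]
    map_mul' := fun x y => by
      induction x, y using p.induction_on₂ with
      | hp => exact isClosed_eq (by fun_prop) (by fun_prop)
      | ih a b => rw [← incl_mul, hin, hin, hin, map_mul]
    map_zero' := by
      have : p.incl 0 = 0 := map_zero p.inclHom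
      rw [← this, hin, map_zero]
    map_add' := fun x y => by
      induction x, y using p.induction_on₂ with
      | hp => exact isClosed_eq (by fun_prop) (by fun_prop)
      | ih a b => rw [← incl_add, hin, hin, hin, map_add]
    commutes' := fun c => by rw [← incl_algebraMap, hin, AlgHomClass.commutes]
    map_star' := fun x => by
      induction x using p.induction_on with
      | hp => exact isClosed_eq (by fun_prop) (by fun_prop)
      | ih a => rw [← incl_star, hin, hin, StarHomClass.map_star] }

@[simp] lemma lift_incl {D : Type*} [CStarAlgebra D] (f : R →⋆ₐ[ℂ] D) (hf : ∀ x, ‖f x‖ ≤ p x)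
    (x : R) : p.lift f hf (p.incl x) = f x :=
  UniformSpace.Completion.extension_coe (α := p.Pre)
    (uniformContinuous_addMonoidHom_of_continuous (α := p.Pre) (f := (f : R →+* D).toAddMonoidHom)
      (AddMonoidHomClass.continuous_of_bound (E := p.Pre) (f : R →+* D).toAddMonoidHom 1 fun x => by
        rw [one_mul]; exact hf x)) x

end CStarSeminorm

/-! ### Free *-algebras and universal C*-algebras -/

/-- The free unital complex *-algebra on `X`: noncommutative polynomials in the symbols
`x = (x, false)` and `x* = (x, true)`. -/
def FreeStarAlgebra (X : Type*) : Type _ := FreeAlgebra ℂ (X × Bool)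

namespace FreeStarAlgebra

variable {X : Type*}

instance : Ring (FreeStarAlgebra X) := inferInstanceAs (Ring (FreeAlgebra ℂ (X × Bool)))
instance : Algebra ℂ (FreeStarAlgebra X) :=
  inferInstanceAs (Algebra ℂ (FreeAlgebra ℂ (X × Bool)))

/-- The generator `x` (for `b = false`) or `x*` (for `b = true`). -/
def sym (x : X) (b : Bool) : FreeStarAlgebra X := FreeAlgebra.ι ℂ (x, b)

/-- The generator `x`. -/
def of (x : X) : FreeStarAlgebra X := sym x false

/-- The opposite of the free algebra, with complex conjugate scalar multiplication. -/
def ConjOp (X : Type*) : Type _ := (FreeStarAlgebra X)ᵐᵒᵖ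

instance : Ring (ConjOp X) := inferInstanceAs (Ring (FreeStarAlgebra X)ᵐᵒᵖ)
instance : Algebra ℂ (ConjOp X) :=
  RingHom.toAlgebra' ((algebraMap ℂ (FreeStarAlgebra X)ᵐᵒᵖ).comp (starRingEnd ℂ))
    fun c x => Algebra.commutes (A := (FreeStarAlgebra X)ᵐᵒᵖ) (starRingEnd ℂ c) x

/-- The conjugate-linear antimultiplicative map that exchanges `x` and `x*`. -/
def starAux (X : Type*) : FreeStarAlgebra X →ₐ[ℂ] ConjOp X :=
  FreeAlgebra.lift ℂ fun xb => (MulOpposite.op (sym xb.1 (!xb.2)) : (FreeStarAlgebra X)ᵐᵒᵖ)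

instance : Star (FreeStarAlgebra X) :=
  ⟨fun a => MulOpposite.unop (show (FreeStarAlgebra X)ᵐᵒᵖ from starAux X a)⟩

lemma star_sym (x : X) (b : Bool) : star (sym x b) = sym x (!b) :=
  congrArg MulOpposite.unop (FreeAlgebra.lift_ι_apply (A := ConjOp X)
    (fun xb : X × Bool => (MulOpposite.op (sym xb.1 (!xb.2)) : (FreeStarAlgebra X)ᵐᵒᵖ)) (x, b))

lemma star_algebraMap (c : ℂ) :
    star (algebraMap ℂ (FreeStarAlgebra X) c) = algebraMap ℂ (FreeStarAlgebra X) (star c) :=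
  congrArg MulOpposite.unop ((starAux X).commutes c)

lemma star_add' (a b : FreeStarAlgebra X) : star (a + b) = star a + star b :=
  congrArg MulOpposite.unop (map_add (starAux X) a b)

lemma star_mul' (a b : FreeStarAlgebra X) : star (a * b) = star b * star a :=
  congrArg MulOpposite.unop (map_mul (starAux X) a b)

lemma induction {P : FreeStarAlgebra X → Prop} (hc : ∀ c, P (algebraMap ℂ _ c))
    (hs : ∀ x b, P (sym x b)) (hm : ∀ a b, P a → P b → P (a * b))
    (ha : ∀ a b, P a → P b → P (a + b)) (a : FreeStarAlgebra X) : P a :=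
  FreeAlgebra.induction ℂ (X × Bool) (motive := P) hc (fun xb => hs xb.1 xb.2) hm ha a

instance : StarRing (FreeStarAlgebra X) where
  star_involutive a := by
    induction a using induction with
    | hc c => rw [star_algebraMap, star_algebraMap, star_star]
    | hs x b => rw [star_sym, star_sym, Bool.not_not]
    | hm a b ha hb => rw [star_mul', star_mul', ha, hb]
    | ha a b ha hb => rw [star_add', star_add', ha, hb]
  star_mul := star_mul'
  star_add := star_add'

instance : StarModule ℂ (FreeStarAlgebra X) where
  star_smul c a := by
    rw [Algebra.smul_def, star_mul, star_algebraMap, ← Algebra.commutes, ← Algebra.smul_def]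

lemma star_of (x : X) : star (of x) = sym x true := star_sym x false

section lift

variable {D : Type*} [Ring D] [StarRing D] [Algebra ℂ D] [StarModule ℂ D]

/-- The *-homomorphism that extends a map on generators. -/
def lift (f : X → D) : FreeStarAlgebra X →⋆ₐ[ℂ] D :=
  let F : FreeStarAlgebra X →ₐ[ℂ] D :=
    FreeAlgebra.lift ℂ fun xb : X × Bool => if xb.2 then star (f xb.1) else f xb.1
  have hF (x : X) (b : Bool) : F (sym x b) = if b then star (f x) else f x :=
    FreeAlgebra.lift_ι_apply (R := ℂ) (A := D) _ (x, b)
  { F with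
    map_star' := fun a => by
      change F (star a) = star (F a)
      induction a using induction with
      | hc c => rw [star_algebraMap, F.commutes, F.commutes, algebraMap_star_comm]
      | hs x b => rw [star_sym, hF, hF]; cases b <;> simp
      | hm a b ha hb => rw [star_mul, map_mul, map_mul, star_mul, ha, hb]
      | ha a b ha hb => rw [star_add, map_add, map_add, star_add, ha, hb] }

@[simp] lemma lift_of (f : X → D) (x : X) : lift f (of x) = f x := by
  have := FreeAlgebra.lift_ι_apply (R := ℂ) (A := D)
    (fun xb : X × Bool => if xb.2 then star (f xb.1) else f xb.1) (x, false)
  exact this.trans (if_neg Bool.false_ne_true)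

lemma hom_ext {f g : FreeStarAlgebra X →⋆ₐ[ℂ] D} (h : ∀ x, f (of x) = g (of x)) : f = g := by
  ext a
  induction a using induction with
  | hc c => rw [AlgHomClass.commutes, AlgHomClass.commutes]
  | hs x b =>
    cases b
    · exact h x
    · rw [← star_of, StarHomClass.map_star, StarHomClass.map_star, h]
  | hm a b ha hb => rw [map_mul, map_mul, ha, hb]
  | ha a b ha hb => rw [map_add, map_add, ha, hb]

end lift

end FreeStarAlgebra

/-- Generators and *-polynomial relations `r = 0` such that every generator is uniformly bounded
in all C*-seminorms that respect the relations; this is the condition under which the universal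
C*-algebra exists. -/
structure Presentation (X : Type) where
  rel : FreeStarAlgebra X → Prop
  bounded : ∀ x, ∃ C : ℝ, ∀ p : CStarSeminorm (FreeStarAlgebra X),
    (∀ r, rel r → p r = 0) → p (FreeStarAlgebra.of x) ≤ C

namespace Presentation

variable {X : Type} (P : Presentation X)

/-- The C*-seminorms that respect the relations. -/
def seminorms : Set (CStarSeminorm (FreeStarAlgebra X)) := {p | ∀ r, P.rel r → p r = 0}

lemma seminorms_bounded (a : FreeStarAlgebra X) : ∃ C : ℝ, ∀ p ∈ P.seminorms, p a ≤ C := by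
  induction a using FreeStarAlgebra.induction with
  | hc c =>
    refine ⟨‖c‖, fun p _ => ?_⟩
    have h1 : p 1 ≤ 1 := by
      have h := p.star_mul_self 1
      rw [star_one, one_mul] at h
      nlinarith [p.nonneg 1]
    rw [Algebra.algebraMap_eq_smul_one, p.map_smul]
    exact mul_le_of_le_one_right (norm_nonneg c) h1
  | hs x b =>
    obtain ⟨C, hC⟩ := P.bounded x
    refine ⟨C, fun p hp => ?_⟩
    cases b
    · exact hC p hp
    · rw [← FreeStarAlgebra.star_of, p.map_star]; exact hC p hp
  | hm a b ha hb =>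
    obtain ⟨C, hC⟩ := ha
    obtain ⟨C', hC'⟩ := hb
    exact ⟨C * C', fun p hp => (p.mul_le a b).trans
      (mul_le_mul (hC p hp) (hC' p hp) (p.nonneg b) ((p.nonneg a).trans (hC p hp)))⟩
  | ha a b ha hb =>
    obtain ⟨C, hC⟩ := ha
    obtain ⟨C', hC'⟩ := hb
    exact ⟨C + C', fun p hp => (p.add_le a b).trans (add_le_add (hC p hp) (hC' p hp))⟩

/-- The largest C*-seminorm that respects the relations. -/
def seminorm : CStarSeminorm (FreeStarAlgebra X) :=
  CStarSeminorm.sup P.seminorms P.seminorms_bounded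

/-- The universal C*-algebra with the given generators and relations. -/
abbrev Alg : Type := P.seminorm.Compl

/-- The generator `x` of the universal C*-algebra. -/
def gen (x : X) : P.Alg := P.seminorm.incl (FreeStarAlgebra.of x)

lemma incl_rel {r : FreeStarAlgebra X} (hr : P.rel r) : P.seminorm.incl r = 0 := by
  rw [← norm_eq_zero, CStarSeminorm.norm_incl]
  exact le_antisymm (CStarSeminorm.sup_le _ le_rfl fun q hq => (hq r hr).le) (P.seminorm.nonneg r)

lemma norm_lift_le {D : Type*} [CStarAlgebra D] (f : X → D)
    (hf : ∀ r, P.rel r → FreeStarAlgebra.lift f r = 0) (a : FreeStarAlgebra X) :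
    ‖FreeStarAlgebra.lift f a‖ ≤ P.seminorm a :=
  CStarSeminorm.le_sup (q := CStarSeminorm.ofHom (FreeStarAlgebra.lift f)) P.seminorms_bounded
    (fun r hr => by rw [CStarSeminorm.ofHom_apply, hf r hr, norm_zero]) a

/-- The universal property. -/
def lift {D : Type*} [CStarAlgebra D] (f : X → D)
    (hf : ∀ r, P.rel r → FreeStarAlgebra.lift f r = 0) : P.Alg →⋆ₐ[ℂ] D :=
  P.seminorm.lift (FreeStarAlgebra.lift f) (P.norm_lift_le f hf)

@[simp] lemma lift_gen {D : Type*} [CStarAlgebra D] (f : X → D)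
    (hf : ∀ r, P.rel r → FreeStarAlgebra.lift f r = 0) (x : X) : P.lift f hf (P.gen x) = f x := by
  rw [lift, gen, CStarSeminorm.lift_incl, FreeStarAlgebra.lift_of]

/-- A closed *-subalgebra that contains the generators is everything. -/
lemma eq_top {S : StarSubalgebra ℂ P.Alg} (hS : IsClosed (S : Set P.Alg))
    (h : ∀ x, P.gen x ∈ S) : S = ⊤ := by
  suffices h : ∀ a, a ∈ S from eq_top_iff.2 fun a _ => h a
  intro a
  induction a using P.seminorm.induction_on with
  | hp => exact hS
  | ih a =>
    induction a using FreeStarAlgebra.induction with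
    | hc c => rw [CStarSeminorm.incl_algebraMap]; exact algebraMap_mem S c
    | hs x b =>
      cases b
      · exact h x
      · rw [← FreeStarAlgebra.star_of, CStarSeminorm.incl_star]; exact star_mem (h x)
    | hm a b ha hb => rw [CStarSeminorm.incl_mul]; exact mul_mem ha hb
    | ha a b ha hb => rw [CStarSeminorm.incl_add]; exact add_mem ha hb

end Presentation

/-! ### The minimal tensor product of C*-algebras -/

section MinTensor

variable {H K : Type} [NormedAddCommGroup H] [InnerProductSpace ℂ H] [CompleteSpace H]
  [NormedAddCommGroup K] [InnerProductSpace ℂ K] [CompleteSpace K]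

variable (H K) in
/-- The Hilbert space tensor product: the completion of the algebraic tensor product for the inner
product `⟪h ⊗ k, h' ⊗ k'⟫ = ⟪h, h'⟫ ⟪k, k'⟫`. -/
def HilbertTensor : Type := UniformSpace.Completion (H ⊗[ℂ] K)

instance : NormedAddCommGroup (HilbertTensor H K) :=
  inferInstanceAs (NormedAddCommGroup (UniformSpace.Completion (H ⊗[ℂ] K)))
instance : InnerProductSpace ℂ (HilbertTensor H K) :=
  inferInstanceAs (InnerProductSpace ℂ (UniformSpace.Completion (H ⊗[ℂ] K)))
instance : CompleteSpace (HilbertTensor H K) :=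
  inferInstanceAs (CompleteSpace (UniformSpace.Completion (H ⊗[ℂ] K)))

/-- The embedding of the algebraic tensor product in the Hilbert space tensor product. -/
def HilbertTensor.incl (x : H ⊗[ℂ] K) : HilbertTensor H K :=
  (x : UniformSpace.Completion (H ⊗[ℂ] K))

open HilbertTensor

lemma HilbertTensor.incl_add (x y : H ⊗[ℂ] K) : incl (x + y) = incl x + incl y :=
  UniformSpace.Completion.coe_add x y

lemma HilbertTensor.incl_smul (c : ℂ) (x : H ⊗[ℂ] K) : incl (c • x) = c • incl x :=
  UniformSpace.Completion.coe_smul c x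

lemma HilbertTensor.norm_incl (x : H ⊗[ℂ] K) : ‖incl x‖ = ‖x‖ :=
  UniformSpace.Completion.norm_coe x

lemma HilbertTensor.inner_incl (x y : H ⊗[ℂ] K) : inner ℂ (incl x) (incl y) = inner ℂ x y :=
  UniformSpace.Completion.inner_coe x y

@[elab_as_elim]
lemma HilbertTensor.induction_on {P : HilbertTensor H K → Prop} (x : HilbertTensor H K)
    (hp : IsClosed {x | P x}) (ih : ∀ a, P (incl a)) : P x :=
  UniformSpace.Completion.induction_on (α := H ⊗[ℂ] K) x hp ih

@[elab_as_elim]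
lemma HilbertTensor.induction_on₂ {P : HilbertTensor H K → HilbertTensor H K → Prop}
    (x y : HilbertTensor H K) (hp : IsClosed {x : HilbertTensor H K × HilbertTensor H K | P x.1 x.2})
    (ih : ∀ a b, P (incl a) (incl b)) : P x y :=
  UniformSpace.Completion.induction_on₂ (α := H ⊗[ℂ] K) (β := H ⊗[ℂ] K) x y hp ih

/-- The bounded operator `S ⊗ T` on the Hilbert space tensor product. -/
def opTensor (S : H →L[ℂ] H) (T : K →L[ℂ] K) : HilbertTensor H K →L[ℂ] HilbertTensor H K :=
  (TensorProduct.mapL S T).completion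

lemma opTensor_incl (S : H →L[ℂ] H) (T : K →L[ℂ] K) (x : H ⊗[ℂ] K) :
    opTensor S T (incl x) = incl (TensorProduct.mapL S T x) :=
  ContinuousLinearMap.completion_apply_coe _ _

lemma op_ext {S T : HilbertTensor H K →L[ℂ] HilbertTensor H K}
    (h : ∀ x : H ⊗[ℂ] K, S (incl x) = T (incl x)) : S = T := by
  ext x
  induction x using HilbertTensor.induction_on with
  | hp => exact isClosed_eq S.continuous T.continuous
  | ih x => exact h x

lemma opTensor_mul (S S' : H →L[ℂ] H) (T T' : K →L[ℂ] K) :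
    opTensor (S * S') (T * T') = opTensor S T * opTensor S' T' := by
  apply op_ext
  intro x
  rw [mul_apply_eq_comp, opTensor_incl, opTensor_incl, opTensor_incl,
    TensorProduct.mapL_mul]
  rfl

lemma opTensor_one : opTensor (1 : H →L[ℂ] H) (1 : K →L[ℂ] K) = 1 := by
  apply op_ext
  intro x
  rw [opTensor_incl]
  simp [ContinuousLinearMap.one_def]

lemma opTensor_add_left (S S' : H →L[ℂ] H) (T : K →L[ℂ] K) :
    opTensor (S + S') T = opTensor S T + opTensor S' T := by
  apply op_ext
  intro x
  rw [_root_.add_apply, opTensor_incl, opTensor_incl, opTensor_incl,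
    TensorProduct.mapL_add_left, _root_.add_apply, HilbertTensor.incl_add]

lemma opTensor_add_right (S : H →L[ℂ] H) (T T' : K →L[ℂ] K) :
    opTensor S (T + T') = opTensor S T + opTensor S T' := by
  apply op_ext
  intro x
  rw [_root_.add_apply, opTensor_incl, opTensor_incl, opTensor_incl,
    TensorProduct.mapL_add_right, _root_.add_apply, HilbertTensor.incl_add]

lemma opTensor_smul_left (c : ℂ) (S : H →L[ℂ] H) (T : K →L[ℂ] K) :
    opTensor (c • S) T = c • opTensor S T := by
  apply op_ext
  intro x
  rw [_root_.smul_apply, opTensor_incl, opTensor_incl,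
    TensorProduct.mapL_smul_left, _root_.smul_apply, HilbertTensor.incl_smul]

lemma opTensor_smul_right (c : ℂ) (S : H →L[ℂ] H) (T : K →L[ℂ] K) :
    opTensor S (c • T) = c • opTensor S T := by
  apply op_ext
  intro x
  rw [_root_.smul_apply, opTensor_incl, opTensor_incl,
    TensorProduct.mapL_smul_right, _root_.smul_apply, HilbertTensor.incl_smul]

lemma mapL_adjoint_inner (S : H →L[ℂ] H) (T : K →L[ℂ] K) (x y : H ⊗[ℂ] K) :
    inner ℂ (TensorProduct.mapL (star S) (star T) x) y = inner ℂ x (TensorProduct.mapL S T y) := by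
  induction x with
  | zero => simp
  | add x x' hx hx' => rw [map_add, inner_add_left, inner_add_left, hx, hx']
  | tmul h k =>
    induction y with
    | zero => simp
    | add y y' hy hy' => rw [map_add, inner_add_right, inner_add_right, hy, hy']
    | tmul h' k' =>
      simp only [TensorProduct.mapL_tmul, TensorProduct.inner_tmul,
        ContinuousLinearMap.star_eq_adjoint, ContinuousLinearMap.adjoint_inner_left]

lemma opTensor_star (S : H →L[ℂ] H) (T : K →L[ℂ] K) :
    opTensor (star S) (star T) = star (opTensor S T) := by
  rw [ContinuousLinearMap.star_eq_adjoint (opTensor S T), ContinuousLinearMap.eq_adjoint_iff]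
  intro x y
  induction x, y using HilbertTensor.induction_on₂ with
  | hp => apply isClosed_eq <;> fun_prop
  | ih x y =>
    rw [opTensor_incl, opTensor_incl, inner_incl, inner_incl, mapL_adjoint_inner]

lemma norm_opTensor_le (S : H →L[ℂ] H) (T : K →L[ℂ] K) : ‖opTensor S T‖ ≤ ‖S‖ * ‖T‖ := by
  refine ContinuousLinearMap.opNorm_le_bound _ (by positivity) fun x => ?_
  induction x using HilbertTensor.induction_on with
  | hp => apply isClosed_le <;> fun_prop
  | ih x =>
    rw [opTensor_incl, norm_incl, norm_incl]
    exact ((TensorProduct.mapL S T).le_opNorm x).trans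
      (mul_le_mul_of_nonneg_right (TensorProduct.norm_mapL_le S T) (norm_nonneg x))

variable {A B A' B' : Type} [CStarAlgebra A] [CStarAlgebra B] [CStarAlgebra A'] [CStarAlgebra B']

/-- The representation `π ⊗ ρ` of the algebraic tensor product `A ⊗ B` on the Hilbert space
tensor product, for representations `π` of `A` and `ρ` of `B`. -/
def repTensor (π : A →⋆ₐ[ℂ] (H →L[ℂ] H)) (ρ : B →⋆ₐ[ℂ] (K →L[ℂ] K)) :
    A ⊗[ℂ] B →⋆ₐ[ℂ] (HilbertTensor H K →L[ℂ] HilbertTensor H K) :=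
  let F : A ⊗[ℂ] B →ₗ[ℂ] (HilbertTensor H K →L[ℂ] HilbertTensor H K) :=
    TensorProduct.lift (LinearMap.mk₂ ℂ (fun a b => opTensor (π a) (ρ b))
      (fun a a' b => by rw [map_add, opTensor_add_left])
      (fun c a b => by rw [_root_.map_smul, opTensor_smul_left])
      (fun a b b' => by rw [map_add, opTensor_add_right])
      (fun c a b => by rw [_root_.map_smul, opTensor_smul_right]))
  have hF (a : A) (b : B) : F (a ⊗ₜ b) = opTensor (π a) (ρ b) := rfl
  let G : A ⊗[ℂ] B →ₐ[ℂ] (HilbertTensor H K →L[ℂ] HilbertTensor H K) :=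
    Algebra.TensorProduct.algHomOfLinearMapTensorProduct F
      (fun a a' b b' => by rw [hF, hF, hF, map_mul, map_mul, opTensor_mul])
      (by rw [hF, map_one, map_one, opTensor_one])
  { G with
    map_star' := fun t => by
      change F (star t) = star (F t)
      induction t with
      | zero => simp
      | tmul a b =>
        rw [TensorProduct.star_tmul, hF, hF, StarHomClass.map_star, StarHomClass.map_star,
          opTensor_star]
      | add s t hs ht => rw [star_add, map_add, map_add, star_add, hs, ht] }

lemma repTensor_tmul (π : A →⋆ₐ[ℂ] (H →L[ℂ] H)) (ρ : B →⋆ₐ[ℂ] (K →L[ℂ] K)) (a : A) (b : B) :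
    repTensor π ρ (a ⊗ₜ b) = opTensor (π a) (ρ b) := rfl

variable (A B) in
/-- The C*-seminorms `t ↦ ‖(π ⊗ ρ)(t)‖` on the algebraic tensor product, where `π` and `ρ` run
over all representations of `A` and `B` on Hilbert spaces. -/
def spatialSeminorms : Set (CStarSeminorm (A ⊗[ℂ] B)) :=
  {p | ∃ (H K : Type) (_ : NormedAddCommGroup H) (_ : InnerProductSpace ℂ H)
    (_ : CompleteSpace H) (_ : NormedAddCommGroup K) (_ : InnerProductSpace ℂ K)
    (_ : CompleteSpace K) (π : A →⋆ₐ[ℂ] (H →L[ℂ] H)) (ρ : B →⋆ₐ[ℂ] (K →L[ℂ] K)),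
    p = CStarSeminorm.ofHom (repTensor π ρ)}

lemma spatialSeminorms_tmul_le {p : CStarSeminorm (A ⊗[ℂ] B)} (hp : p ∈ spatialSeminorms A B)
    (a : A) (b : B) : p (a ⊗ₜ b) ≤ ‖a‖ * ‖b‖ := by
  obtain ⟨H, K, _, _, _, _, _, _, π, ρ, rfl⟩ := hp
  rw [CStarSeminorm.ofHom_apply, repTensor_tmul]
  exact (norm_opTensor_le _ _).trans (mul_le_mul (NonUnitalStarAlgHom.norm_apply_le π a)
    (NonUnitalStarAlgHom.norm_apply_le ρ b) (norm_nonneg _) (norm_nonneg _))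

lemma spatialSeminorms_bounded (t : A ⊗[ℂ] B) :
    ∃ C : ℝ, ∀ p ∈ spatialSeminorms A B, p t ≤ C := by
  induction t with
  | zero => exact ⟨0, fun p _ => (map_zero p.toSeminorm).le⟩
  | tmul a b => exact ⟨‖a‖ * ‖b‖, fun p hp => spatialSeminorms_tmul_le hp a b⟩
  | add s t hs ht =>
    obtain ⟨C, hC⟩ := hs
    obtain ⟨C', hC'⟩ := ht
    exact ⟨C + C', fun p hp => (p.add_le s t).trans (add_le_add (hC p hp) (hC' p hp))⟩

variable (A B) in
/-- The minimal (spatial) C*-norm on the algebraic tensor product. -/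
def minSeminorm : CStarSeminorm (A ⊗[ℂ] B) :=
  CStarSeminorm.sup (spatialSeminorms A B) spatialSeminorms_bounded

variable (A B) in
/-- The minimal tensor product of two unital C*-algebras. -/
abbrev MinTensor : Type := (minSeminorm A B).Compl

namespace MinTensor

/-- Elementary tensors. -/
def tmul (a : A) (b : B) : MinTensor A B := (minSeminorm A B).incl (a ⊗ₜ b)

lemma tmul_mul_tmul (a a' : A) (b b' : B) :
    tmul a b * tmul a' b' = tmul (a * a') (b * b') := by
  rw [tmul, tmul, ← CStarSeminorm.incl_mul, Algebra.TensorProduct.tmul_mul_tmul, tmul]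

lemma star_tmul (a : A) (b : B) : star (tmul a b) = tmul (star a) (star b) := by
  rw [tmul, ← CStarSeminorm.incl_star, TensorProduct.star_tmul, tmul]

lemma one_tmul_one : tmul (1 : A) (1 : B) = 1 := by
  rw [tmul, ← Algebra.TensorProduct.one_def, CStarSeminorm.incl_one]

/-- The bilinear map `(a, b) ↦ a ⊗ b`. -/
def bilin : A →ₗ[ℂ] B →ₗ[ℂ] MinTensor A B :=
  LinearMap.mk₂ ℂ tmul
    (fun a a' b => by rw [tmul, TensorProduct.add_tmul, CStarSeminorm.incl_add]; rfl)
    (fun c a b => by rw [tmul, ← TensorProduct.smul_tmul', CStarSeminorm.incl_smul]; rfl)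
    (fun a b b' => by rw [tmul, TensorProduct.tmul_add, CStarSeminorm.incl_add]; rfl)
    (fun c a b => by rw [tmul, TensorProduct.tmul_smul, CStarSeminorm.incl_smul]; rfl)

lemma sum_tmul {ι : Type*} (s : Finset ι) (f : ι → A) (b : B) :
    tmul (∑ i ∈ s, f i) b = ∑ i ∈ s, tmul (f i) b := by
  change bilin (∑ i ∈ s, f i) b = ∑ i ∈ s, bilin (f i) b
  rw [map_sum, LinearMap.sum_apply]

lemma tmul_sum {ι : Type*} (s : Finset ι) (a : A) (f : ι → B) :
    tmul a (∑ i ∈ s, f i) = ∑ i ∈ s, tmul a (f i) := map_sum (bilin a) f s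

lemma zero_tmul (b : B) : tmul (0 : A) b = 0 := by
  change bilin (0 : A) b = 0
  rw [map_zero, LinearMap.zero_apply]

lemma tmul_zero (a : A) : tmul a (0 : B) = 0 := map_zero (bilin a)

@[elab_as_elim]
lemma induction {P : MinTensor A B → Prop} (t : MinTensor A B) (hP : IsClosed {t | P t})
    (h0 : P 0) (ht : ∀ a b, P (tmul a b)) (ha : ∀ s t, P s → P t → P (s + t)) : P t := by
  induction t using (minSeminorm A B).induction_on with
  | hp => exact hP
  | ih t =>
    induction t with
    | zero =>
      have : (minSeminorm A B).incl 0 = 0 := map_zero (minSeminorm A B).inclHom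
      rw [this]; exact h0
    | tmul a b => exact ht a b
    | add s t hs ht => rw [CStarSeminorm.incl_add]; exact ha _ _ hs ht

/-- The *-homomorphism `φ ⊗ ψ` on algebraic tensor products. -/
def algMap (φ : A →⋆ₐ[ℂ] A') (ψ : B →⋆ₐ[ℂ] B') : A ⊗[ℂ] B →⋆ₐ[ℂ] A' ⊗[ℂ] B' :=
  { Algebra.TensorProduct.map φ.toAlgHom ψ.toAlgHom with
    map_star' := fun t => by
      change Algebra.TensorProduct.map φ.toAlgHom ψ.toAlgHom (star t) =
        star (Algebra.TensorProduct.map φ.toAlgHom ψ.toAlgHom t)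
      induction t with
      | zero => simp
      | tmul a b =>
        simp only [TensorProduct.star_tmul, Algebra.TensorProduct.map_tmul]
        congr 1
        · exact StarHomClass.map_star φ a
        · exact StarHomClass.map_star ψ b
      | add s t hs ht => rw [star_add, map_add, map_add, star_add, hs, ht] }

lemma algMap_tmul (φ : A →⋆ₐ[ℂ] A') (ψ : B →⋆ₐ[ℂ] B') (a : A) (b : B) :
    algMap φ ψ (a ⊗ₜ b) = φ a ⊗ₜ ψ b := rfl

lemma minSeminorm_algMap_le (φ : A →⋆ₐ[ℂ] A') (ψ : B →⋆ₐ[ℂ] B') (t : A ⊗[ℂ] B) :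
    minSeminorm A' B' (algMap φ ψ t) ≤ minSeminorm A B t := by
  refine CStarSeminorm.sup_le _ ((minSeminorm A B).nonneg t) fun q hq => ?_
  obtain ⟨H, K, _, _, _, _, _, _, π, ρ, rfl⟩ := hq
  have key : repTensor π ρ (algMap φ ψ t) = repTensor (π.comp φ) (ρ.comp ψ) t := by
    induction t with
    | zero => simp
    | tmul a b => rfl
    | add s t hs ht => rw [map_add, map_add, map_add, hs, ht]
  rw [CStarSeminorm.ofHom_apply, key]
  exact CStarSeminorm.le_sup (q := CStarSeminorm.ofHom (repTensor (π.comp φ) (ρ.comp ψ)))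
    spatialSeminorms_bounded ⟨H, K, _, _, _, _, _, _, _, _, rfl⟩ t

/-- The *-homomorphism `φ ⊗ ψ` on minimal tensor products. -/
def map (φ : A →⋆ₐ[ℂ] A') (ψ : B →⋆ₐ[ℂ] B') : MinTensor A B →⋆ₐ[ℂ] MinTensor A' B' :=
  (minSeminorm A B).lift ((minSeminorm A' B').inclHom.comp (algMap φ ψ)) fun t => by
    rw [StarAlgHom.comp_apply, CStarSeminorm.inclHom_apply, CStarSeminorm.norm_incl]
    exact minSeminorm_algMap_le φ ψ t

@[simp] lemma map_tmul (φ : A →⋆ₐ[ℂ] A') (ψ : B →⋆ₐ[ℂ] B') (a : A) (b : B) :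
    map φ ψ (tmul a b) = tmul (φ a) (ψ b) := by
  rw [map, tmul, CStarSeminorm.lift_incl, StarAlgHom.comp_apply, algMap_tmul,
    CStarSeminorm.inclHom_apply, tmul]

end MinTensor

end MinTensor

/-! ### Quantum permutation groups -/

/-- A magic unitary: a square matrix of self-adjoint projections whose rows and columns sum
to `1`. -/
structure IsMagicUnitary {ι A : Type} [Fintype ι] [CStarAlgebra A] (u : Matrix ι ι A) : Prop where
  star_eq : ∀ i j, star (u i j) = u i j
  mul_self : ∀ i j, u i j * u i j = u i j
  row_sum : ∀ i, ∑ j, u i j = 1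
  col_sum : ∀ j, ∑ i, u i j = 1

/-- Projections in a C*-algebra that sum to `1` are pairwise orthogonal. -/
lemma orthogonal_of_sum_eq_one {ι A : Type} [Fintype ι] [CStarAlgebra A] (q : ι → A)
    (hs : ∀ i, star (q i) = q i) (hm : ∀ i, q i * q i = q i) (h1 : ∑ i, q i = 1)
    {i j : ι} (hij : i ≠ j) : q i * q j = 0 := by
  classical
  let _ := CStarAlgebra.spectralOrder A
  have _ := CStarAlgebra.spectralOrderedRing A
  have h : ∑ k ∈ Finset.univ.erase j, star (q k * q j) * (q k * q j) = 0 := by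
    have h2 : ∑ k, star (q k * q j) * (q k * q j) = q j := by
      have : ∀ k, star (q k * q j) * (q k * q j) = q j * q k * q j := fun k => by
        rw [star_mul, hs, hs, mul_assoc, ← mul_assoc (q k), hm, mul_assoc]
      simp only [this]
      rw [← Finset.sum_mul, ← Finset.mul_sum, h1, mul_one, hm]
    rw [← Finset.add_sum_erase _ _ (Finset.mem_univ j), hm, hs, hm] at h2
    exact left_eq_add.1 h2.symm
  have h3 := (Finset.sum_eq_zero_iff_of_nonneg fun k _ => star_mul_self_nonneg (q k * q j)).1 h i
    (Finset.mem_erase.2 ⟨hij, Finset.mem_univ i⟩)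
  exact CStarRing.star_mul_self_eq_zero_iff _ |>.1 h3

namespace IsMagicUnitary

variable {ι A : Type} [Fintype ι] [CStarAlgebra A] {u : Matrix ι ι A}

lemma row_orthogonal (hu : IsMagicUnitary u) (i : ι) {j k : ι} (h : j ≠ k) : u i j * u i k = 0 :=
  orthogonal_of_sum_eq_one (u i) (hu.star_eq i) (hu.mul_self i) (hu.row_sum i) h

lemma col_orthogonal (hu : IsMagicUnitary u) (j : ι) {i k : ι} (h : i ≠ k) : u i j * u k j = 0 :=
  orthogonal_of_sum_eq_one (fun i => u i j) (fun i => hu.star_eq i j) (fun i => hu.mul_self i j)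
    (hu.col_sum j) h

/-- The matrix with entries `∑ k, u i k ⊗ u k j` is again a magic unitary. -/
lemma comul (hu : IsMagicUnitary u) :
    IsMagicUnitary (Matrix.of fun i j => ∑ k, MinTensor.tmul (u i k) (u k j)) where
  star_eq i j := by
    simp only [Matrix.of_apply, star_sum, MinTensor.star_tmul, hu.star_eq]
  mul_self i j := by
    simp only [Matrix.of_apply, Finset.sum_mul_sum, MinTensor.tmul_mul_tmul]
    refine Finset.sum_congr rfl fun k _ => ?_
    rw [Finset.sum_eq_single k]
    · rw [hu.mul_self, hu.mul_self]
    · intro l _ hl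
      rw [hu.row_orthogonal i hl.symm, MinTensor.zero_tmul]
    · intro h; exact absurd (Finset.mem_univ k) h
  row_sum i := by
    simp only [Matrix.of_apply]
    rw [Finset.sum_comm]
    simp only [← MinTensor.tmul_sum, hu.row_sum, ← MinTensor.sum_tmul, MinTensor.one_tmul_one]
  col_sum j := by
    simp only [Matrix.of_apply]
    rw [Finset.sum_comm]
    simp only [← MinTensor.sum_tmul, hu.col_sum, ← MinTensor.tmul_sum, MinTensor.one_tmul_one]

end IsMagicUnitary

/-- A quantum permutation group: a compact matrix quantum group whose fundamental representation
`u` is a magic unitary. (A magic unitary is invertible, its inverse being its transpose, and has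
self-adjoint entries, so that both `u` and `(star (u i j))` are invertible.) -/
structure QuantumPermutationGroup where
  /-- The C*-algebra of continuous functions on the quantum group. -/
  Alg : Type
  [cstar : CStarAlgebra Alg]
  /-- The set of points that is acted on. -/
  Pt : Type
  [fintype : Fintype Pt]
  [nonempty : Nonempty Pt]
  /-- The fundamental representation. -/
  u : Matrix Pt Pt Alg
  magic : IsMagicUnitary u
  generates :
    (StarAlgebra.adjoin ℂ (Set.range fun p : Pt × Pt => u p.1 p.2)).topologicalClosure = ⊤
  /-- The comultiplication. -/
  comul : Alg →⋆ₐ[ℂ] MinTensor Alg Alg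
  comul_u : ∀ i j, comul (u i j) = ∑ k, MinTensor.tmul (u i k) (u k j)

namespace QuantumPermutationGroup

attribute [instance] cstar fintype nonempty

/-- Isomorphism of quantum groups: a *-isomorphism that intertwines the comultiplications. (The
fundamental representations need not correspond to each other.) -/
def Iso (G H : QuantumPermutationGroup) : Prop :=
  ∃ φ : G.Alg ≃⋆ₐ[ℂ] H.Alg, ∀ x : G.Alg,
    MinTensor.map (φ : G.Alg →⋆ₐ[ℂ] H.Alg) (φ : G.Alg →⋆ₐ[ℂ] H.Alg) (G.comul x) = H.comul (φ x)

lemma mem_of_u_mem (G : QuantumPermutationGroup) {S : StarSubalgebra ℂ G.Alg}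
    (hS : IsClosed (S : Set G.Alg)) (hu : ∀ i j, G.u i j ∈ S) (x : G.Alg) : x ∈ S := by
  have h : (StarAlgebra.adjoin ℂ (Set.range fun p : G.Pt × G.Pt => G.u p.1 p.2)) ≤ S :=
    StarAlgebra.adjoin_le (by rintro _ ⟨p, rfl⟩; exact hu p.1 p.2)
  have h' := StarSubalgebra.topologicalClosure_minimal h hS
  rw [G.generates] at h'
  exact h' trivial

/-- The trivial quantum group, acting on one point. -/
def one : QuantumPermutationGroup where
  Alg := ℂ
  Pt := Unit
  u := Matrix.of fun _ _ => 1
  magic := ⟨by simp, by simp, by simp, by simp⟩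
  generates := by
    refine eq_top_iff.2 fun x _ => ?_
    exact algebraMap_mem (StarSubalgebra.topologicalClosure _) x
  comul := StarAlgHom.ofId ℂ (MinTensor ℂ ℂ)
  comul_u i j := by simp [MinTensor.one_tmul_one]

end QuantumPermutationGroup

/-! ### Quantum automorphism groups of graphs -/

section Qut

open FreeStarAlgebra

variable {V : Type} [Fintype V]

/-- The relations `u i j = (u i j)* = (u i j)²`, `∑ k, u i k = 1 = ∑ k, u k j`, and
`u i j * u k l = 0` whenever `R i j k l`. -/
inductive MagicRel (R : V → V → V → V → Prop) : FreeStarAlgebra (V × V) → Prop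
  | star_eq (i j : V) : MagicRel R (star (of (i, j)) - of (i, j))
  | mul_self (i j : V) : MagicRel R (of (i, j) * of (i, j) - of (i, j))
  | row_sum (i : V) : MagicRel R (∑ k, of (i, k) - 1)
  | col_sum (j : V) : MagicRel R (∑ k, of (k, j) - 1)
  | mul_eq_zero (i j k l : V) (h : R i j k l) : MagicRel R (of (i, j) * of (k, l))

/-- Generators `u i j` with the relations `MagicRel`. -/
def magicPresentation (R : V → V → V → V → Prop) : Presentation (V × V) where
  rel := MagicRel R
  bounded := by
    rintro ⟨i, j⟩
    refine ⟨1, fun p hp => ?_⟩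
    have h1 : p (star (of (i, j)) * of (i, j)) = p (of (i, j)) := by
      have h2 : p (star (of (i, j)) * of (i, j)) = p (of (i, j) * of (i, j)) := by
        apply p.eq_of_sub
        rw [← sub_mul]
        refine le_antisymm ((p.mul_le _ _).trans ?_) (p.nonneg _)
        rw [hp _ (.star_eq i j), zero_mul]
      rw [h2]
      exact p.eq_of_sub (hp _ (.mul_self i j))
    rw [p.star_mul_self] at h1
    nlinarith [p.nonneg (of (i, j))]

lemma magicPresentation_magic (R : V → V → V → V → Prop) :
    IsMagicUnitary (Matrix.of fun i j => (magicPresentation R).gen (i, j)) := by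
  have key : ∀ r, MagicRel R r → (magicPresentation R).seminorm.inclHom r = 0 :=
    fun r hr => (magicPresentation R).incl_rel hr
  have gen_eq : ∀ x, (magicPresentation R).gen x =
    (magicPresentation R).seminorm.inclHom (of x) := fun x => rfl
  constructor
  · intro i j
    have := key _ (.star_eq i j)
    rw [map_sub, sub_eq_zero, StarHomClass.map_star] at this
    exact this
  · intro i j
    have := key _ (.mul_self i j)
    rw [map_sub, sub_eq_zero, map_mul] at this
    exact this
  · intro i
    have := key _ (.row_sum i)
    rw [map_sub, sub_eq_zero, map_sum, map_one] at this
    exact this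
  · intro j
    have := key _ (.col_sum j)
    rw [map_sub, sub_eq_zero, map_sum, map_one] at this
    exact this

lemma magicPresentation_mul_eq_zero (R : V → V → V → V → Prop) {i j k l : V} (h : R i j k l) :
    (magicPresentation R).gen (i, j) * (magicPresentation R).gen (k, l) = 0 := by
  have := (magicPresentation R).incl_rel (.mul_eq_zero i j k l h)
  rw [CStarSeminorm.incl_mul] at this
  exact this

lemma MagicRel.lift_eq_zero {R : V → V → V → V → Prop} {D : Type} [CStarAlgebra D]
    (w : Matrix V V D) (hw : IsMagicUnitary w) (hR : ∀ i j k l, R i j k l → w i j * w k l = 0)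
    (r : FreeStarAlgebra (V × V)) (hr : MagicRel R r) :
    FreeStarAlgebra.lift (fun p : V × V => w p.1 p.2) r = 0 := by
  induction hr with
  | star_eq i j => rw [map_sub, StarHomClass.map_star, lift_of, hw.star_eq, sub_self]
  | mul_self i j => rw [map_sub, map_mul, lift_of, hw.mul_self, sub_self]
  | row_sum i => simp only [map_sub, map_sum, lift_of, hw.row_sum, map_one, sub_self]
  | col_sum j => simp only [map_sub, map_sum, lift_of, hw.col_sum, map_one, sub_self]
  | mul_eq_zero i j k l h => rw [map_mul, lift_of, lift_of, hR i j k l h]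

/-- The quantum permutation group given by the universal C*-algebra generated by the entries of
a magic unitary `u` with `u i j * u k l = 0` whenever `R i j k l`. -/
def magicGroup [Nonempty V] (R : V → V → V → V → Prop)
    (hR : ∀ i j k l, R i j k l → ∀ a b, R i a k b ∨ R a j b l) : QuantumPermutationGroup where
  Alg := (magicPresentation R).Alg
  Pt := V
  u := Matrix.of fun i j => (magicPresentation R).gen (i, j)
  magic := magicPresentation_magic R
  generates := by
    refine (magicPresentation R).eq_top (StarSubalgebra.isClosed_topologicalClosure _) fun x => ?_
    exact StarSubalgebra.le_topologicalClosure _ (StarAlgebra.subset_adjoin ℂ _ ⟨x, rfl⟩)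
  comul := (magicPresentation R).lift _
    (MagicRel.lift_eq_zero _ (magicPresentation_magic R).comul (by
      intro i j k l h
      simp only [Matrix.of_apply, Finset.sum_mul_sum, MinTensor.tmul_mul_tmul]
      refine Finset.sum_eq_zero fun a _ => Finset.sum_eq_zero fun b _ => ?_
      rcases hR i j k l h a b with h | h
      · rw [magicPresentation_mul_eq_zero R h, MinTensor.zero_tmul]
      · rw [magicPresentation_mul_eq_zero R h, MinTensor.tmul_zero]))
  comul_u i j := Presentation.lift_gen _ _ _ (i, j)

/-- The quantum symmetric group on `n ≥ 1` points. -/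
def quantumSymmetricGroup (n : ℕ) [NeZero n] : QuantumPermutationGroup :=
  magicGroup (V := Fin n) (fun _ _ _ _ => False) (fun _ _ _ _ h => h.elim)

/-- The quantum automorphism group of a finite graph: here `u i j * u k l = 0` if exactly one of
`i k` and `j l` is an edge. -/
def Qut [Nonempty V] (X : SimpleGraph V) : QuantumPermutationGroup :=
  magicGroup (fun i j k l => ¬(X.Adj i k ↔ X.Adj j l)) (fun i j k l h a b => by tauto)

end Qut

/-! ### Free products and free wreath products -/

section Products

open FreeStarAlgebra

variable {A B D X : Type} [CStarAlgebra A] [CStarAlgebra B] [CStarAlgebra D]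

/-- The relations that make the symbols `f a`, for `a : A`, the values of a unital
*-homomorphism. -/
inductive HomRel (f : A → FreeStarAlgebra X) : FreeStarAlgebra X → Prop
  | add (a b : A) : HomRel f (f (a + b) - (f a + f b))
  | smul (c : ℂ) (a : A) : HomRel f (f (c • a) - c • f a)
  | mul (a b : A) : HomRel f (f (a * b) - f a * f b)
  | star (a : A) : HomRel f (f (star a) - star (f a))
  | one : HomRel f (f 1 - 1)

/-- If `T` respects the relations `HomRel f`, then `T ∘ f` is a *-homomorphism. -/
def homOfRel (f : A → FreeStarAlgebra X) (T : FreeStarAlgebra X →⋆ₐ[ℂ] D)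
    (h : ∀ r, HomRel f r → T r = 0) : A →⋆ₐ[ℂ] D :=
  have hsmul (c : ℂ) (a : A) : T (f (c • a)) = c • T (f a) := by
    have := h _ (.smul c a)
    rwa [map_sub, sub_eq_zero, _root_.map_smul] at this
  have hone : T (f 1) = 1 := by
    have := h _ .one
    rwa [map_sub, sub_eq_zero, map_one] at this
  { toFun := fun a => T (f a)
    map_one' := hone
    map_mul' := fun a b => by
      have := h _ (.mul a b)
      rwa [map_sub, sub_eq_zero, map_mul] at this
    map_zero' := by simpa using hsmul 0 0
    map_add' := fun a b => by
      have := h _ (.add a b)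
      rwa [map_sub, sub_eq_zero, map_add] at this
    commutes' := fun c => by
      rw [Algebra.algebraMap_eq_smul_one, hsmul, hone, Algebra.algebraMap_eq_smul_one]
    map_star' := fun a => by
      have := h _ (.star a)
      rwa [map_sub, sub_eq_zero, StarHomClass.map_star] at this }

lemma HomRel.eq_zero {f : A → FreeStarAlgebra X} (T : FreeStarAlgebra X →⋆ₐ[ℂ] D)
    (φ : A →⋆ₐ[ℂ] D) (h : ∀ a, T (f a) = φ a) (r : FreeStarAlgebra X) (hr : HomRel f r) :
    T r = 0 := by
  induction hr with
  | add a b => rw [map_sub, map_add, h, h, h, map_add, sub_self]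
  | smul c a => rw [map_sub, _root_.map_smul, h, h, _root_.map_smul, sub_self]
  | mul a b => rw [map_sub, map_mul, h, h, h, map_mul, sub_self]
  | star a =>
    rw [map_sub, StarHomClass.map_star, h, h, StarHomClass.map_star, sub_self]
  | one => rw [map_sub, map_one, h, map_one, sub_self]

lemma HomRel.bound {f : A → FreeStarAlgebra X} (p : CStarSeminorm (FreeStarAlgebra X))
    (hp : ∀ r, HomRel f r → p r = 0) (a : A) : p (f a) ≤ ‖a‖ := by
  have h : ∀ r, HomRel f r → p.inclHom r = 0 := fun r hr => by
    rw [← norm_eq_zero, CStarSeminorm.inclHom_apply, CStarSeminorm.norm_incl, hp r hr]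
  have := NonUnitalStarAlgHom.norm_apply_le (homOfRel f p.inclHom h) a
  rw [← p.norm_incl]
  exact this

variable (A B) in
/-- The relations of the unital free product of `A` and `B`. -/
inductive FreeProdRel : FreeStarAlgebra (A ⊕ B) → Prop
  | left (r : FreeStarAlgebra (A ⊕ B)) (h : HomRel (fun a : A => of (Sum.inl a)) r) :
      FreeProdRel r
  | right (r : FreeStarAlgebra (A ⊕ B)) (h : HomRel (fun b : B => of (Sum.inr b)) r) :
      FreeProdRel r

variable (A B) in
/-- The unital free product of `A` and `B` (with amalgamation over `ℂ 1`). -/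
def freeProdPresentation : Presentation (A ⊕ B) where
  rel := FreeProdRel A B
  bounded := by
    rintro (a | b)
    · exact ⟨‖a‖, fun p hp => HomRel.bound p (fun r hr => hp r (.left r hr)) a⟩
    · exact ⟨‖b‖, fun p hp => HomRel.bound p (fun r hr => hp r (.right r hr)) b⟩

namespace FreeProd

/-- The canonical map from the first factor. -/
def inl : A →⋆ₐ[ℂ] (freeProdPresentation A B).Alg :=
  homOfRel (fun a : A => of (Sum.inl a)) (freeProdPresentation A B).seminorm.inclHom
    fun r hr => (freeProdPresentation A B).incl_rel (FreeProdRel.left r hr)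

/-- The canonical map from the second factor. -/
def inr : B →⋆ₐ[ℂ] (freeProdPresentation A B).Alg :=
  homOfRel (fun b : B => of (Sum.inr b)) (freeProdPresentation A B).seminorm.inclHom
    fun r hr => (freeProdPresentation A B).incl_rel (FreeProdRel.right r hr)

lemma rel_lift (φ : A →⋆ₐ[ℂ] D) (ψ : B →⋆ₐ[ℂ] D) (r : FreeStarAlgebra (A ⊕ B))
    (hr : FreeProdRel A B r) : FreeStarAlgebra.lift (Sum.elim φ ψ) r = 0 := by
  cases hr with
  | left h => exact HomRel.eq_zero _ φ (fun a => lift_of (Sum.elim φ ψ) (Sum.inl a)) r h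
  | right h => exact HomRel.eq_zero _ ψ (fun b => lift_of (Sum.elim φ ψ) (Sum.inr b)) r h

/-- The universal property of the free product. -/
def lift (φ : A →⋆ₐ[ℂ] D) (ψ : B →⋆ₐ[ℂ] D) : (freeProdPresentation A B).Alg →⋆ₐ[ℂ] D :=
  (freeProdPresentation A B).lift (Sum.elim φ ψ) (rel_lift φ ψ)

lemma lift_inl (φ : A →⋆ₐ[ℂ] D) (ψ : B →⋆ₐ[ℂ] D) (a : A) : lift φ ψ (inl a) = φ a :=
  Presentation.lift_gen _ _ _ (Sum.inl a)

lemma lift_inr (φ : A →⋆ₐ[ℂ] D) (ψ : B →⋆ₐ[ℂ] D) (b : B) : lift φ ψ (inr b) = ψ b :=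
  Presentation.lift_gen _ _ _ (Sum.inr b)

end FreeProd

namespace QuantumPermutationGroup

lemma map_mem_of_u_mem (G : QuantumPermutationGroup) (φ : G.Alg →⋆ₐ[ℂ] D)
    {S : StarSubalgebra ℂ D} (hS : IsClosed (S : Set D)) (hu : ∀ i j, φ (G.u i j) ∈ S)
    (x : G.Alg) : φ x ∈ S :=
  G.mem_of_u_mem (S := S.comap φ) (hS.preimage (map_continuous φ)) hu x

/-- The free product of two quantum permutation groups, with fundamental representation
`u ⊕ v`. -/
def freeProd (G H : QuantumPermutationGroup) : QuantumPermutationGroup where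
  Alg := (freeProdPresentation G.Alg H.Alg).Alg
  Pt := G.Pt ⊕ H.Pt
  u := Matrix.fromBlocks (G.u.map FreeProd.inl) 0 0 (H.u.map FreeProd.inr)
  magic := by
    constructor
    · rintro (i | i) (j | j) <;> simp [← StarHomClass.map_star, G.magic.star_eq, H.magic.star_eq]
    · rintro (i | i) (j | j) <;> simp [← map_mul, G.magic.mul_self, H.magic.mul_self]
    · rintro (i | i) <;> simp [← map_sum, G.magic.row_sum, H.magic.row_sum]
    · rintro (j | j) <;> simp [← map_sum, G.magic.col_sum, H.magic.col_sum]
  generates := by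
    refine Presentation.eq_top _ (StarSubalgebra.isClosed_topologicalClosure _) ?_
    rintro (a | b)
    · refine G.map_mem_of_u_mem FreeProd.inl (StarSubalgebra.isClosed_topologicalClosure _)
        (fun i j => ?_) a
      exact StarSubalgebra.le_topologicalClosure _
        (StarAlgebra.subset_adjoin ℂ _ ⟨(Sum.inl i, Sum.inl j), rfl⟩)
    · refine H.map_mem_of_u_mem FreeProd.inr (StarSubalgebra.isClosed_topologicalClosure _)
        (fun i j => ?_) b
      exact StarSubalgebra.le_topologicalClosure _
        (StarAlgebra.subset_adjoin ℂ _ ⟨(Sum.inr i, Sum.inr j), rfl⟩)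
  comul := FreeProd.lift ((MinTensor.map FreeProd.inl FreeProd.inl).comp G.comul)
    ((MinTensor.map FreeProd.inr FreeProd.inr).comp H.comul)
  comul_u := by
    rintro (i | i) (j | j)
    · simp [FreeProd.lift_inl, G.comul_u, MinTensor.zero_tmul]
    · simp [MinTensor.zero_tmul, MinTensor.tmul_zero]
    · simp [MinTensor.zero_tmul, MinTensor.tmul_zero]
    · simp [FreeProd.lift_inr, H.comul_u, MinTensor.zero_tmul]

end QuantumPermutationGroup

/-- A *-homomorphism `x ↦ ∑ c, φ c x * q c` obtained from *-homomorphisms `φ c` and projections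
`q c` that commute with them and sum to `1`. -/
def sumHom {J : Type} [Fintype J] (φ : J → A →⋆ₐ[ℂ] D) (q : J → D) (hs : ∀ c, star (q c) = q c)
    (hm : ∀ c, q c * q c = q c) (h1 : ∑ c, q c = 1) (hc : ∀ c x, Commute (φ c x) (q c)) :
    A →⋆ₐ[ℂ] D where
  toFun x := ∑ c, φ c x * q c
  map_one' := by simp [h1]
  map_mul' x y := by
    rw [Finset.sum_mul_sum]
    refine Finset.sum_congr rfl fun c _ => ?_
    rw [Finset.sum_eq_single c]
    · rw [map_mul, mul_assoc, mul_assoc, ← mul_assoc (q c), ← (hc c y).eq, mul_assoc, hm]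
    · intro d _ hd
      rw [(hc d y).eq, mul_assoc, ← mul_assoc (q c), orthogonal_of_sum_eq_one q hs hm h1 hd.symm,
        zero_mul, mul_zero]
    · intro h; exact absurd (Finset.mem_univ c) h
  map_zero' := by simp
  map_add' x y := by simp [add_mul, Finset.sum_add_distrib]
  commutes' z := by
    simp only [AlgHomClass.commutes]
    rw [← Finset.mul_sum, h1, mul_one]
  map_star' x := by
    simp only [star_sum, star_mul, hs, StarHomClass.map_star]
    exact Finset.sum_congr rfl fun c _ => (hs c ▸ (hc c x).star_star).eq

namespace QuantumPermutationGroup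

variable (G H : QuantumPermutationGroup)

/-- The relations of the free wreath product algebra: a copy `ν a : C(G) → ·` for each point `a`
of `H`, a copy of `C(H)`, and `ν a (u i j)` commutes with `v a b`. -/
inductive WreathRel : FreeStarAlgebra ((H.Pt × G.Alg) ⊕ H.Alg) → Prop
  | left (a : H.Pt) (r : FreeStarAlgebra ((H.Pt × G.Alg) ⊕ H.Alg))
      (h : HomRel (fun x : G.Alg => of (Sum.inl (a, x))) r) : WreathRel r
  | right (r : FreeStarAlgebra ((H.Pt × G.Alg) ⊕ H.Alg))
      (h : HomRel (fun y : H.Alg => of (Sum.inr y)) r) : WreathRel r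
  | comm (i j : G.Pt) (a b : H.Pt) :
      WreathRel (of (Sum.inl (a, G.u i j)) * of (Sum.inr (H.u a b))
        - of (Sum.inr (H.u a b)) * of (Sum.inl (a, G.u i j)))

/-- The algebra `(C(G) * ⋯ * C(G) * C(H)) / ⟨[u i j ^ (a), v a b] = 0⟩`. -/
def wreathPresentation : Presentation ((H.Pt × G.Alg) ⊕ H.Alg) where
  rel := WreathRel G H
  bounded := by
    rintro (⟨a, x⟩ | y)
    · exact ⟨‖x‖, fun p hp => HomRel.bound p (fun r hr => hp r (.left a r hr)) x⟩
    · exact ⟨‖y‖, fun p hp => HomRel.bound p (fun r hr => hp r (.right r hr)) y⟩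

namespace Wreath

variable {G H}

/-- The copy of `C(G)` at the point `a`. -/
def inl (a : H.Pt) : G.Alg →⋆ₐ[ℂ] (wreathPresentation G H).Alg :=
  homOfRel (fun x : G.Alg => of (Sum.inl (a, x))) (wreathPresentation G H).seminorm.inclHom
    fun r hr => (wreathPresentation G H).incl_rel (WreathRel.left a r hr)

/-- The copy of `C(H)`. -/
def inr : H.Alg →⋆ₐ[ℂ] (wreathPresentation G H).Alg :=
  homOfRel (fun y : H.Alg => of (Sum.inr y)) (wreathPresentation G H).seminorm.inclHom
    fun r hr => (wreathPresentation G H).incl_rel (WreathRel.right r hr)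

lemma commute_u (i j : G.Pt) (a b : H.Pt) :
    Commute (inl a (G.u i j) : (wreathPresentation G H).Alg) (inr (H.u a b)) := by
  have := (wreathPresentation G H).incl_rel (WreathRel.comm i j a b)
  rw [← CStarSeminorm.inclHom_apply, map_sub, sub_eq_zero, map_mul, map_mul] at this
  exact this

lemma commute (x : G.Alg) (a b : H.Pt) :
    Commute (inl a x : (wreathPresentation G H).Alg) (inr (H.u a b)) := by
  have hs : star (inr (H.u a b) : (wreathPresentation G H).Alg) = inr (H.u a b) := by
    rw [← StarHomClass.map_star, H.magic.star_eq]
  have h := G.map_mem_of_u_mem (inl a)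
    (S := StarSubalgebra.centralizer ℂ {(inr (H.u a b) : (wreathPresentation G H).Alg)})
    (by
      rw [StarSubalgebra.coe_centralizer]
      exact Set.isClosed_centralizer _)
    (fun i j => by
      rw [StarSubalgebra.mem_centralizer_iff]
      rintro _ rfl
      rw [hs]
      exact ⟨(commute_u i j a b).eq.symm, (commute_u i j a b).eq.symm⟩) x
  rw [StarSubalgebra.mem_centralizer_iff] at h
  exact (h _ rfl).1.symm

lemma rel_lift (φ : H.Pt → G.Alg →⋆ₐ[ℂ] D) (ψ : H.Alg →⋆ₐ[ℂ] D)
    (h : ∀ i j a b, Commute (φ a (G.u i j)) (ψ (H.u a b)))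
    (r : FreeStarAlgebra ((H.Pt × G.Alg) ⊕ H.Alg)) (hr : WreathRel G H r) :
    FreeStarAlgebra.lift (Sum.elim (fun p : H.Pt × G.Alg => φ p.1 p.2) ψ) r = 0 := by
  cases hr with
  | left a _ h => exact HomRel.eq_zero _ (φ a) (fun x => lift_of _ (Sum.inl (a, x))) r h
  | right _ h => exact HomRel.eq_zero _ ψ (fun y => lift_of _ (Sum.inr y)) r h
  | comm i j a b =>
    rw [map_sub, map_mul, map_mul, lift_of, lift_of, sub_eq_zero]
    exact (h i j a b).eq

/-- The universal property of the free wreath product algebra. -/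
def lift (φ : H.Pt → G.Alg →⋆ₐ[ℂ] D) (ψ : H.Alg →⋆ₐ[ℂ] D)
    (h : ∀ i j a b, Commute (φ a (G.u i j)) (ψ (H.u a b))) :
    (wreathPresentation G H).Alg →⋆ₐ[ℂ] D :=
  (wreathPresentation G H).lift (Sum.elim (fun p : H.Pt × G.Alg => φ p.1 p.2) ψ) (rel_lift φ ψ h)

lemma lift_inl (φ : H.Pt → G.Alg →⋆ₐ[ℂ] D) (ψ : H.Alg →⋆ₐ[ℂ] D)
    (h : ∀ i j a b, Commute (φ a (G.u i j)) (ψ (H.u a b))) (a : H.Pt) (x : G.Alg) :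
    lift φ ψ h (inl a x) = φ a x :=
  Presentation.lift_gen _ _ _ (Sum.inl (a, x))

lemma lift_inr (φ : H.Pt → G.Alg →⋆ₐ[ℂ] D) (ψ : H.Alg →⋆ₐ[ℂ] D)
    (h : ∀ i j a b, Commute (φ a (G.u i j)) (ψ (H.u a b))) (y : H.Alg) :
    lift φ ψ h (inr y) = ψ y :=
  Presentation.lift_gen _ _ _ (Sum.inr y)

variable (G H) in
/-- The matrix `w (i, a) (j, b) = u i j ^ (a) * v a b`. -/
def mat : Matrix (G.Pt × H.Pt) (G.Pt × H.Pt) (wreathPresentation G H).Alg :=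
  Matrix.of fun p q => inl p.2 (G.u p.1 q.1) * inr (H.u p.2 q.2)

lemma inl_eq (i j : G.Pt) (a : H.Pt) :
    (inl a (G.u i j) : (wreathPresentation G H).Alg) = ∑ b, mat G H (i, a) (j, b) := by
  simp only [mat, Matrix.of_apply]
  rw [← Finset.mul_sum, ← map_sum, H.magic.row_sum, map_one, mul_one]

lemma inr_eq (i : G.Pt) (a b : H.Pt) :
    (inr (H.u a b) : (wreathPresentation G H).Alg) = ∑ j, mat G H (i, a) (j, b) := by
  simp only [mat, Matrix.of_apply]
  rw [← Finset.sum_mul, ← map_sum, G.magic.row_sum, map_one, one_mul]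

lemma mat_magic : IsMagicUnitary (mat G H) where
  star_eq p q := by
    rw [mat, Matrix.of_apply, star_mul, ← StarHomClass.map_star, ← StarHomClass.map_star,
      G.magic.star_eq, H.magic.star_eq, (commute _ _ _).eq]
  mul_self p q := by
    rw [mat, Matrix.of_apply, (commute _ _ _).symm.mul_mul_mul_comm, ← map_mul, ← map_mul,
      G.magic.mul_self, H.magic.mul_self]
  row_sum p := by
    rw [Fintype.sum_prod_type]
    obtain ⟨i, a⟩ := p
    simp only [← inl_eq]
    rw [← map_sum, G.magic.row_sum, map_one]
  col_sum q := by
    rw [Fintype.sum_prod_type_right]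
    simp only [mat, Matrix.of_apply, ← Finset.sum_mul, ← map_sum, G.magic.col_sum, map_one,
      one_mul, H.magic.col_sum]

lemma commute_tensor (a c : H.Pt) (t : MinTensor G.Alg G.Alg) :
    Commute (MinTensor.map (inl a) (inl c) t)
      (MinTensor.tmul (inr (H.u a c)) (1 : (wreathPresentation G H).Alg)) := by
  induction t using MinTensor.induction with
  | hP =>
    simp only [commute_iff_eq]
    have := map_continuous (MinTensor.map (inl a) (inl c) :
      MinTensor G.Alg G.Alg →⋆ₐ[ℂ]
        MinTensor (wreathPresentation G H).Alg (wreathPresentation G H).Alg)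
    exact isClosed_eq (by fun_prop) (by fun_prop)
  | h0 => rw [map_zero]; exact Commute.zero_left _
  | ht x y =>
    rw [MinTensor.map_tmul, commute_iff_eq, MinTensor.tmul_mul_tmul, MinTensor.tmul_mul_tmul,
      (commute x a c).eq, one_mul, mul_one]
  | ha s t hs ht => rw [map_add]; exact hs.add_left ht

/-- The comultiplication on the copy of `C(G)` at `a`:
`ν a x ↦ ∑ c, (ν a ⊗ ν c)(Δ x) (v a c ⊗ 1)`. -/
def comulLeft (a : H.Pt) : G.Alg →⋆ₐ[ℂ]
    MinTensor (wreathPresentation G H).Alg (wreathPresentation G H).Alg :=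
  sumHom (fun c => (MinTensor.map (inl a) (inl c)).comp G.comul)
    (fun c => MinTensor.tmul (inr (H.u a c)) 1)
    (fun c => by
      rw [MinTensor.star_tmul, ← StarHomClass.map_star, H.magic.star_eq, star_one])
    (fun c => by rw [MinTensor.tmul_mul_tmul, ← map_mul, H.magic.mul_self, one_mul])
    (by rw [← MinTensor.sum_tmul, ← map_sum, H.magic.row_sum, map_one, MinTensor.one_tmul_one])
    (fun c x => commute_tensor a c _)

lemma comulLeft_u (a : H.Pt) (i j : G.Pt) :
    comulLeft a (G.u i j) = ∑ c : H.Pt, ∑ k,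
      MinTensor.tmul (inl a (G.u i k) * inr (H.u a c) : (wreathPresentation G H).Alg)
        (inl c (G.u k j)) := by
  change ∑ c : H.Pt, MinTensor.map (inl a) (inl c) (G.comul (G.u i j)) *
    MinTensor.tmul (inr (H.u a c)) 1 = _
  simp only [G.comul_u, map_sum, MinTensor.map_tmul, Finset.sum_mul, MinTensor.tmul_mul_tmul,
    mul_one]

/-- The comultiplication on the copy of `C(H)`. -/
def comulRight : H.Alg →⋆ₐ[ℂ]
    MinTensor (wreathPresentation G H).Alg (wreathPresentation G H).Alg :=
  (MinTensor.map inr inr).comp H.comul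

lemma comulRight_u (a b : H.Pt) :
    comulRight (H.u a b) = ∑ c, MinTensor.tmul (inr (H.u a c) : (wreathPresentation G H).Alg)
      (inr (H.u c b)) := by
  change MinTensor.map inr inr (H.comul (H.u a b)) = _
  simp only [H.comul_u, map_sum, MinTensor.map_tmul]

lemma comulLeft_mul_comulRight (i j : G.Pt) (a b : H.Pt) :
    comulLeft a (G.u i j) * comulRight (H.u a b) =
      ∑ c, ∑ k, MinTensor.tmul (mat G H (i, a) (k, c)) (mat G H (k, c) (j, b)) := by
  rw [comulLeft_u, comulRight_u, Finset.sum_mul_sum]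
  refine Finset.sum_congr rfl fun c _ => ?_
  rw [Finset.sum_eq_single c]
  · rw [Finset.sum_mul]
    refine Finset.sum_congr rfl fun k _ => ?_
    rw [MinTensor.tmul_mul_tmul, mul_assoc, ← map_mul, H.magic.mul_self]
    rfl
  · intro d _ hd
    rw [Finset.sum_mul]
    refine Finset.sum_eq_zero fun k _ => ?_
    rw [MinTensor.tmul_mul_tmul, mul_assoc, ← map_mul, H.magic.row_orthogonal a hd.symm,
      map_zero, mul_zero, MinTensor.zero_tmul]
  · intro h; exact absurd (Finset.mem_univ c) h

lemma commute_comul (i j : G.Pt) (a b : H.Pt) :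
    Commute (comulLeft a (G.u i j) : MinTensor (wreathPresentation G H).Alg
      (wreathPresentation G H).Alg) (comulRight (H.u a b)) := by
  have h := congrArg star (comulLeft_mul_comulRight (G := G) (H := H) i j a b)
  rw [star_mul, ← StarHomClass.map_star, ← StarHomClass.map_star, G.magic.star_eq,
    H.magic.star_eq] at h
  rw [commute_iff_eq, h, comulLeft_mul_comulRight]
  simp only [star_sum, MinTensor.star_tmul, mat_magic.star_eq]

end Wreath

/-- The free wreath product of `G` by `H`, with fundamental representation
`w (i, a) (j, b) = u i j ^ (a) * v a b`. -/
def freeWreath : QuantumPermutationGroup where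
  Alg := (wreathPresentation G H).Alg
  Pt := G.Pt × H.Pt
  u := Wreath.mat G H
  magic := Wreath.mat_magic
  generates := by
    have hmem : ∀ p q, Wreath.mat G H p q ∈ (StarAlgebra.adjoin ℂ (Set.range
        fun p : (G.Pt × H.Pt) × (G.Pt × H.Pt) => Wreath.mat G H p.1 p.2)).topologicalClosure :=
      fun p q => StarSubalgebra.le_topologicalClosure _
        (StarAlgebra.subset_adjoin ℂ _ ⟨(p, q), rfl⟩)
    refine Presentation.eq_top _ (StarSubalgebra.isClosed_topologicalClosure _) ?_
    rintro (⟨a, x⟩ | y)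
    · refine G.map_mem_of_u_mem (Wreath.inl a) (StarSubalgebra.isClosed_topologicalClosure _)
        (fun i j => ?_) x
      rw [Wreath.inl_eq]
      exact sum_mem fun b _ => hmem _ _
    · refine H.map_mem_of_u_mem Wreath.inr (StarSubalgebra.isClosed_topologicalClosure _)
        (fun a b => ?_) y
      rw [Wreath.inr_eq (Classical.arbitrary G.Pt)]
      exact sum_mem fun j _ => hmem _ _
  comul := Wreath.lift Wreath.comulLeft Wreath.comulRight Wreath.commute_comul
  comul_u := by
    rintro ⟨i, a⟩ ⟨j, b⟩
    rw [Fintype.sum_prod_type_right, ← Wreath.comulLeft_mul_comulRight, Wreath.mat,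
      Matrix.of_apply, map_mul, Wreath.lift_inl, Wreath.lift_inr]

end QuantumPermutationGroup

end Products

/-! ### The two classes of quantum groups -/

/-- A class of quantum permutation groups, closed under isomorphism, that contains the trivial
quantum group and is closed under free products and under free wreath products by quantum
symmetric groups. -/
structure IsJordanClass (C : Set QuantumPermutationGroup) : Prop where
  iso : ∀ G H, G.Iso H → G ∈ C → H ∈ C
  one : QuantumPermutationGroup.one ∈ C
  freeProd : ∀ G H, G ∈ C → H ∈ C → G.freeProd H ∈ C
  freeWreath : ∀ (G) (n : ℕ) [NeZero n], G ∈ C → G.freeWreath (quantumSymmetricGroup n) ∈ C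

/-- The quantum permutation groups that are isomorphic to the quantum automorphism group of a
finite tree. -/
def treeQut : Set QuantumPermutationGroup :=
  {G | ∃ (V : Type) (_ : Fintype V) (_ : Nonempty V) (X : SimpleGraph V), X.IsTree ∧ G.Iso (Qut X)}

end QAut

end

/-!
The proof passes from trees to rooted forests, for which the quantum automorphism group is defined
by the magic unitaries that preserve the relation "`k` is the parent of `i`". Both inclusions
follow once the quantum automorphism groups of trees and of rooted forests are known to be the
same groups.

*From trees to forests* (`Qut_iso_ofTree`). A magic unitary that preserves the adjacency relation
of a connected graph preserves the distance, hence the sum `f v` of the distances from `v` to all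
vertices. On a tree `f` is strictly convex along paths. So every vertex has at most one neighbour
`w` with `f w ≤ f v`; calling it the parent if `f w < f v` makes the tree a rooted forest, whose
roots are the one or two centroids, which are adjacent. As `f` is preserved, a magic unitary
preserves the tree if and only if it preserves the forest.

*From forests to trees* (`Forest.qut_mem_treeQut`). A new common parent of all roots does not
change the quantum automorphism group (`Forest.qut_iso_addRoot`), and neither does a disjoint path
that is higher than all other components, as this amounts to a free product with the trivial
group. With enough such paths the new root becomes the unique vertex of maximal degree of the
resulting tree. Then it is fixed by every magic unitary that preserves the graph, so that the
parent relation is preserved as well (`Forest.par_of_graph`).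

*Operations*. A magic unitary that preserves a forest acts on its components through the entries
that are indexed by the roots (`Forest.mul_root`). Consequently a disjoint union of two forests
without nonzero mixed entries gives a free product (`Forest.qut_iso_freeProd`), and `n` copies of
a tree give a free wreath product by the quantum symmetric group (`Forest.qut_iso_freeWreath`).
Since the components of two forests can be made to differ in height, the class of forest groups
has the closure properties.

*Minimality* (`Forest.qut_mem_of_isJordanClass`). The nonvanishing of the entries of the universal
magic unitary generates an equivalence relation on the vertices. By the counting argument
`IsMagicUnitary.sum_eq`, equivalent vertices have equally many children in each class, so that
components with equivalent roots are isomorphic (`Forest.exists_equiv_copies`). By induction on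
the number of vertices, every forest is therefore decomposed by the three operations: split off a
class of components, pass to one of several isomorphic trees, or remove the root of a single tree.
-/

noncomputable section

open scoped TensorProduct CStarAlgebra

namespace QAut

open QuantumPermutationGroup

/-! ### Homomorphisms and isomorphisms of quantum permutation groups -/

namespace MinTensor

variable {A A' A'' B B' B'' : Type} [CStarAlgebra A] [CStarAlgebra A'] [CStarAlgebra A'']
  [CStarAlgebra B] [CStarAlgebra B'] [CStarAlgebra B'']

lemma map_map (φ : A →⋆ₐ[ℂ] A') (φ' : A' →⋆ₐ[ℂ] A'') (ψ : B →⋆ₐ[ℂ] B') (ψ' : B' →⋆ₐ[ℂ] B'')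
    (t : MinTensor A B) :
    map φ' ψ' (map φ ψ t) = map (φ'.comp φ) (ψ'.comp ψ) t := by
  induction t using MinTensor.induction with
  | hP =>
    have h1 := map_continuous (map φ ψ : MinTensor A B →⋆ₐ[ℂ] MinTensor A' B')
    have h2 := map_continuous (map φ' ψ' : MinTensor A' B' →⋆ₐ[ℂ] MinTensor A'' B'')
    have h3 := map_continuous
      (map (φ'.comp φ) (ψ'.comp ψ) : MinTensor A B →⋆ₐ[ℂ] MinTensor A'' B'')
    exact isClosed_eq (h2.comp h1) h3
  | h0 => simp
  | ht a b => simp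
  | ha s t hs ht => rw [map_add, map_add, map_add, hs, ht]

lemma map_id (t : MinTensor A B) :
    map (StarAlgHom.id ℂ A) (StarAlgHom.id ℂ B) t = t := by
  induction t using MinTensor.induction with
  | hP =>
    have h1 := map_continuous
      (map (StarAlgHom.id ℂ A) (StarAlgHom.id ℂ B) : MinTensor A B →⋆ₐ[ℂ] MinTensor A B)
    exact isClosed_eq h1 continuous_id
  | h0 => simp
  | ht a b => simp
  | ha s t hs ht => rw [map_add, hs, ht]

end MinTensor

namespace QuantumPermutationGroup

variable {G H K : QuantumPermutationGroup}

/-- A *-homomorphism is determined by its values on the entries of the fundamental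
representation. -/
lemma hom_ext {D : Type} [CStarAlgebra D] {f g : G.Alg →⋆ₐ[ℂ] D}
    (h : ∀ i j, f (G.u i j) = g (G.u i j)) : f = g := by
  ext x
  exact G.mem_of_u_mem (S := StarAlgHom.equalizer f g)
    (isClosed_eq (map_continuous f) (map_continuous g)) h x

lemma Iso.of_comp {φ : G.Alg →⋆ₐ[ℂ] H.Alg} {ψ : H.Alg →⋆ₐ[ℂ] G.Alg}
    (h₁ : ψ.comp φ = StarAlgHom.id ℂ _) (h₂ : φ.comp ψ = StarAlgHom.id ℂ _)
    (hΔ : (MinTensor.map φ φ).comp G.comul = H.comul.comp φ) : G.Iso H :=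
  ⟨StarAlgEquiv.ofStarAlgHom φ ψ h₁ h₂, fun x => DFunLike.congr_fun hΔ x⟩

/-- The matrix `u` serves as a fundamental representation of `G`: it is a magic unitary,
homomorphisms are determined by its entries, and the comultiplication has the usual form on it.
The index set need not be `G.Pt`, which lets the points of a composite quantum group be named
explicitly. -/
structure IsFundamental (G : QuantumPermutationGroup) {ι : Type} [Fintype ι]
    (u : Matrix ι ι G.Alg) : Prop where
  magic : IsMagicUnitary u
  hom_ext : ∀ {D : Type} [CStarAlgebra D] {f g : G.Alg →⋆ₐ[ℂ] D},
    (∀ i j, f (u i j) = g (u i j)) → f = g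
  comul : ∀ i j, G.comul (u i j) = ∑ k, MinTensor.tmul (u i k) (u k j)

lemma isFundamental (G : QuantumPermutationGroup) : G.IsFundamental G.u :=
  ⟨G.magic, hom_ext, G.comul_u⟩

section

variable {ι κ : Type} [Fintype ι] [Fintype κ] {u : Matrix ι ι G.Alg} {v : Matrix κ κ H.Alg}

/-- Mutually inverse *-homomorphisms give an isomorphism; everything can be checked on the entries
of fundamental representations. -/
lemma Iso.of_hom (hu : G.IsFundamental u) (hv : H.IsFundamental v)
    (φ : G.Alg →⋆ₐ[ℂ] H.Alg) (ψ : H.Alg →⋆ₐ[ℂ] G.Alg)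
    (h₁ : ∀ i j, ψ (φ (u i j)) = u i j) (h₂ : ∀ i j, φ (ψ (v i j)) = v i j)
    (hΔ : ∀ i j, MinTensor.map φ φ (G.comul (u i j)) = H.comul (φ (u i j))) : G.Iso H :=
  Iso.of_comp (hu.hom_ext h₁) (hv.hom_ext h₂) (hu.hom_ext hΔ)

/-- If the *-homomorphisms match fundamental representations up to a bijection between the
points, then the comultiplications correspond automatically. -/
lemma Iso.of_equiv (hu : G.IsFundamental u) (hv : H.IsFundamental v) (e : ι ≃ κ)
    (φ : G.Alg →⋆ₐ[ℂ] H.Alg) (ψ : H.Alg →⋆ₐ[ℂ] G.Alg)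
    (hφ : ∀ i j, φ (u i j) = v (e i) (e j)) (hψ : ∀ i j, ψ (v (e i) (e j)) = u i j) :
    G.Iso H := by
  refine Iso.of_hom hu hv φ ψ (fun i j => by rw [hφ, hψ]) (fun i j => ?_) (fun i j => ?_)
  · obtain ⟨i, rfl⟩ := e.surjective i
    obtain ⟨j, rfl⟩ := e.surjective j
    rw [hψ, hφ]
  · rw [hφ, hv.comul, hu.comul, map_sum, ← e.sum_comp]
    simp only [MinTensor.map_tmul, hφ]

end

lemma Iso.exists_hom (h : G.Iso H) : ∃ (φ : G.Alg →⋆ₐ[ℂ] H.Alg) (ψ : H.Alg →⋆ₐ[ℂ] G.Alg),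
    ψ.comp φ = StarAlgHom.id ℂ _ ∧ φ.comp ψ = StarAlgHom.id ℂ _ ∧
      ∀ x, MinTensor.map φ φ (G.comul x) = H.comul (φ x) := by
  obtain ⟨e, he⟩ := h
  refine ⟨e, e.symm, ?_, ?_, he⟩
  · ext x; exact e.symm_apply_apply x
  · ext x; exact e.apply_symm_apply x

lemma Iso.symm (h : G.Iso H) : H.Iso G := by
  obtain ⟨φ, ψ, h₁, h₂, hΔ⟩ := h.exists_hom
  refine Iso.of_comp h₂ h₁ ?_
  ext y
  obtain ⟨x, rfl⟩ : ∃ x, φ x = y := ⟨ψ y, DFunLike.congr_fun h₂ y⟩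
  have hx : ψ (φ x) = x := DFunLike.congr_fun h₁ x
  simp only [StarAlgHom.comp_apply, hx, ← hΔ, MinTensor.map_map, h₁, MinTensor.map_id]

lemma Iso.trans (h : G.Iso H) (h' : H.Iso K) : G.Iso K := by
  obtain ⟨φ, ψ, h₁, h₂, hΔ⟩ := h.exists_hom
  obtain ⟨φ', ψ', h₁', h₂', hΔ'⟩ := h'.exists_hom
  refine Iso.of_comp (φ := φ'.comp φ) (ψ := ψ.comp ψ') ?_ ?_ ?_
  · ext x
    exact (congrArg ψ (DFunLike.congr_fun h₁' (φ x))).trans (DFunLike.congr_fun h₁ x)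
  · ext x
    exact (congrArg φ' (DFunLike.congr_fun h₂ (ψ' x))).trans (DFunLike.congr_fun h₂' x)
  · ext x
    simp only [StarAlgHom.comp_apply, ← hΔ', ← hΔ, MinTensor.map_map]

/-! ### Free products and free wreath products respect isomorphism -/

/-- The canonical map from the function algebra of the first factor of a free product. -/
def freeProdInl : G.Alg →⋆ₐ[ℂ] (G.freeProd H).Alg :=
  FreeProd.inl (A := G.Alg) (B := H.Alg)

/-- The canonical map from the function algebra of the second factor of a free product. -/
def freeProdInr : H.Alg →⋆ₐ[ℂ] (G.freeProd H).Alg :=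
  FreeProd.inr (A := G.Alg) (B := H.Alg)

/-- The universal property of the free product, for quantum permutation groups. -/
def freeProdLift {D : Type} [CStarAlgebra D] (φ : G.Alg →⋆ₐ[ℂ] D) (ψ : H.Alg →⋆ₐ[ℂ] D) :
    (G.freeProd H).Alg →⋆ₐ[ℂ] D :=
  FreeProd.lift φ ψ

lemma freeProdLift_inl {D : Type} [CStarAlgebra D] (φ : G.Alg →⋆ₐ[ℂ] D) (ψ : H.Alg →⋆ₐ[ℂ] D)
    (x : G.Alg) : freeProdLift φ ψ (freeProdInl x) = φ x :=
  FreeProd.lift_inl φ ψ x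

lemma freeProdLift_inr {D : Type} [CStarAlgebra D] (φ : G.Alg →⋆ₐ[ℂ] D) (ψ : H.Alg →⋆ₐ[ℂ] D)
    (y : H.Alg) : freeProdLift φ ψ (freeProdInr y) = ψ y :=
  FreeProd.lift_inr φ ψ y

lemma freeProd_hom_ext {D : Type} [CStarAlgebra D] {f g : (G.freeProd H).Alg →⋆ₐ[ℂ] D}
    (hl : ∀ x, f (freeProdInl x) = g (freeProdInl x))
    (hr : ∀ y, f (freeProdInr y) = g (freeProdInr y)) : f = g := by
  refine hom_ext ?_
  rintro (i | i) (j | j)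
  · exact hl (G.u i j)
  · exact (map_zero f).trans (map_zero g).symm
  · exact (map_zero f).trans (map_zero g).symm
  · exact hr (H.u i j)

lemma freeProd_comul_inl (x : G.Alg) : (G.freeProd H).comul (freeProdInl x) =
    MinTensor.map freeProdInl freeProdInl (G.comul x) :=
  FreeProd.lift_inl _ _ x

lemma freeProd_comul_inr (y : H.Alg) : (G.freeProd H).comul (freeProdInr y) =
    MinTensor.map freeProdInr freeProdInr (H.comul y) :=
  FreeProd.lift_inr _ _ y

lemma IsFundamental.freeProd {ι κ : Type} [Fintype ι] [Fintype κ] {u : Matrix ι ι G.Alg}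
    {v : Matrix κ κ H.Alg} (hu : G.IsFundamental u) (hv : H.IsFundamental v) :
    (G.freeProd H).IsFundamental
      (Matrix.fromBlocks (u.map freeProdInl) 0 0 (v.map freeProdInr)) where
  magic := by
    constructor
    · rintro (i | i) (j | j) <;> simp [← StarHomClass.map_star, hu.magic.star_eq, hv.magic.star_eq]
    · rintro (i | i) (j | j) <;> simp [← map_mul, hu.magic.mul_self, hv.magic.mul_self]
    · rintro (i | i) <;> simp [← map_sum, hu.magic.row_sum, hv.magic.row_sum]
    · rintro (j | j) <;> simp [← map_sum, hu.magic.col_sum, hv.magic.col_sum]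
  hom_ext {D} _ f g h := by
    have hl : f.comp freeProdInl = g.comp freeProdInl := hu.hom_ext fun i j => h (.inl i) (.inl j)
    have hr : f.comp freeProdInr = g.comp freeProdInr := hv.hom_ext fun i j => h (.inr i) (.inr j)
    exact freeProd_hom_ext (DFunLike.congr_fun hl) (DFunLike.congr_fun hr)
  comul := by
    rintro (i | i) (j | j)
    · simp [freeProd_comul_inl, hu.comul, MinTensor.zero_tmul]
    · simp [MinTensor.zero_tmul, MinTensor.tmul_zero]
    · simp [MinTensor.zero_tmul, MinTensor.tmul_zero]
    · simp [freeProd_comul_inr, hv.comul, MinTensor.zero_tmul]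

lemma Iso.freeProd {G' H' : QuantumPermutationGroup} (hG : G.Iso G') (hH : H.Iso H') :
    (G.freeProd H).Iso (G'.freeProd H') := by
  obtain ⟨φ, φ', h₁, h₂, hΔ⟩ := hG.exists_hom
  obtain ⟨ψ, ψ', k₁, k₂, kΔ⟩ := hH.exists_hom
  have h₁ := DFunLike.congr_fun h₁
  have h₂ := DFunLike.congr_fun h₂
  have k₁ := DFunLike.congr_fun k₁
  have k₂ := DFunLike.congr_fun k₂
  simp only [StarAlgHom.comp_apply, StarAlgHom.coe_id, id] at h₁ h₂ k₁ k₂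
  let F : (G.freeProd H).Alg →⋆ₐ[ℂ] (G'.freeProd H').Alg :=
    freeProdLift (freeProdInl.comp φ) (freeProdInr.comp ψ)
  let F' : (G'.freeProd H').Alg →⋆ₐ[ℂ] (G.freeProd H).Alg :=
    freeProdLift (freeProdInl.comp φ') (freeProdInr.comp ψ')
  have Fl (x) : F (freeProdInl x) = freeProdInl (φ x) := freeProdLift_inl _ _ x
  have Fr (x) : F (freeProdInr x) = freeProdInr (ψ x) := freeProdLift_inr _ _ x
  have Fl' (x) : F' (freeProdInl x) = freeProdInl (φ' x) := freeProdLift_inl _ _ x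
  have Fr' (x) : F' (freeProdInr x) = freeProdInr (ψ' x) := freeProdLift_inr _ _ x
  have Flc : F.comp freeProdInl = freeProdInl.comp φ := by ext x; exact Fl x
  have Frc : F.comp freeProdInr = freeProdInr.comp ψ := by ext x; exact Fr x
  refine Iso.of_comp (φ := F) (ψ := F') ?_ ?_ ?_
  · refine freeProd_hom_ext (fun a => ?_) (fun a => ?_)
    · change F' (F _) = _
      rw [Fl, Fl', h₁]; rfl
    · change F' (F _) = _
      rw [Fr, Fr', k₁]; rfl
  · refine freeProd_hom_ext (fun a => ?_) (fun a => ?_)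
    · change F (F' _) = _
      rw [Fl', Fl, h₂]; rfl
    · change F (F' _) = _
      rw [Fr', Fr, k₂]; rfl
  · refine freeProd_hom_ext (fun a => ?_) (fun a => ?_)
    · change MinTensor.map F F ((G.freeProd H).comul _) = (G'.freeProd H').comul (F _)
      rw [Fl, freeProd_comul_inl, freeProd_comul_inl, MinTensor.map_map, ← hΔ, MinTensor.map_map,
        Flc]
    · change MinTensor.map F F ((G.freeProd H).comul _) = (G'.freeProd H').comul (F _)
      rw [Fr, freeProd_comul_inr, freeProd_comul_inr, MinTensor.map_map, ← kΔ, MinTensor.map_map,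
        Frc]

lemma freeProd_one_iso (G : QuantumPermutationGroup) : (G.freeProd one).Iso G := by
  let F : (G.freeProd one).Alg →⋆ₐ[ℂ] G.Alg :=
    freeProdLift (StarAlgHom.id ℂ G.Alg) (StarAlgHom.ofId ℂ G.Alg)
  have Fl (x) : F (freeProdInl x) = x := freeProdLift_inl _ _ x
  have hr (f g : (one.Alg) →⋆ₐ[ℂ] (G.freeProd one).Alg) : f = g :=
    hom_ext (G := one) fun i j => (map_one f).trans (map_one g).symm
  have hlc : F.comp freeProdInl = StarAlgHom.id ℂ _ := by ext x; exact Fl x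
  refine (Iso.of_comp (G := G) (H := G.freeProd one) (φ := freeProdInl) (ψ := F) hlc ?_ ?_).symm
  · refine freeProd_hom_ext (fun a => ?_) (fun a => ?_)
    · change freeProdInl (F _) = _
      rw [Fl]; rfl
    · exact DFunLike.congr_fun (hr (((freeProdInl).comp F).comp freeProdInr) freeProdInr) a
  · ext x
    exact (freeProd_comul_inl x).symm

/-- The canonical map from the copy of the function algebra of `G` at the point `a`. -/
def wreathInl (a : H.Pt) : G.Alg →⋆ₐ[ℂ] (G.freeWreath H).Alg :=
  Wreath.inl (G := G) (H := H) a

/-- The canonical map from the function algebra of `H` to that of a free wreath product by `H`. -/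
def wreathInr : H.Alg →⋆ₐ[ℂ] (G.freeWreath H).Alg :=
  Wreath.inr (G := G) (H := H)

/-- The universal property of the free wreath product, for quantum permutation groups. -/
def wreathLift {D : Type} [CStarAlgebra D] (φ : H.Pt → G.Alg →⋆ₐ[ℂ] D) (ψ : H.Alg →⋆ₐ[ℂ] D)
    (h : ∀ i j a b, Commute (φ a (G.u i j)) (ψ (H.u a b))) : (G.freeWreath H).Alg →⋆ₐ[ℂ] D :=
  Wreath.lift φ ψ h

section

variable {D : Type} [CStarAlgebra D] (φ : H.Pt → G.Alg →⋆ₐ[ℂ] D) (ψ : H.Alg →⋆ₐ[ℂ] D)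
  (h : ∀ i j a b, Commute (φ a (G.u i j)) (ψ (H.u a b)))

lemma wreathLift_inl (a : H.Pt) (x : G.Alg) : wreathLift φ ψ h (wreathInl a x) = φ a x :=
  Wreath.lift_inl φ ψ h a x

lemma wreathLift_inr (y : H.Alg) : wreathLift φ ψ h (wreathInr y) = ψ y :=
  Wreath.lift_inr φ ψ h y

end

lemma wreath_commute (x : G.Alg) (a b : H.Pt) :
    Commute (wreathInl a x : (G.freeWreath H).Alg) (wreathInr (H.u a b)) :=
  Wreath.commute x a b

lemma freeWreath_u (i j : G.Pt) (a b : H.Pt) :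
    (G.freeWreath H).u (i, a) (j, b) = wreathInl a (G.u i j) * wreathInr (H.u a b) := rfl

lemma freeWreath_hom_ext {D : Type} [CStarAlgebra D] {f g : (G.freeWreath H).Alg →⋆ₐ[ℂ] D}
    (hl : ∀ a x, f (wreathInl a x) = g (wreathInl a x))
    (hr : ∀ y, f (wreathInr y) = g (wreathInr y)) : f = g := by
  refine hom_ext ?_
  rintro ⟨i, a⟩ ⟨j, b⟩
  rw [freeWreath_u, map_mul, map_mul, hl, hr]

lemma freeWreath_comul_inl (a : H.Pt) (x : G.Alg) :
    (G.freeWreath H).comul (wreathInl a x) =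
      ∑ c, MinTensor.map (wreathInl a) (wreathInl c) (G.comul x) *
        MinTensor.tmul (wreathInr (H.u a c)) 1 :=
  Wreath.lift_inl _ _ Wreath.commute_comul a x

lemma freeWreath_comul_inr (y : H.Alg) : (G.freeWreath H).comul (wreathInr y) =
    MinTensor.map wreathInr wreathInr (H.comul y) :=
  Wreath.lift_inr _ _ Wreath.commute_comul y

lemma Iso.freeWreath {G' : QuantumPermutationGroup} (hG : G.Iso G')
    (H : QuantumPermutationGroup) : (G.freeWreath H).Iso (G'.freeWreath H) := by
  obtain ⟨φ, φ', h₁, h₂, hΔ⟩ := hG.exists_hom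
  have h₁ := DFunLike.congr_fun h₁
  have h₂ := DFunLike.congr_fun h₂
  simp only [StarAlgHom.comp_apply, StarAlgHom.coe_id, id] at h₁ h₂
  let F : (G.freeWreath H).Alg →⋆ₐ[ℂ] (G'.freeWreath H).Alg :=
    wreathLift (fun a => (wreathInl a).comp φ) wreathInr
      (fun i j a b => wreath_commute (φ (G.u i j)) a b)
  let F' : (G'.freeWreath H).Alg →⋆ₐ[ℂ] (G.freeWreath H).Alg :=
    wreathLift (fun a => (wreathInl a).comp φ') wreathInr
      (fun i j a b => wreath_commute (φ' (G'.u i j)) a b)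
  have Fl (a x) : F (wreathInl a x) = wreathInl a (φ x) := wreathLift_inl _ _ _ a x
  have Fr (x) : F (wreathInr x) = wreathInr x := wreathLift_inr _ _ _ x
  have Fl' (a x) : F' (wreathInl a x) = wreathInl a (φ' x) := wreathLift_inl _ _ _ a x
  have Fr' (x) : F' (wreathInr x) = wreathInr x := wreathLift_inr _ _ _ x
  have Flc (a) : F.comp (wreathInl a) = (wreathInl a).comp φ := by ext x; exact Fl a x
  have Frc : F.comp wreathInr = wreathInr := by ext x; exact Fr x
  refine Iso.of_comp (φ := F) (ψ := F') ?_ ?_ ?_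
  · refine freeWreath_hom_ext (fun a x => ?_) (fun y => ?_)
    · change F' (F _) = _
      rw [Fl, Fl', h₁]; rfl
    · change F' (F _) = _
      rw [Fr, Fr']; rfl
  · refine freeWreath_hom_ext (fun a x => ?_) (fun y => ?_)
    · change F (F' _) = _
      rw [Fl', Fl, h₂]; rfl
    · change F (F' _) = _
      rw [Fr', Fr]; rfl
  · refine freeWreath_hom_ext (fun a x => ?_) (fun y => ?_)
    · change MinTensor.map F F ((G.freeWreath H).comul _) = (G'.freeWreath H).comul (F _)
      rw [Fl, freeWreath_comul_inl, freeWreath_comul_inl, map_sum]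
      refine Finset.sum_congr rfl fun c _ => ?_
      rw [map_mul, MinTensor.map_map, ← hΔ, MinTensor.map_map, Flc, Flc, MinTensor.map_tmul, Fr,
        map_one]
    · change MinTensor.map F F ((G.freeWreath H).comul _) = (G'.freeWreath H).comul (F _)
      rw [Fr, freeWreath_comul_inr, freeWreath_comul_inr, MinTensor.map_map, Frc]

end QuantumPermutationGroup

/-! ### Relations preserved by a magic unitary -/

section Preserves

variable {ι A : Type} [CStarAlgebra A]

/-- The magic unitary `u` preserves the relation `S`: `u i j * u k l` vanishes if exactly one of
`S i k` and `S j l` holds. -/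
def PreservesRel (u : Matrix ι ι A) (S : ι → ι → Prop) : Prop :=
  ∀ i j k l, ¬(S i k ↔ S j l) → u i j * u k l = 0

lemma PreservesRel.transpose {u : Matrix ι ι A} {S : ι → ι → Prop} (h : PreservesRel u S) :
    PreservesRel u.transpose S :=
  fun i j k l hS => h j i l k fun h' => hS h'.symm

lemma PreservesRel.iff {u : Matrix ι ι A} {S : ι → ι → Prop} (h : PreservesRel u S)
    {i j k l : ι} (hu : u i j * u k l ≠ 0) : S i k ↔ S j l := by
  by_contra hS
  exact hu (h i j k l hS)

lemma preservesRel_of_iff {u : Matrix ι ι A} {S : ι → ι → Prop}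
    (h : ∀ i j k l, u i j * u k l ≠ 0 → (S i k ↔ S j l)) : PreservesRel u S :=
  fun i j k l hS => by
    by_contra hu
    exact hS (h i j k l hu)

variable [Fintype ι] {u : Matrix ι ι A}

lemma IsMagicUnitary.transpose (hu : IsMagicUnitary u) : IsMagicUnitary u.transpose :=
  ⟨fun i j => hu.star_eq j i, fun i j => hu.mul_self j i, hu.col_sum, hu.row_sum⟩

lemma IsMagicUnitary.mul_comm_ne_zero (hu : IsMagicUnitary u) {i j k l : ι}
    (h : u i j * u k l ≠ 0) : u k l * u i j ≠ 0 := fun h' => h <| by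
  rw [← star_star (u i j * u k l), star_mul, hu.star_eq, hu.star_eq, h', star_zero]

lemma IsMagicUnitary.exists_row (hu : IsMagicUnitary u) {x : A} (hx : x ≠ 0) (k : ι) :
    ∃ l, x * u k l ≠ 0 := by
  by_contra! h
  apply hx
  rw [← mul_one x, ← hu.row_sum k, Finset.mul_sum]
  exact Finset.sum_eq_zero fun l _ => h l

lemma IsMagicUnitary.exists_col (hu : IsMagicUnitary u) {x : A} (hx : x ≠ 0) (l : ι) :
    ∃ k, x * u k l ≠ 0 :=
  hu.transpose.exists_row hx l

/-- If `x` annihilates all entries of a row except one, then that entry acts on `x` as the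
identity. -/
lemma IsMagicUnitary.mul_eq_single (hu : IsMagicUnitary u) (x : A) (k l : ι)
    (h : ∀ l', l' ≠ l → x * u k l' = 0) : x * u k l = x := by
  classical
  conv_rhs => rw [← mul_one x, ← hu.row_sum k, Finset.mul_sum]
  exact (Finset.sum_eq_single l (fun l' _ hl => h l' hl)
    (fun h => absurd (Finset.mem_univ l) h)).symm

/-- The counting argument behind colour refinement: weights on the rows and on the columns of `u`
that match each other, relative to some nonzero `x`, have the same total. -/
lemma IsMagicUnitary.sum_eq (hu : IsMagicUnitary u) {x : A} (hx : x ≠ 0) (p q : ι → ℕ)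
    (h : ∀ k l, x * u k l ≠ 0 → p k = q l) : ∑ k, p k = ∑ l, q l := by
  have h1 : (∑ k, p k) • x = ∑ k, ∑ l, p k • (x * u k l) := by
    rw [Finset.sum_smul]
    refine Finset.sum_congr rfl fun k _ => ?_
    rw [← Finset.smul_sum, ← Finset.mul_sum, hu.row_sum, mul_one]
  have h2 : (∑ l, q l) • x = ∑ k, ∑ l, q l • (x * u k l) := by
    rw [Finset.sum_smul, Finset.sum_comm]
    refine Finset.sum_congr rfl fun l _ => ?_
    rw [← Finset.smul_sum, ← Finset.mul_sum, hu.col_sum, mul_one]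
  have h3 : (∑ k, p k) • x = (∑ l, q l) • x := by
    rw [h1, h2]
    refine Finset.sum_congr rfl fun k _ => Finset.sum_congr rfl fun l _ => ?_
    by_cases h0 : x * u k l = 0
    · rw [h0, smul_zero, smul_zero]
    · rw [h k l h0]
  rw [← Nat.cast_smul_eq_nsmul ℂ, ← Nat.cast_smul_eq_nsmul ℂ] at h3
  exact Nat.cast_injective (smul_left_injective ℂ hx h3)

lemma IsMagicUnitary.card_eq (hu : IsMagicUnitary u) {x : A} (hx : x ≠ 0) (P Q : ι → Prop)
    (h : ∀ k l, x * u k l ≠ 0 → (P k ↔ Q l)) : Nat.card {k // P k} = Nat.card {l // Q l} := by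
  classical
  rw [Nat.card_eq_fintype_card, Nat.card_eq_fintype_card, Fintype.card_subtype,
    Fintype.card_subtype, Finset.card_filter, Finset.card_filter]
  exact hu.sum_eq hx _ _ fun k l hkl => by simp only [h k l hkl]

lemma PreservesRel.card_eq (hu : IsMagicUnitary u) {S : ι → ι → Prop} (hS : PreservesRel u S)
    {i j : ι} (hij : u i j ≠ 0) : Nat.card {k // S i k} = Nat.card {l // S j l} :=
  hu.card_eq hij _ _ fun _ _ h => hS.iff h

lemma preservesRel_eq (hu : IsMagicUnitary u) : PreservesRel u Eq := by
  refine preservesRel_of_iff fun i j k l h => ⟨?_, ?_⟩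
  · rintro rfl
    by_contra hjl
    exact h (hu.row_orthogonal i hjl)
  · rintro rfl
    by_contra hik
    exact h (hu.col_orthogonal j hik)

lemma PreservesRel.swap (hu : IsMagicUnitary u) {S : ι → ι → Prop} (hS : PreservesRel u S) :
    PreservesRel u fun i k => S k i :=
  preservesRel_of_iff fun _ _ _ _ h => hS.iff (hu.mul_comm_ne_zero h)

lemma PreservesRel.comp (hu : IsMagicUnitary u) {S S' : ι → ι → Prop} (hS : PreservesRel u S)
    (hS' : PreservesRel u S') : PreservesRel u fun i k => ∃ m, S i m ∧ S' m k := by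
  refine preservesRel_of_iff fun i j k l h => ⟨?_, ?_⟩
  · rintro ⟨m, h1, h2⟩
    have : ∃ n, u i j * u m n * u k l ≠ 0 := by
      by_contra! h0
      apply h
      rw [← mul_one (u i j), ← hu.row_sum m, Finset.mul_sum, Finset.sum_mul]
      exact Finset.sum_eq_zero fun n _ => h0 n
    obtain ⟨n, hn⟩ := this
    exact ⟨n, (hS.iff (left_ne_zero_of_mul hn)).1 h1,
      (hS'.iff (right_ne_zero_of_mul (mul_assoc (u i j) _ _ ▸ hn))).1 h2⟩
  · rintro ⟨n, h1, h2⟩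
    have : ∃ m, u i j * u m n * u k l ≠ 0 := by
      by_contra! h0
      apply h
      rw [← mul_one (u i j), ← hu.col_sum n, Finset.mul_sum, Finset.sum_mul]
      exact Finset.sum_eq_zero fun n _ => h0 n
    obtain ⟨m, hm⟩ := this
    exact ⟨m, (hS.iff (left_ne_zero_of_mul hm)).2 h1,
      (hS'.iff (right_ne_zero_of_mul (mul_assoc (u i j) _ _ ▸ hm))).2 h2⟩

end Preserves

/-! ### Homomorphisms from the universal algebras of magic unitaries -/

section MagicGroup

variable {V D : Type} [Fintype V] [Nonempty V] [CStarAlgebra D]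

/-- The universal property of `magicGroup`. -/
def magicLift (R : V → V → V → V → Prop) (hR) (w : Matrix V V D) (hw : IsMagicUnitary w)
    (hwR : ∀ i j k l, R i j k l → w i j * w k l = 0) : (magicGroup R hR).Alg →⋆ₐ[ℂ] D :=
  (magicPresentation R).lift (fun p : V × V => w p.1 p.2) (MagicRel.lift_eq_zero w hw hwR)

lemma magicLift_u (R : V → V → V → V → Prop) (hR) (w : Matrix V V D) (hw : IsMagicUnitary w)
    (hwR : ∀ i j k l, R i j k l → w i j * w k l = 0) (i j : V) :
    magicLift R hR w hw hwR ((magicGroup R hR).u i j) = w i j :=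
  Presentation.lift_gen _ _ _ (i, j)

lemma magicGroup_mul_eq_zero (R : V → V → V → V → Prop) (hR) {i j k l : V} (h : R i j k l) :
    (magicGroup R hR).u i j * (magicGroup R hR).u k l = 0 :=
  magicPresentation_mul_eq_zero R h

/-- Two relations on the same set of points that have the same magic unitaries define isomorphic
quantum permutation groups. -/
lemma magicGroup_iso {R R' : V → V → V → V → Prop} (hR) (hR')
    (h : ∀ i j k l, R' i j k l → (magicGroup R hR).u i j * (magicGroup R hR).u k l = 0)
    (h' : ∀ i j k l, R i j k l → (magicGroup R' hR').u i j * (magicGroup R' hR').u k l = 0) :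
    (magicGroup R hR).Iso (magicGroup R' hR') :=
  Iso.of_equiv (isFundamental _) (isFundamental _) (Equiv.refl V)
    (magicLift R hR _ (magicGroup R' hR').magic h') (magicLift R' hR' _ (magicGroup R hR).magic h)
    (magicLift_u R hR _ _ h') (magicLift_u R' hR' _ _ h)

lemma Qut_preserves (X : SimpleGraph V) : PreservesRel (Qut X).u X.Adj :=
  fun _ _ _ _ h => magicGroup_mul_eq_zero _ _ h

end MagicGroup

/-! ### Rooted forests -/

/-- A rooted forest on `V`: `par i k` says that `k` is the parent of `i`. The rank, which decreases
from a vertex to its parent, excludes cycles; roots are the vertices without a parent. -/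
structure Forest (V : Type) where
  par : V → V → Prop
  uniq : ∀ {i k l}, par i k → par i l → k = l
  rank : V → ℕ
  rank_lt : ∀ {i k}, par i k → rank k < rank i

namespace Forest

variable {V : Type} (F : Forest V)

/-- Vertices without a parent. -/
def IsRoot (i : V) : Prop := ∀ k, ¬F.par i k

/-- The root of the component of a vertex. -/
def root (i : V) : V :=
  open Classical in
  if h : ∃ k, F.par i k then root h.choose else i
termination_by F.rank i
decreasing_by exact F.rank_lt h.choose_spec

variable {F}

lemma root_of_isRoot {i : V} (h : F.IsRoot i) : F.root i = i := by
  rw [root, dif_neg (not_exists.2 h)]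

lemma root_of_par {i k : V} (h : F.par i k) : F.root i = F.root k := by
  have h' : ∃ k, F.par i k := ⟨k, h⟩
  rw [root, dif_pos h', F.uniq h h'.choose_spec]

/-- Induction from the roots of a forest to the leaves. -/
@[elab_as_elim]
lemma induction {P : V → Prop} (hr : ∀ i, F.IsRoot i → P i)
    (hp : ∀ i k, F.par i k → P k → P i) (i : V) : P i := by
  induction h : F.rank i using Nat.strong_induction_on generalizing i with
  | h n ih =>
    subst h
    by_cases hi : F.IsRoot i
    · exact hr i hi
    · obtain ⟨k, hk⟩ := not_forall_not.1 hi
      exact hp i k hk (ih _ (F.rank_lt hk) k rfl)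

lemma isRoot_root (i : V) : F.IsRoot (F.root i) := by
  induction i using F.induction with
  | hr i hi => rwa [root_of_isRoot hi]
  | hp i k h hk => rwa [root_of_par h]

section Magic

variable {A : Type} [CStarAlgebra A] [Fintype V] {u : Matrix V V A}

lemma isRoot_of_ne_zero (hu : IsMagicUnitary u) (hF : PreservesRel u F.par) {i j : V}
    (hij : u i j ≠ 0) (hi : F.IsRoot i) : F.IsRoot j := fun l hl => by
  obtain ⟨k, hk⟩ := hu.exists_col hij l
  exact hi k ((hF.iff hk).2 hl)

lemma isRoot_iff (hu : IsMagicUnitary u) (hF : PreservesRel u F.par) {i j : V}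
    (hij : u i j ≠ 0) : F.IsRoot i ↔ F.IsRoot j :=
  ⟨isRoot_of_ne_zero hu hF hij, isRoot_of_ne_zero hu.transpose hF.transpose hij⟩

/-- A magic unitary that preserves a forest acts on the set of components. -/
lemma mul_root (hu : IsMagicUnitary u) (hF : PreservesRel u F.par) (i j : V) :
    u i j * u (F.root i) (F.root j) = u i j := by
  induction i using F.induction generalizing j with
  | hr i hi =>
    rw [root_of_isRoot hi]
    by_cases hij : u i j = 0
    · rw [hij, zero_mul]
    · rw [root_of_isRoot (isRoot_of_ne_zero hu hF hij hi), hu.mul_self]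
  | hp i k h ih =>
    by_cases hij : u i j = 0
    · rw [hij, zero_mul]
    obtain ⟨l, hl⟩ := hu.exists_row hij k
    have hl' := (hF.iff hl).1 h
    have : u i j * u k l = u i j := hu.mul_eq_single _ k l fun l' hne => by
      by_contra h0
      exact hne (F.uniq ((hF.iff h0).1 h) hl')
    rw [root_of_par h, root_of_par hl', ← this, mul_assoc, ih]

lemma root_ne_zero (hu : IsMagicUnitary u) (hF : PreservesRel u F.par) {i j : V}
    (hij : u i j ≠ 0) : u (F.root i) (F.root j) ≠ 0 := fun h => hij <| by
  rw [← mul_root hu hF i j, h, mul_zero]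

end Magic

variable (F) in
/-- The quantum automorphism group of a rooted forest. -/
def qut [Fintype V] [Nonempty V] : QuantumPermutationGroup :=
  magicGroup (fun i j k l => ¬(F.par i k ↔ F.par j l)) (fun i j k l h a b => by tauto)

variable (F) in
/-- The fundamental representation of the quantum automorphism group of a rooted forest. -/
def mat [Fintype V] [Nonempty V] : Matrix V V F.qut.Alg := F.qut.u

variable (F) in
lemma isFundamental_mat [Fintype V] [Nonempty V] : F.qut.IsFundamental F.mat :=
  F.qut.isFundamental

variable (F) in
lemma magic_mat [Fintype V] [Nonempty V] : IsMagicUnitary F.mat := F.qut.magic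

variable (F) in
lemma preserves_mat [Fintype V] [Nonempty V] : PreservesRel F.mat F.par :=
  fun _ _ _ _ h => magicGroup_mul_eq_zero _ _ h

variable (F) in
/-- The universal property of the quantum automorphism group of a rooted forest. -/
def qutLift [Fintype V] [Nonempty V] {D : Type} [CStarAlgebra D] (w : Matrix V V D)
    (hw : IsMagicUnitary w) (hF : PreservesRel w F.par) : F.qut.Alg →⋆ₐ[ℂ] D :=
  magicLift _ _ w hw hF

lemma qutLift_mat [Fintype V] [Nonempty V] {D : Type} [CStarAlgebra D] (w : Matrix V V D)
    (hw : IsMagicUnitary w) (hF : PreservesRel w F.par) (i j : V) :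
    F.qutLift w hw hF (F.mat i j) = w i j :=
  magicLift_u _ _ w hw hF i j

end Forest

/-! ### Disjoint unions, copies and added roots -/

section Submatrix

variable {ι κ A : Type} [Fintype ι] [Fintype κ] [CStarAlgebra A] {u : Matrix ι ι A}

lemma sum_comp_of_injective {f : κ → ι} (hf : f.Injective) (x : ι → A)
    (hx : ∀ i, i ∉ Set.range f → x i = 0) : ∑ k, x (f k) = ∑ i, x i := by
  classical
  rw [← Finset.sum_image (f := x) (s := Finset.univ) (g := f) (fun a _ b _ h => hf h)]
  refine Finset.sum_subset (Finset.subset_univ _) fun i _ hi => hx i fun ⟨k, hk⟩ => hi ?_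
  exact Finset.mem_image.2 ⟨k, Finset.mem_univ k, hk⟩

/-- A diagonal block of a magic unitary is a magic unitary if the off-diagonal blocks vanish. -/
lemma IsMagicUnitary.block (hu : IsMagicUnitary u) {f : κ → ι} (hf : f.Injective)
    (h : ∀ i, i ∉ Set.range f → ∀ k, u i (f k) = 0 ∧ u (f k) i = 0) :
    IsMagicUnitary (u.submatrix f f) where
  star_eq i j := hu.star_eq _ _
  mul_self i j := hu.mul_self _ _
  row_sum i := by
    rw [← hu.row_sum (f i)]
    exact sum_comp_of_injective hf (fun j => u (f i) j) fun j hj => (h j hj i).2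
  col_sum j := by
    rw [← hu.col_sum (f j)]
    exact sum_comp_of_injective hf (fun i => u i (f j)) fun i hi => (h i hi j).1

lemma IsMagicUnitary.reindex (hu : IsMagicUnitary u) (e : κ ≃ ι) :
    IsMagicUnitary (u.submatrix e e) :=
  hu.block e.injective fun i hi => (hi (e.surjective i)).elim

end Submatrix

namespace Forest

variable {V V₁ V₂ : Type} [Fintype V] [Fintype V₁] [Fintype V₂] [Nonempty V] [Nonempty V₁]
  [Nonempty V₂]
variable {F : Forest V} {F₁ : Forest V₁} {F₂ : Forest V₂}

lemma qut_iso_of_equiv (F : Forest V) (F₁ : Forest V₁) (e : V₁ ≃ V)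
    (he : ∀ i k, F.par (e i) (e k) ↔ F₁.par i k) : F₁.qut.Iso F.qut := by
  refine Iso.of_equiv F₁.isFundamental_mat F.isFundamental_mat e
    (F₁.qutLift (F.mat.submatrix e e) (F.magic_mat.reindex e)
      (preservesRel_of_iff fun i j k l h => ?_))
    (F.qutLift (F₁.mat.submatrix e.symm e.symm) (F₁.magic_mat.reindex e.symm)
      (preservesRel_of_iff fun i j k l h => ?_))
    (fun i j => qutLift_mat _ _ _ i j) (fun i j => ?_)
  · rw [← he, ← he]
    exact (preserves_mat _).iff h
  · have := (preserves_mat _).iff h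
    simpa [← he] using this
  · rw [qutLift_mat, Matrix.submatrix_apply, e.symm_apply_apply, e.symm_apply_apply]

/-- If no entry of the universal magic unitary mixes two complementary parts of a forest, then the
quantum automorphism group is a free product. -/
lemma qut_iso_freeProd (F : Forest V) (F₁ : Forest V₁) (F₂ : Forest V₂) (e : V₁ ⊕ V₂ ≃ V)
    (he : ∀ x y, F.par (e x) (e y) ↔ Sum.LiftRel F₁.par F₂.par x y)
    (h₁₂ : ∀ i j, F.mat (e (.inl i)) (e (.inr j)) = 0)
    (h₂₁ : ∀ i j, F.mat (e (.inr i)) (e (.inl j)) = 0) :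
    (F₁.qut.freeProd F₂.qut).Iso F.qut := by
  have hl : IsMagicUnitary (F.mat.submatrix (e ∘ Sum.inl) (e ∘ Sum.inl)) := by
    refine F.magic_mat.block (e.injective.comp Sum.inl_injective) fun x hx k => ?_
    obtain ⟨i | i, rfl⟩ := e.surjective x
    · exact (hx ⟨i, rfl⟩).elim
    · exact ⟨h₂₁ i k, h₁₂ k i⟩
  have hr : IsMagicUnitary (F.mat.submatrix (e ∘ Sum.inr) (e ∘ Sum.inr)) := by
    refine F.magic_mat.block (e.injective.comp Sum.inr_injective) fun x hx k => ?_
    obtain ⟨i | i, rfl⟩ := e.surjective x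
    · exact ⟨h₁₂ i k, h₂₁ k i⟩
    · exact (hx ⟨i, rfl⟩).elim
  have pl : PreservesRel (F.mat.submatrix (e ∘ Sum.inl) (e ∘ Sum.inl)) F₁.par :=
    preservesRel_of_iff fun i j k l h => by
      have := F.preserves_mat.iff h
      simpa [he] using this
  have pr : PreservesRel (F.mat.submatrix (e ∘ Sum.inr) (e ∘ Sum.inr)) F₂.par :=
    preservesRel_of_iff fun i j k l h => by
      have := F.preserves_mat.iff h
      simpa [he] using this
  have hf := F₁.isFundamental_mat.freeProd F₂.isFundamental_mat
  set w : Matrix (V₁ ⊕ V₂) (V₁ ⊕ V₂) (F₁.qut.freeProd F₂.qut).Alg :=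
    Matrix.fromBlocks (F₁.mat.map freeProdInl) 0 0 (F₂.mat.map freeProdInr)
  have hw : IsMagicUnitary w := hf.magic
  have w11 (i j) : w (.inl i) (.inl j) = freeProdInl (F₁.mat i j) := rfl
  have w12 (i j) : w (.inl i) (.inr j) = 0 := rfl
  have w21 (i j) : w (.inr i) (.inl j) = 0 := rfl
  have w22 (i j) : w (.inr i) (.inr j) = freeProdInr (F₂.mat i j) := rfl
  have hwF : PreservesRel (w.submatrix e.symm e.symm) F.par :=
    preservesRel_of_iff fun x y x' y' h => by
      obtain ⟨x, rfl⟩ := e.surjective x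
      obtain ⟨y, rfl⟩ := e.surjective y
      obtain ⟨x', rfl⟩ := e.surjective x'
      obtain ⟨y', rfl⟩ := e.surjective y'
      rw [he, he]
      simp only [Matrix.submatrix_apply, Equiv.symm_apply_apply] at h
      have h1 := left_ne_zero_of_mul h
      have h2 := right_ne_zero_of_mul h
      rcases x with i | i <;> rcases y with j | j <;> rcases x' with k | k <;>
        rcases y' with l | l <;> first
        | exact (h1 (w12 _ _)).elim
        | exact (h1 (w21 _ _)).elim
        | exact (h2 (w12 _ _)).elim
        | exact (h2 (w21 _ _)).elim
        | simp only [Sum.not_liftRel_inl_inr, Sum.not_liftRel_inr_inl]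
        | skip
      · rw [w11, w11, ← map_mul] at h
        rw [Sum.liftRel_inl_inl, Sum.liftRel_inl_inl]
        exact (preserves_mat _).iff fun h0 => h (by rw [h0, map_zero])
      · rw [w22, w22, ← map_mul] at h
        rw [Sum.liftRel_inr_inr, Sum.liftRel_inr_inr]
        exact (preserves_mat _).iff fun h0 => h (by rw [h0, map_zero])
  refine Iso.of_equiv hf F.isFundamental_mat e
    (freeProdLift (F₁.qutLift _ hl pl) (F₂.qutLift _ hr pr))
    (F.qutLift (w.submatrix e.symm e.symm) (hw.reindex e.symm) hwF)
    (fun x y => ?_) (fun x y => ?_)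
  · rcases x with i | i <;> rcases y with j | j
    · rw [w11, freeProdLift_inl, qutLift_mat]; rfl
    · rw [w12, map_zero, h₁₂]
    · rw [w21, map_zero, h₂₁]
    · rw [w22, freeProdLift_inr, qutLift_mat]; rfl
  · rw [qutLift_mat, Matrix.submatrix_apply, e.symm_apply_apply, e.symm_apply_apply]

/-- Adding a common parent of all roots does not change the quantum automorphism group. -/
lemma qut_iso_addRoot (F : Forest V) (F₁ : Forest V₁) (e : Option V₁ ≃ V)
    (he : ∀ i k, F.par (e (some i)) (e (some k)) ↔ F₁.par i k)
    (hr : ∀ i, F.par (e (some i)) (e none) ↔ F₁.IsRoot i)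
    (h0 : F.IsRoot (e none)) : F₁.qut.Iso F.qut := by
  have hsome (i) : ¬F.IsRoot (e (some i)) := fun h => by
    by_cases hi : F₁.IsRoot i
    · exact h _ ((hr i).2 hi)
    · obtain ⟨k, hk⟩ := not_forall_not.1 hi
      exact h _ ((he i k).2 hk)
  have z₁ (i) : F.mat (e none) (e (some i)) = 0 := by
    by_contra h
    exact hsome i ((isRoot_iff F.magic_mat F.preserves_mat h).1 h0)
  have z₂ (i) : F.mat (e (some i)) (e none) = 0 := by
    by_contra h
    exact hsome i ((isRoot_iff F.magic_mat F.preserves_mat h).2 h0)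
  have u0 : F.mat (e none) (e none) = 1 := by
    rw [← F.magic_mat.row_sum (e none), ← e.sum_comp, Fintype.sum_option]
    simp [z₁]
  have hm : IsMagicUnitary (F.mat.submatrix (e ∘ some) (e ∘ some)) := by
    refine F.magic_mat.block (e.injective.comp (Option.some_injective _)) fun x hx k => ?_
    obtain ⟨_ | i, rfl⟩ := e.surjective x
    · exact ⟨z₁ k, z₂ k⟩
    · exact (hx ⟨i, rfl⟩).elim
  have pm : PreservesRel (F.mat.submatrix (e ∘ some) (e ∘ some)) F₁.par :=
    preservesRel_of_iff fun i j k l h => by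
      rw [← he, ← he]
      exact F.preserves_mat.iff h
  let w : Matrix (Option V₁) (Option V₁) F₁.qut.Alg := Matrix.of fun x y =>
    match x, y with
    | none, none => 1
    | none, some _ => 0
    | some _, none => 0
    | some i, some j => F₁.mat i j
  have hw : IsMagicUnitary w := by
    constructor
    · rintro (_ | i) (_ | j) <;> simp [w, F₁.magic_mat.star_eq]
    · rintro (_ | i) (_ | j) <;> simp [w, F₁.magic_mat.mul_self]
    · rintro (_ | i) <;> simp [w, F₁.magic_mat.row_sum]
    · rintro (_ | i) <;> simp [w, F₁.magic_mat.col_sum]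
  have hwF : PreservesRel (w.submatrix e.symm e.symm) F.par :=
    preservesRel_of_iff fun x y x' y' h => by
      obtain ⟨x, rfl⟩ := e.surjective x
      obtain ⟨y, rfl⟩ := e.surjective y
      obtain ⟨x', rfl⟩ := e.surjective x'
      obtain ⟨y', rfl⟩ := e.surjective y'
      simp only [Matrix.submatrix_apply, Equiv.symm_apply_apply] at h
      rcases x with _ | i <;> rcases y with _ | j <;> rcases x' with _ | k <;>
        rcases y' with _ | l <;>
        simp only [w, Matrix.of_apply, mul_zero, zero_mul, ne_eq, not_true_eq_false, mul_one,
          one_mul] at h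
      · simp [h0 _]
      · simp [h0 _]
      · rw [hr, hr]
        exact isRoot_iff F₁.magic_mat F₁.preserves_mat h
      · rw [he, he]
        exact (preserves_mat _).iff h
  refine Iso.of_hom F₁.isFundamental_mat F.isFundamental_mat (F₁.qutLift _ hm pm)
    (F.qutLift _ (hw.reindex e.symm) hwF)
    (fun i j => ?_) (fun x y => ?_) (fun i j => ?_)
  · rw [qutLift_mat, Matrix.submatrix_apply, qutLift_mat]
    simp [w]
  · obtain ⟨x, rfl⟩ := e.surjective x
    obtain ⟨y, rfl⟩ := e.surjective y
    rw [qutLift_mat, Matrix.submatrix_apply, e.symm_apply_apply, e.symm_apply_apply]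
    rcases x with _ | i <;> rcases y with _ | j
    · exact (map_one _).trans u0.symm
    · exact (map_zero _).trans (z₁ j).symm
    · exact (map_zero _).trans (z₂ i).symm
    · exact qutLift_mat _ _ _ i j
  · rw [qutLift_mat, Matrix.submatrix_apply, F.isFundamental_mat.comul,
      F₁.isFundamental_mat.comul, map_sum, ← e.sum_comp, Fintype.sum_option]
    simp only [MinTensor.map_tmul, Function.comp_apply, z₂, MinTensor.zero_tmul, zero_add]
    refine Finset.sum_congr rfl fun k _ => ?_
    rw [qutLift_mat, qutLift_mat]
    rfl

lemma one_iso_qut [Subsingleton V] (F : Forest V) : one.Iso F.qut := by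
  have hF (i k : V) : ¬F.par i k := fun h =>
    (F.rank_lt h).ne (congrArg F.rank (Subsingleton.elim k i))
  have hu (i j : V) : F.mat i j = 1 := by
    rw [← F.magic_mat.row_sum i]
    exact (Fintype.sum_subsingleton _ j).symm
  let w : Matrix V V one.Alg := Matrix.of fun _ _ => 1
  have hw : IsMagicUnitary w := by
    have (f : V → one.Alg) : ∑ i, f i = f (Classical.arbitrary V) := Fintype.sum_subsingleton _ _
    constructor <;> intros <;> simp [w, this]
  let φ : one.Alg →⋆ₐ[ℂ] F.qut.Alg := StarAlgHom.ofId ℂ F.qut.Alg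
  have h1 (i j) : one.u i j = 1 := rfl
  refine Iso.of_hom one.isFundamental F.isFundamental_mat φ
    (F.qutLift w hw fun i j k l h => by simp [hF] at h)
    (fun i j => ?_) (fun i j => ?_) (fun i j => ?_)
  · rw [h1, map_one, map_one]
  · exact (congrArg φ (qutLift_mat w hw _ i j)).trans ((map_one φ).trans (hu i j).symm)
  · rw [h1, map_one, map_one, map_one, map_one]

end Forest

/-! ### Copies of a tree and free wreath products -/

section SymmetricWreath

variable (G : QuantumPermutationGroup) (n : ℕ) [NeZero n]

/-- The free wreath product of `G` by the quantum symmetric group. -/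
abbrev symWreath : QuantumPermutationGroup := G.freeWreath (quantumSymmetricGroup n)

/-- The fundamental representation of the quantum symmetric group. -/
def symMat : Matrix (Fin n) (Fin n) (quantumSymmetricGroup n).Alg := (quantumSymmetricGroup n).u

lemma symMat_isFundamental : (quantumSymmetricGroup n).IsFundamental (symMat n) :=
  (quantumSymmetricGroup n).isFundamental

/-- The universal property of the quantum symmetric group. -/
def symLift {n : ℕ} [NeZero n] {D : Type} [CStarAlgebra D] (w : Matrix (Fin n) (Fin n) D)
    (hw : IsMagicUnitary w) : (quantumSymmetricGroup n).Alg →⋆ₐ[ℂ] D :=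
  magicLift _ _ w hw fun _ _ _ _ h => h.elim

lemma symLift_mat {n : ℕ} [NeZero n] {D : Type} [CStarAlgebra D] (w : Matrix (Fin n) (Fin n) D)
    (hw : IsMagicUnitary w) (a b : Fin n) : symLift w hw (symMat n a b) = w a b :=
  magicLift_u _ _ w hw _ a b

variable {G n}

/-- The copy of the function algebra of `G` at the point `a`. -/
def symInl (a : Fin n) : G.Alg →⋆ₐ[ℂ] (symWreath G n).Alg :=
  wreathInl (H := quantumSymmetricGroup n) a

/-- The copy of the function algebra of the quantum symmetric group. -/
def symInr : (quantumSymmetricGroup n).Alg →⋆ₐ[ℂ] (symWreath G n).Alg :=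
  wreathInr (H := quantumSymmetricGroup n)

lemma sym_commute (x : G.Alg) (a b : Fin n) :
    Commute (symInl a x : (symWreath G n).Alg) (symInr (symMat n a b)) :=
  wreath_commute (H := quantumSymmetricGroup n) x a b

end SymmetricWreath

namespace Forest

section Wreath

variable {T : Type} [Fintype T] [Nonempty T] (F : Forest T) {n : ℕ} [NeZero n]

/-- The fundamental representation of a free wreath product by the quantum symmetric group. -/
def wreathMat (F : Forest T) (n : ℕ) [NeZero n] :
    Matrix (T × Fin n) (T × Fin n) (symWreath F.qut n).Alg :=
  Matrix.of fun x y => symInl x.2 (F.mat x.1 y.1) * symInr (symMat n x.2 y.2)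

lemma wreathMat_apply (i j : T) (a b : Fin n) : F.wreathMat n (i, a) (j, b) =
    symInl a (F.mat i j) * symInr (symMat n a b) := rfl

lemma wreathMat_isFundamental : (symWreath F.qut n).IsFundamental (F.wreathMat n) :=
  (symWreath F.qut n).isFundamental

/-- The universal property of a free wreath product by the quantum symmetric group. -/
def qutWreathLift {D : Type} [CStarAlgebra D] (φ : Fin n → F.qut.Alg →⋆ₐ[ℂ] D)
    (ψ : (quantumSymmetricGroup n).Alg →⋆ₐ[ℂ] D)
    (h : ∀ i j a b, Commute (φ a (F.mat i j)) (ψ (symMat n a b))) :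
    (symWreath F.qut n).Alg →⋆ₐ[ℂ] D :=
  wreathLift (H := quantumSymmetricGroup n) φ ψ h

lemma qutWreathLift_mat {D : Type} [CStarAlgebra D] (φ : Fin n → F.qut.Alg →⋆ₐ[ℂ] D)
    (ψ : (quantumSymmetricGroup n).Alg →⋆ₐ[ℂ] D)
    (h : ∀ i j a b, Commute (φ a (F.mat i j)) (ψ (symMat n a b))) (i j : T) (a b : Fin n) :
    F.qutWreathLift φ ψ h (F.wreathMat n (i, a) (j, b)) = φ a (F.mat i j) * ψ (symMat n a b) := by
  rw [wreathMat_apply, map_mul]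
  exact congrArg₂ (· * ·) (wreathLift_inl (H := quantumSymmetricGroup n) φ ψ h a (F.mat i j))
    (wreathLift_inr (H := quantumSymmetricGroup n) φ ψ h (symMat n a b))

/-- Nonzero products of entries of the fundamental representation of the free wreath product
respect the forest that consists of `n` copies of `F`. -/
lemma wreathMat_iff {i j k l : T} {a b c d : Fin n}
    (h : F.wreathMat n (i, a) (j, b) * F.wreathMat n (k, c) (l, d) ≠ 0) :
    (a = c ∧ F.par i k) ↔ (b = d ∧ F.par j l) := by
  have hv := (symMat_isFundamental n).magic
  rw [wreathMat_apply, wreathMat_apply] at h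
  have hac : a = c ↔ b = d := by
    constructor
    · rintro rfl
      by_contra hbd
      rw [(sym_commute _ a b).symm.mul_mul_mul_comm, ← map_mul symInr, hv.row_orthogonal a hbd,
        map_zero, mul_zero] at h
      exact h rfl
    · rintro rfl
      by_contra hac
      rw [(sym_commute (F.mat k l) c b).eq, mul_assoc, ← mul_assoc (symInr (symMat n a b)),
        ← map_mul symInr, hv.col_orthogonal b hac, map_zero, zero_mul, mul_zero] at h
      exact h rfl
  rw [← hac]
  refine and_congr_right fun hac => ?_
  subst hac
  refine F.preserves_mat.iff fun h0 => h ?_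
  rw [(sym_commute _ a b).symm.mul_mul_mul_comm, ← map_mul, h0, map_zero, zero_mul]

end Wreath

section Copies

variable {T V A : Type} {n : ℕ} {F₁ : Forest T} {F : Forest V} {r : T} {e : T × Fin n ≃ V}

lemma root_copy (hr : ∀ i, F₁.root i = r)
    (he : ∀ i k a c, F.par (e (i, a)) (e (k, c)) ↔ a = c ∧ F₁.par i k) (i : T) (a : Fin n) :
    F.root (e (i, a)) = e (r, a) := by
  induction i using F₁.induction with
  | hr i hi =>
    rw [← hr i, root_of_isRoot hi, root_of_isRoot fun x hx => ?_]
    obtain ⟨⟨k, c⟩, rfl⟩ := e.surjective x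
    exact hi k ((he i k a c).1 hx).2
  | hp i k h ih => rw [root_of_par ((he i k a a).2 ⟨rfl, h⟩), ih]

variable [Fintype V] [CStarAlgebra A] {u : Matrix V V A}

lemma mul_copy (hu : IsMagicUnitary u) (hF : PreservesRel u F.par) (hr : ∀ i, F₁.root i = r)
    (he : ∀ i k a c, F.par (e (i, a)) (e (k, c)) ↔ a = c ∧ F₁.par i k) (i j : T) (a b : Fin n) :
    u (e (i, a)) (e (j, b)) * u (e (r, a)) (e (r, b)) = u (e (i, a)) (e (j, b)) := by
  have := mul_root hu hF (e (i, a)) (e (j, b))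
  rwa [root_copy hr he, root_copy hr he] at this

lemma copy_mul (hu : IsMagicUnitary u) (hF : PreservesRel u F.par) (hr : ∀ i, F₁.root i = r)
    (he : ∀ i k a c, F.par (e (i, a)) (e (k, c)) ↔ a = c ∧ F₁.par i k) (i j : T) (a b : Fin n) :
    u (e (r, a)) (e (r, b)) * u (e (i, a)) (e (j, b)) = u (e (i, a)) (e (j, b)) := by
  have := congrArg star (mul_copy hu hF hr he i j a b)
  rwa [star_mul, hu.star_eq, hu.star_eq] at this

variable [Fintype T]

/-- The `(a, b)` block of a magic unitary that permutes copies of a tree has constant row sums. -/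
lemma sum_copy (hu : IsMagicUnitary u) (hF : PreservesRel u F.par) (hr : ∀ i, F₁.root i = r)
    (he : ∀ i k a c, F.par (e (i, a)) (e (k, c)) ↔ a = c ∧ F₁.par i k) (i : T) (a b : Fin n) :
    ∑ j, u (e (i, a)) (e (j, b)) = u (e (r, a)) (e (r, b)) := by
  conv_rhs => rw [← mul_one (u (e (r, a)) (e (r, b))), ← hu.row_sum (e (i, a)), ← e.sum_comp,
    Fintype.sum_prod_type, Finset.mul_sum]
  refine Finset.sum_congr rfl fun j _ => ?_
  rw [Finset.mul_sum, Finset.sum_eq_single b]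
  · rw [copy_mul hu hF hr he]
  · intro d _ hd
    rw [← copy_mul hu hF hr he i j a d, ← mul_assoc, hu.row_orthogonal, zero_mul]
    simpa using hd.symm
  · intro h; exact absurd (Finset.mem_univ b) h

variable [Nonempty T] [Nonempty V] [NeZero n]

/-- The quantum automorphism group of `n` copies of a rooted tree is the free wreath product of the
quantum automorphism group of that tree by the quantum symmetric group. -/
lemma qut_iso_freeWreath (F : Forest V) (F₁ : Forest T) (r : T) (hr : ∀ i, F₁.root i = r)
    (e : T × Fin n ≃ V)
    (he : ∀ i k a c, F.par (e (i, a)) (e (k, c)) ↔ a = c ∧ F₁.par i k) :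
    (F₁.qut.freeWreath (quantumSymmetricGroup n)).Iso F.qut := by
  have hu := F.magic_mat
  have hF := F.preserves_mat
  have hne {i j : T} {a b : Fin n} (h : a ≠ b) : e (i, a) ≠ e (j, b) := by simp [h]
  let v : Matrix (Fin n) (Fin n) F.qut.Alg := Matrix.of fun a b => F.mat (e (r, a)) (e (r, b))
  have v_apply (a b) : v a b = F.mat (e (r, a)) (e (r, b)) := rfl
  let U (a : Fin n) : Matrix T T F.qut.Alg :=
    Matrix.of fun i j => ∑ b, F.mat (e (i, a)) (e (j, b))
  have U_apply (a i j) : U a i j = ∑ b, F.mat (e (i, a)) (e (j, b)) := rfl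
  have v_row (a) : ∑ b, v a b = 1 := by
    simp only [v_apply, ← sum_copy hu hF hr he r a]
    rw [← hu.row_sum (e (r, a)), ← e.sum_comp, Fintype.sum_prod_type_right]
  have v_col (b) : ∑ a, v a b = 1 := by
    have h := sum_copy hu.transpose hF.transpose hr he r b
    simp only [Matrix.transpose_apply] at h
    simp only [v_apply, ← h]
    rw [← hu.col_sum (e (r, b)), ← e.sum_comp, Fintype.sum_prod_type_right]
  have hv : IsMagicUnitary v :=
    ⟨fun a b => hu.star_eq _ _, fun a b => hu.mul_self _ _, v_row, v_col⟩
  have hU (a) : IsMagicUnitary (U a) := by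
    refine ⟨fun i j => ?_, fun i j => ?_, fun i => ?_, fun j => ?_⟩
    · simp only [U_apply, star_sum, hu.star_eq]
    · rw [U_apply, Finset.sum_mul_sum]
      refine Finset.sum_congr rfl fun b _ => ?_
      rw [Finset.sum_eq_single b]
      · rw [hu.mul_self]
      · intro d _ hd
        exact hu.row_orthogonal _ (hne hd.symm)
      · intro h; exact absurd (Finset.mem_univ b) h
    · simp only [U_apply]
      rw [← hu.row_sum (e (i, a)), ← e.sum_comp, Fintype.sum_prod_type]
    · simp only [U_apply]
      rw [Finset.sum_comm]
      have h (b) := sum_copy hu.transpose hF.transpose hr he j b a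
      simp only [Matrix.transpose_apply] at h
      simp only [h, ← v_apply, v_row]
  have hUF (a) : PreservesRel (U a) F₁.par := preservesRel_of_iff fun i j k l h => by
    rw [U_apply, U_apply, Finset.sum_mul_sum] at h
    obtain ⟨b, -, h⟩ := Finset.exists_ne_zero_of_sum_ne_zero h
    obtain ⟨d, -, h⟩ := Finset.exists_ne_zero_of_sum_ne_zero h
    have hbd : b = d := by
      by_contra hbd
      rw [← mul_copy hu hF hr he, ← copy_mul hu hF hr he k, mul_assoc,
        ← mul_assoc (F.mat (e (r, a)) (e (r, b))), hu.row_orthogonal _ (hne hbd), zero_mul,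
        mul_zero] at h
      exact h rfl
    subst hbd
    simpa [he] using hF.iff h
  have hmul (i j a b) : U a i j * v a b = F.mat (e (i, a)) (e (j, b)) := by
    rw [U_apply, Finset.sum_mul, Finset.sum_eq_single b]
    · exact mul_copy hu hF hr he i j a b
    · intro d _ hd
      rw [← mul_copy hu hF hr he, mul_assoc, v_apply, hu.row_orthogonal _ (hne hd), mul_zero]
    · intro h; exact absurd (Finset.mem_univ b) h
  have hcomm (i j a b) : Commute (U a i j) (v a b) := by
    have h := congrArg star (hmul i j a b)
    rw [star_mul, hv.star_eq, (hU a).star_eq, hu.star_eq] at h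
    rw [commute_iff_eq, h, hmul]
  have hw := (F₁.wreathMat_isFundamental (n := n)).magic
  have hwF : PreservesRel ((F₁.wreathMat n).submatrix e.symm e.symm) F.par :=
    preservesRel_of_iff fun x y x' y' h => by
      obtain ⟨⟨i, a⟩, rfl⟩ := e.surjective x
      obtain ⟨⟨j, b⟩, rfl⟩ := e.surjective y
      obtain ⟨⟨k, c⟩, rfl⟩ := e.surjective x'
      obtain ⟨⟨l, d⟩, rfl⟩ := e.surjective y'
      simp only [Matrix.submatrix_apply, Equiv.symm_apply_apply] at h
      rw [he, he]
      exact F₁.wreathMat_iff h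
  refine Iso.of_equiv F₁.wreathMat_isFundamental F.isFundamental_mat e
    (F₁.qutWreathLift (fun a => F₁.qutLift (U a) (hU a) (hUF a)) (symLift v hv)
      fun i j a b => by rw [qutLift_mat, symLift_mat]; exact hcomm i j a b)
    (F.qutLift _ (hw.reindex e.symm) hwF) ?_ (fun x y => ?_)
  · rintro ⟨i, a⟩ ⟨j, b⟩
    rw [qutWreathLift_mat, qutLift_mat, symLift_mat, hmul]
  · rw [qutLift_mat, Matrix.submatrix_apply, e.symm_apply_apply, e.symm_apply_apply]

end Copies

end Forest

/-! ### The centroid of a tree -/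

section Tree

variable {V : Type} {X : SimpleGraph V}

lemma exists_adj_dist_eq (hX : X.Connected) {r z : V} {n : ℕ} (h : X.dist r z = n + 1) :
    ∃ w, X.Adj z w ∧ X.dist r w = n := by
  obtain ⟨p, hp⟩ := hX.exists_walk_length_eq_dist z r
  rw [SimpleGraph.dist_comm, h] at hp
  cases p with
  | nil => simp at hp
  | cons hzw q =>
    rename_i w
    refine ⟨w, hzw, le_antisymm ?_ ?_⟩
    · rw [SimpleGraph.dist_comm]
      have := SimpleGraph.dist_le q
      rw [SimpleGraph.Walk.length_cons] at hp
      omega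
    · have h1 := hX.dist_triangle (u := r) (v := w) (w := z)
      rw [SimpleGraph.dist_eq_one_iff_adj.2 hzw.symm] at h1
      omega

/-- In a tree, at most one neighbour of `v` is closer to `y` than `v`. -/
lemma eq_of_dist_lt (hX : X.IsTree) {v w w' y : V} (h : X.Adj v w) (h' : X.Adj v w')
    (hw : X.dist v y = X.dist w y + 1) (hw' : X.dist v y = X.dist w' y + 1) : w = w' := by
  obtain ⟨p, hp⟩ := hX.connected.exists_walk_length_eq_dist w y
  obtain ⟨q, hq⟩ := hX.connected.exists_walk_length_eq_dist w' y
  have h1 := (SimpleGraph.Walk.cons h p).isPath_of_length_eq_dist (by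
    rw [SimpleGraph.Walk.length_cons, hp, hw])
  have h2 := (SimpleGraph.Walk.cons h' q).isPath_of_length_eq_dist (by
    rw [SimpleGraph.Walk.length_cons, hq, hw'])
  have := congrArg Subtype.val
    ((hX.isAcyclic.subsingleton_path v y).elim ⟨_, h1⟩ ⟨_, h2⟩)
  simp only [SimpleGraph.Walk.cons.injEq] at this
  exact this.1

variable [Fintype V]

variable (X) in
/-- The sum of the distances from a vertex to all vertices; it is minimal at the centroids. -/
def distSum (v : V) : ℕ := ∑ y, X.dist v y

/-- The sum of the distances is strictly convex along the paths of a tree. -/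
lemma two_mul_distSum_lt (hX : X.IsTree) {v w w' : V} (h : X.Adj v w) (h' : X.Adj v w')
    (hne : w ≠ w') : 2 * distSum X v < distSum X w + distSum X w' := by
  rw [distSum, distSum, distSum, Finset.mul_sum, ← Finset.sum_add_distrib]
  refine Finset.sum_lt_sum (fun y _ => ?_) ⟨v, Finset.mem_univ v, ?_⟩
  · have h1 := hX.dist_eq_dist_add_one_of_adj y h
    have h2 := hX.dist_eq_dist_add_one_of_adj y h'
    simp only [SimpleGraph.dist_comm (u := y)] at h1 h2
    by_contra! hlt
    exact hne (eq_of_dist_lt hX h h' (y := y) (by omega) (by omega))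
  · rw [SimpleGraph.dist_self, SimpleGraph.dist_eq_one_iff_adj.2 h.symm]
    omega

/-- A tree as a rooted forest: parents are the neighbours that are closer to the centroid. The
roots are the centroids, so that there may be two components. -/
def Forest.ofTree (X : SimpleGraph V) (hX : X.IsTree) : Forest V where
  par i k := X.Adj i k ∧ distSum X k < distSum X i
  uniq {i k l} hk hl := by
    by_contra hne
    have := two_mul_distSum_lt hX hk.1 hl.1 hne
    have := hk.2
    have := hl.2
    omega
  rank := distSum X
  rank_lt h := h.2

lemma distSum_le_of_isRoot (hX : X.IsTree) {r : V} (hr : (Forest.ofTree X hX).IsRoot r) (n : ℕ)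
    {y z : V} (h : X.Adj y z) (hy : X.dist r y = n + 1) (hz : X.dist r z = n) :
    distSum X z ≤ distSum X y ∧ (n ≠ 0 → distSum X z < distSum X y) := by
  induction n generalizing y z with
  | zero =>
    obtain rfl := (hX.connected.dist_eq_zero_iff).1 hz
    refine ⟨?_, fun h => absurd rfl h⟩
    by_contra! hlt
    exact hr y ⟨h.symm, hlt⟩
  | succ n ih =>
    obtain ⟨w, hzw, hw⟩ := exists_adj_dist_eq hX.connected hz
    have h1 := (ih hzw hz hw).1
    have hne : y ≠ w := by
      rintro rfl
      omega
    have := two_mul_distSum_lt hX h.symm hzw hne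
    exact ⟨by omega, fun _ => by omega⟩

/-- A tree has at most two centroids, and they are adjacent. -/
lemma adj_of_isRoot (hX : X.IsTree) {r s : V} (hr : (Forest.ofTree X hX).IsRoot r)
    (hs : (Forest.ofTree X hX).IsRoot s) (hne : r ≠ s) : X.Adj r s := by
  rw [← SimpleGraph.dist_eq_one_iff_adj]
  obtain ⟨n, hn⟩ := Nat.exists_eq_succ_of_ne_zero
    (mt (hX.connected.dist_eq_zero_iff (u := r) (v := s)).1 hne)
  obtain ⟨z, hz, hz'⟩ := exists_adj_dist_eq hX.connected hn
  by_contra h1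
  exact hs z ⟨hz, (distSum_le_of_isRoot hX hr n hz hn hz').2 (by omega)⟩

lemma adj_iff (hX : X.IsTree) (i k : V) : X.Adj i k ↔
    (Forest.ofTree X hX).par i k ∨ (Forest.ofTree X hX).par k i ∨
      (i ≠ k ∧ (Forest.ofTree X hX).IsRoot i ∧ (Forest.ofTree X hX).IsRoot k) := by
  have key {i k : V} (h : X.Adj i k) (hik : distSum X i = distSum X k) :
      (Forest.ofTree X hX).IsRoot i := by
    rintro l ⟨hl, hlt⟩
    have := two_mul_distSum_lt hX h hl (by rintro rfl; omega)
    omega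
  refine ⟨fun h => ?_, ?_⟩
  · rcases lt_trichotomy (distSum X i) (distSum X k) with h1 | h1 | h1
    · exact .inr (.inl ⟨h.symm, h1⟩)
    · exact .inr (.inr ⟨h.ne, key h h1, key h.symm h1.symm⟩)
    · exact .inl ⟨h, h1⟩
  · rintro (h | h | ⟨hne, hi, hk⟩)
    · exact h.1
    · exact h.1.symm
    · exact adj_of_isRoot hX hi hk hne

variable {A : Type} [CStarAlgebra A] {u : Matrix V V A}

lemma dist_eq_of_preserves (hX : X.Connected) (hu : IsMagicUnitary u)
    (h : PreservesRel u X.Adj) {i j k l : V} (hne : u i j * u k l ≠ 0) :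
    X.dist i k = X.dist j l := by
  have key (n : ℕ) : PreservesRel u fun i k => X.dist i k ≤ n := by
    induction n with
    | zero =>
      have : (fun i k => X.dist i k ≤ 0) = Eq := by
        ext i k
        rw [Nat.le_zero, hX.dist_eq_zero_iff]
      rw [this]
      exact preservesRel_eq hu
    | succ n ih =>
      have h1 : PreservesRel u fun i m => i = m ∨ X.Adj i m :=
        preservesRel_of_iff fun i j k l h0 => or_congr ((preservesRel_eq hu).iff h0) (h.iff h0)
      have h2 : (fun i k => X.dist i k ≤ n + 1) =
          fun i k => ∃ m, (i = m ∨ X.Adj i m) ∧ X.dist m k ≤ n := by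
        ext i k
        constructor
        · intro hle
          rcases hle.eq_or_lt with heq | hlt
          · rw [SimpleGraph.dist_comm] at heq
            obtain ⟨m, hm, hm'⟩ := exists_adj_dist_eq hX heq
            exact ⟨m, .inr hm, by rw [SimpleGraph.dist_comm, hm']⟩
          · exact ⟨i, .inl rfl, Nat.lt_succ_iff.1 hlt⟩
        · rintro ⟨m, rfl | hm, hle⟩
          · exact hle.trans n.le_succ
          · have := hX.dist_triangle (u := i) (v := m) (w := k)
            rw [SimpleGraph.dist_eq_one_iff_adj.2 hm] at this
            omega
      rw [h2]
      exact h1.comp hu ih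
  exact le_antisymm (((key _).iff hne).2 le_rfl) (((key _).iff hne).1 le_rfl)

/-- The quantum automorphism group of a tree is that of the associated forest. -/
lemma Qut_iso_ofTree [Nonempty V] (hX : X.IsTree) : (Qut X).Iso (Forest.ofTree X hX).qut := by
  refine magicGroup_iso _ _ ?_ ?_
  · have hu : IsMagicUnitary (ι := V) (Qut X).u := (Qut X).magic
    have hA : PreservesRel (ι := V) (Qut X).u X.Adj := Qut_preserves X
    have hd {i j : V} (h : (Qut X).u i j ≠ 0) : distSum X i = distSum X j :=
      hu.sum_eq h _ _ fun k l hkl => dist_eq_of_preserves hX.connected hu hA hkl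
    refine preservesRel_of_iff fun i j k l h => ?_
    have h1 := hd (left_ne_zero_of_mul h)
    have h2 := hd (right_ne_zero_of_mul h)
    have h3 := hA.iff h
    simp only [Forest.ofTree, h1, h2, h3]
  · have hu := (Forest.ofTree X hX).magic_mat
    have hF := (Forest.ofTree X hX).preserves_mat
    refine preservesRel_of_iff fun i j k l h => ?_
    rw [adj_iff hX, adj_iff hX, hF.iff h, (hF.swap hu).iff h, ne_eq, ne_eq,
      (preservesRel_eq hu).iff h,
      Forest.isRoot_iff hu hF (left_ne_zero_of_mul h),
      Forest.isRoot_iff hu hF (right_ne_zero_of_mul h)]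

end Tree

namespace Forest

/-! ### Operations on rooted forests -/

section Operations

variable {V V₁ V₂ : Type}

/-- The disjoint union of two forests. -/
def sum (F₁ : Forest V₁) (F₂ : Forest V₂) : Forest (V₁ ⊕ V₂) where
  par := Sum.LiftRel F₁.par F₂.par
  uniq := by
    rintro (i | i) (k | k) (l | l) hk hl <;>
      simp only [Sum.liftRel_inl_inl, Sum.liftRel_inr_inr, Sum.not_liftRel_inl_inr,
        Sum.not_liftRel_inr_inl] at hk hl
    · rw [F₁.uniq hk hl]
    · rw [F₂.uniq hk hl]
  rank := Sum.elim F₁.rank F₂.rank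
  rank_lt := by
    rintro _ _ (h | h)
    · exact F₁.rank_lt h
    · exact F₂.rank_lt h

/-- The parent relation of `Forest.addRoot`. -/
def addRootPar (F : Forest V) : Option V → Option V → Prop
  | some i, some k => F.par i k
  | some i, none => F.IsRoot i
  | none, _ => False

/-- The tree obtained from a forest by a new vertex `none`, which becomes the parent of all roots.
-/
def addRoot (F : Forest V) : Forest (Option V) where
  par := F.addRootPar
  uniq := by
    rintro (_ | i) (_ | k) (_ | l) hk hl
    · rfl
    · exact hk.elim
    · exact hl.elim
    · exact hk.elim
    · rfl
    · exact (hk l hl).elim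
    · exact (hl k hk).elim
    · exact congrArg some (F.uniq hk hl)
  rank x := x.elim 0 fun i => F.rank i + 1
  rank_lt := by
    rintro (_ | i) (_ | k) h
    · exact h.elim
    · exact h.elim
    · exact Nat.succ_pos _
    · exact Nat.succ_lt_succ (F.rank_lt h)

/-- The disjoint union of `n` copies of a forest. -/
def copies (F : Forest V) (n : ℕ) : Forest (V × Fin n) where
  par x y := x.2 = y.2 ∧ F.par x.1 y.1
  uniq h h' := Prod.ext (F.uniq h.2 h'.2) (h.1.symm.trans h'.1)
  rank x := F.rank x.1
  rank_lt h := F.rank_lt h.2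

/-- The induced forest on a set of vertices; a vertex whose parent is left out becomes a root. -/
def restrict (F : Forest V) (S : V → Prop) : Forest {v // S v} where
  par x y := F.par x.1 y.1
  uniq h h' := Subtype.ext (F.uniq h h')
  rank x := F.rank x.1
  rank_lt h := F.rank_lt h

/-- The one-vertex forest. -/
def point : Forest Unit := ⟨fun _ _ => False, fun h => h.elim, fun _ => 0, fun h => h.elim⟩

variable (F : Forest V) (F₁ : Forest V₁) (F₂ : Forest V₂)

lemma isRoot_sum_inl {i : V₁} : (F₁.sum F₂).IsRoot (.inl i) ↔ F₁.IsRoot i :=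
  ⟨fun h k hk => h (.inl k) (Sum.LiftRel.inl hk), fun h k hk => by
    cases hk with
    | inl hk => exact h _ hk⟩

lemma isRoot_sum_inr {i : V₂} : (F₁.sum F₂).IsRoot (.inr i) ↔ F₂.IsRoot i :=
  ⟨fun h k hk => h (.inr k) (Sum.LiftRel.inr hk), fun h k hk => by
    cases hk with
    | inr hk => exact h _ hk⟩

lemma root_sum_inl (i : V₁) : (F₁.sum F₂).root (.inl i) = .inl (F₁.root i) := by
  induction i using F₁.induction with
  | hr i hi => rw [root_of_isRoot hi, root_of_isRoot ((isRoot_sum_inl _ _).2 hi)]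
  | hp i k h ih =>
    rw [root_of_par h, ← ih]
    exact root_of_par (Sum.LiftRel.inl h)

lemma root_sum_inr (i : V₂) : (F₁.sum F₂).root (.inr i) = .inr (F₂.root i) := by
  induction i using F₂.induction with
  | hr i hi => rw [root_of_isRoot hi, root_of_isRoot ((isRoot_sum_inr _ _).2 hi)]
  | hp i k h ih =>
    rw [root_of_par h, ← ih]
    exact root_of_par (Sum.LiftRel.inr h)

lemma isRoot_addRoot_none : F.addRoot.IsRoot none := fun _ h => h

lemma root_addRoot (x : Option V) : F.addRoot.root x = none := by
  have h0 := root_of_isRoot F.isRoot_addRoot_none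
  rcases x with _ | i
  · exact h0
  induction i using F.induction with
  | hr i hi => exact (root_of_par (F := F.addRoot) (i := some i) (k := none) hi).trans h0
  | hp i k h ih => exact (root_of_par (F := F.addRoot) (i := some i) (k := some k) h).trans ih

lemma qut_iso_qut_addRoot [Fintype V] [Nonempty V] : F.qut.Iso F.addRoot.qut :=
  qut_iso_addRoot F.addRoot F (Equiv.refl _) (fun _ _ => Iff.rfl) (fun _ => Iff.rfl)
    F.isRoot_addRoot_none

end Operations

/-! ### Heights -/

section Height

variable {V V₁ V₂ : Type}

/-- There is a chain of `d` successive descendants below the vertex. -/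
def HasHeight (F : Forest V) : ℕ → V → Prop
  | 0, _ => True
  | d + 1, v => ∃ k, F.par k v ∧ F.HasHeight d k

lemma exists_not_hasHeight [Fintype V] (F : Forest V) : ∃ N, ∀ v, ¬F.HasHeight N v := by
  have h (d : ℕ) (v : V) (hd : F.HasHeight d v) : ∃ w, F.rank v + d ≤ F.rank w := by
    induction d generalizing v with
    | zero => exact ⟨v, le_rfl⟩
    | succ d ih =>
      obtain ⟨k, hk, hd⟩ := hd
      obtain ⟨w, hw⟩ := ih k hd
      have := F.rank_lt hk
      exact ⟨w, by omega⟩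
  refine ⟨Finset.univ.sup F.rank + 1, fun v hv => ?_⟩
  obtain ⟨w, hw⟩ := h _ v hv
  have := Finset.le_sup (f := F.rank) (Finset.mem_univ w)
  omega

lemma hasHeight_of_ne_zero {A : Type} [CStarAlgebra A] [Fintype V] {u : Matrix V V A}
    {F : Forest V} (hu : IsMagicUnitary u) (hF : PreservesRel u F.par) {d : ℕ} {i j : V}
    (hij : u i j ≠ 0) (h : F.HasHeight d i) : F.HasHeight d j := by
  induction d generalizing i j with
  | zero => trivial
  | succ d ih =>
    obtain ⟨k, hk, hd⟩ := h
    obtain ⟨l, hl⟩ := hu.exists_row hij k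
    exact ⟨l, ((hF.swap hu).iff hl).1 hk, ih (right_ne_zero_of_mul hl) hd⟩

lemma hasHeight_sum_inl {F₁ : Forest V₁} {F₂ : Forest V₂} {d : ℕ} {i : V₁} :
    (F₁.sum F₂).HasHeight d (.inl i) ↔ F₁.HasHeight d i := by
  induction d generalizing i with
  | zero => exact Iff.rfl
  | succ d ih =>
    constructor
    · rintro ⟨_, hk, hd⟩
      cases hk with
      | inl hk => exact ⟨_, hk, ih.1 hd⟩
    · rintro ⟨k, hk, hd⟩
      exact ⟨.inl k, Sum.LiftRel.inl hk, ih.2 hd⟩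

lemma hasHeight_sum_inr {F₁ : Forest V₁} {F₂ : Forest V₂} {d : ℕ} {i : V₂} :
    (F₁.sum F₂).HasHeight d (.inr i) ↔ F₂.HasHeight d i := by
  induction d generalizing i with
  | zero => exact Iff.rfl
  | succ d ih =>
    constructor
    · rintro ⟨_, hk, hd⟩
      cases hk with
      | inr hk => exact ⟨_, hk, ih.1 hd⟩
    · rintro ⟨k, hk, hd⟩
      exact ⟨.inr k, Sum.LiftRel.inr hk, ih.2 hd⟩

lemma HasHeight.addRoot_some {F : Forest V} {d : ℕ} {i : V} (h : F.HasHeight d i) :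
    F.addRoot.HasHeight d (some i) := by
  induction d generalizing i with
  | zero => trivial
  | succ d ih =>
    obtain ⟨k, hk, hd⟩ := h
    exact ⟨some k, hk, ih hd⟩

/-- The disjoint union of two forests with components of different heights gives a free product. -/
lemma qut_sum_iso [Fintype V₁] [Fintype V₂] [Nonempty V₁] [Nonempty V₂] (F₁ : Forest V₁)
    (F₂ : Forest V₂) (N : ℕ) (h₁ : ∀ i, ¬F₁.HasHeight N i)
    (h₂ : ∀ i, F₂.IsRoot i → F₂.HasHeight N i) :
    (F₁.qut.freeProd F₂.qut).Iso (F₁.sum F₂).qut := by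
  have hu := (F₁.sum F₂).magic_mat
  have hF := (F₁.sum F₂).preserves_mat
  refine qut_iso_freeProd (F₁.sum F₂) F₁ F₂ (Equiv.refl _) (fun _ _ => Iff.rfl)
    (fun i j => ?_) (fun i j => ?_)
  · by_contra h
    have h := root_ne_zero hu.transpose hF.transpose h
    simp only [Equiv.refl_apply, root_sum_inl, root_sum_inr] at h
    exact h₁ _ (hasHeight_sum_inl.1 (hasHeight_of_ne_zero hu.transpose hF.transpose h
      (hasHeight_sum_inr.2 (h₂ _ (isRoot_root _)))))
  · by_contra h
    have h := root_ne_zero hu hF h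
    simp only [Equiv.refl_apply, root_sum_inl, root_sum_inr] at h
    exact h₁ _ (hasHeight_sum_inl.1 (hasHeight_of_ne_zero hu hF h
      (hasHeight_sum_inr.2 (h₂ _ (isRoot_root _)))))

end Height

/-! ### Adjusting a forest without changing its quantum automorphism group -/

section Adjust

/-- The number of roots and the numbers of children of the vertices are at most `m`. -/
structure BranchingLE {V : Type} (F : Forest V) (m : ℕ) : Prop where
  children : ∀ v, Nat.card {k // F.par k v} ≤ m
  roots : Nat.card {k // F.IsRoot k} ≤ m

lemma card_children_addRoot_none {V : Type} (F : Forest V) :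
    Nat.card {k // F.addRoot.par k none} = Nat.card {k // F.IsRoot k} := by
  symm
  refine Nat.card_eq_of_bijective (fun k => ⟨some k.1, k.2⟩) ⟨?_, ?_⟩
  · rintro ⟨i, hi⟩ ⟨k, hk⟩ h
    exact Subtype.ext (Option.some_injective _ (congrArg Subtype.val h))
  · rintro ⟨_ | k, hk⟩
    · exact hk.elim
    · exact ⟨⟨k, hk⟩, rfl⟩

lemma card_children_addRoot_some {V : Type} [Finite V] (F : Forest V) (v : V) :
    Nat.card {k // F.addRoot.par k (some v)} ≤ Nat.card {k // F.par k v} := by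
  refine Nat.card_le_card_of_surjective (fun k => ⟨some k.1, k.2⟩) ?_
  rintro ⟨_ | k, hk⟩
  · exact hk.elim
  · exact ⟨⟨k, hk⟩, rfl⟩

lemma isRoot_eq_none {V : Type} {F : Forest V} {x : Option V} (h : F.addRoot.IsRoot x) :
    x = none := by
  rw [← root_of_isRoot h, root_addRoot]

lemma BranchingLE.addRoot {V : Type} [Finite V] {F : Forest V} {m : ℕ} (h : F.BranchingLE m)
    (hm : 1 ≤ m) : F.addRoot.BranchingLE m where
  children := by
    rintro (_ | v)
    · rw [card_children_addRoot_none]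
      exact h.roots
    · exact (card_children_addRoot_some F v).trans (h.children v)
  roots := by
    refine le_trans ?_ hm
    have : Subsingleton {k // F.addRoot.IsRoot k} :=
      ⟨fun x y => Subtype.ext ((isRoot_eq_none x.2).trans (isRoot_eq_none y.2).symm)⟩
    exact Finite.card_le_one_iff_subsingleton.2 this

/-- Adding roots repeatedly makes a forest an arbitrarily high tree. -/
lemma exists_high_tree {V : Type} [Fintype V] [Nonempty V] (F : Forest V) (N : ℕ) :
    ∃ (W : Type) (_ : Fintype W) (_ : Nonempty W) (F' : Forest W), F.qut.Iso F'.qut ∧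
      (∀ i, F'.IsRoot i → F'.HasHeight N i) ∧
      ∀ m, 1 ≤ m → F.BranchingLE m → F'.BranchingLE m := by
  suffices h : ∃ (W : Type) (_ : Fintype W) (F' : Forest (Option W)), F.qut.Iso F'.qut ∧
      (∀ i, F'.IsRoot i ↔ i = none) ∧ F'.HasHeight N none ∧
      ∀ m, 1 ≤ m → F.BranchingLE m → F'.BranchingLE m by
    obtain ⟨W, _, F', h1, h2, h3, h4⟩ := h
    exact ⟨Option W, inferInstance, inferInstance, F', h1,
      fun i hi => (h2 i).1 hi ▸ h3, h4⟩
  have hroot {W : Type} (F' : Forest W) (i : Option W) : F'.addRoot.IsRoot i ↔ i = none :=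
    ⟨isRoot_eq_none, fun h => h ▸ isRoot_addRoot_none F'⟩
  induction N with
  | zero =>
    exact ⟨V, inferInstance, F.addRoot, F.qut_iso_qut_addRoot, hroot F, trivial,
      fun m hm h => h.addRoot hm⟩
  | succ N ih =>
    obtain ⟨W, _, F', h1, h2, h3, h4⟩ := ih
    exact ⟨Option W, inferInstance, F'.addRoot, h1.trans F'.qut_iso_qut_addRoot, hroot F',
      ⟨some none, (h2 none).2 rfl, h3.addRoot_some⟩, fun m hm h => (h4 m hm h).addRoot hm⟩

/-- Adding disjoint paths that are higher than everything else increases the number of roots, but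
neither changes the quantum automorphism group nor increases the numbers of children. -/
lemma exists_many_roots {V : Type} [Fintype V] [Nonempty V] (F : Forest V) {m : ℕ} (hm : 1 ≤ m)
    (hF : ∀ v, Nat.card {k // F.par k v} ≤ m) (M : ℕ) :
    ∃ (W : Type) (_ : Fintype W) (_ : Nonempty W) (F' : Forest W), F.qut.Iso F'.qut ∧
      (∀ v, Nat.card {k // F'.par k v} ≤ m) ∧ M ≤ Nat.card {k // F'.IsRoot k} := by
  induction M with
  | zero => exact ⟨V, _, inferInstance, F, F.qut_iso_of_equiv F (Equiv.refl _) fun _ _ => Iff.rfl,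
      hF, Nat.zero_le _⟩
  | succ M ih =>
    obtain ⟨W, _, _, F', h1, h2, h3⟩ := ih
    obtain ⟨N, hN⟩ := F'.exists_not_hasHeight
    obtain ⟨P, _, _, C, c1, c2, c3⟩ := point.exists_high_tree N
    have hC := c3 m hm ⟨fun v => by simp [point], (Finite.card_subtype_le _).trans (by simpa)⟩
    have c1' := (one_iso_qut point).trans c1
    have hid := F'.qut_iso_of_equiv F' (Equiv.refl _) fun _ _ => Iff.rfl
    refine ⟨W ⊕ P, inferInstance, inferInstance, F'.sum C,
      (h1.trans (((freeProd_one_iso _).symm.trans (hid.freeProd c1')).trans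
        (qut_sum_iso F' C N hN c2))), ?_, ?_⟩
    · rintro (v | v)
      · rw [Nat.card_congr Equiv.subtypeSum, Nat.card_sum]
        simpa [Forest.sum] using h2 v
      · rw [Nat.card_congr Equiv.subtypeSum, Nat.card_sum]
        simpa [Forest.sum] using hC.children v
    · rw [Nat.card_congr Equiv.subtypeSum, Nat.card_sum]
      simp only [isRoot_sum_inl, isRoot_sum_inr]
      have : Nonempty {k // C.IsRoot k} := ⟨⟨_, isRoot_root (Classical.arbitrary P)⟩⟩
      have := Nat.card_pos (α := {k // C.IsRoot k})
      omega

end Adjust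

/-! ### The graph of a rooted tree -/

section Graph

variable {V : Type} (F : Forest V)

/-- The graph that underlies a rooted forest. -/
def graph : SimpleGraph V where
  Adj i k := F.par i k ∨ F.par k i
  symm := ⟨fun _ _ h => h.symm⟩
  loopless := ⟨fun _ h => (h.elim F.rank_lt F.rank_lt).false⟩

lemma graph_reachable_root (i : V) : F.graph.Reachable i (F.root i) := by
  induction i using F.induction with
  | hr i hi => rw [root_of_isRoot hi]
  | hp i k h ih =>
    rw [root_of_par h]
    exact (SimpleGraph.Adj.reachable (G := F.graph) (.inl h)).trans ih

lemma graph_isTree [Finite V] {t : V} (ht : ∀ i, F.root i = t) : F.graph.IsTree := by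
  have hc : F.graph.Connected :=
    { preconnected := fun i k => (ht i ▸ F.graph_reachable_root i).trans
        (ht k ▸ F.graph_reachable_root k).symm
      nonempty := ⟨t⟩ }
  rw [SimpleGraph.isTree_iff_connected_and_card]
  refine ⟨hc, le_antisymm ?_ hc.card_vert_le_card_edgeSet_add_one⟩
  have hpar (v : {v // v ≠ t}) : ∃ k, F.par v.1 k := by
    by_contra! h
    exact v.2 ((root_of_isRoot h).symm.trans (ht v.1))
  choose p hp using hpar
  have hs : Function.Surjective
      fun v : {v // v ≠ t} => (⟨s(v.1, p v), .inl (hp v)⟩ : F.graph.edgeSet) := by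
    rintro ⟨e, he⟩
    have key {i k : V} (h : F.par i k) : ∃ v : {v // v ≠ t}, s(v.1, p v) = s(i, k) := by
      refine ⟨⟨i, ?_⟩, ?_⟩
      · rintro rfl
        exact isRoot_root (F := F) i k (by rwa [ht i])
      · rw [F.uniq (hp ⟨i, _⟩) h]
    induction e with
    | h _ _ =>
      rcases he with h | h
      · obtain ⟨v, hv⟩ := key h
        exact ⟨v, Subtype.ext hv⟩
      · obtain ⟨v, hv⟩ := key h
        exact ⟨v, Subtype.ext (hv.trans Sym2.eq_swap)⟩
  have h1 : Nat.card F.graph.edgeSet ≤ Nat.card {v // v ≠ t} :=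
    Nat.card_le_card_of_surjective _ hs
  have := Fintype.ofFinite V
  classical
  have h2 : Nat.card {v // v ≠ t} + 1 = Nat.card V := by
    rw [Nat.card_eq_fintype_card, Nat.card_eq_fintype_card, ← Fintype.card_option]
    exact Fintype.card_congr (Equiv.optionSubtypeNe t)
  omega

variable {F} {A : Type} [CStarAlgebra A] [Fintype V] {u : Matrix V V A}

/-- A magic unitary that preserves the graph of a rooted tree and fixes the root preserves the
orientation of the edges towards the root. -/
lemma par_of_graph (hu : IsMagicUnitary u) (hX : PreservesRel u F.graph.Adj) {t : V}
    (ht : ∀ i, F.root i = t) (h0 : ∀ j, u t j ≠ 0 → j = t) {i j k l : V} (h : F.par i k)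
    (hne : u i j * u k l ≠ 0) : F.par j l := by
  induction k using F.induction generalizing i j l with
  | hr k hk =>
    have hkt : k = t := (root_of_isRoot hk).symm.trans (ht k)
    subst hkt
    obtain rfl := h0 l (right_ne_zero_of_mul hne)
    exact ((hX.iff hne).1 (.inl h)).resolve_right (hk j)
  | hp k m hkm ih =>
    refine ((hX.iff hne).1 (.inl h)).resolve_right fun hlj => hne ?_
    -- The grandparent of `i` is sent to the parent `j` of `l`, so that `i` is not sent to `j`.
    have h1 : u k l * u m j = u k l := hu.mul_eq_single _ m j fun n hn => by
      by_contra h2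
      exact hn (F.uniq (ih hkm h2) hlj)
    have h2 := congrArg star h1
    rw [star_mul, hu.star_eq, hu.star_eq] at h2
    have him : i ≠ m := by
      rintro rfl
      exact lt_asymm (F.rank_lt h) (F.rank_lt hkm)
    rw [← h2, ← mul_assoc, hu.col_orthogonal j him, zero_mul]

lemma Qut_graph_iso [Nonempty V] {t : V} (ht : ∀ i, F.root i = t)
    (hdeg : ∀ i, i ≠ t → Nat.card {k // F.graph.Adj i k} ≠ Nat.card {k // F.graph.Adj t k}) :
    (Qut F.graph).Iso F.qut := by
  refine magicGroup_iso _ _ ?_ ?_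
  · have hu : IsMagicUnitary (ι := V) (Qut F.graph).u := (Qut F.graph).magic
    have hX : PreservesRel (ι := V) (Qut F.graph).u F.graph.Adj := Qut_preserves F.graph
    refine preservesRel_of_iff fun i j k l h =>
      ⟨fun h' => par_of_graph hu hX ht (fun j hj => ?_) h' h,
        fun h' => par_of_graph hu.transpose hX.transpose ht (fun j hj => ?_) h' h⟩
    · by_contra hne
      exact hdeg j hne (hX.card_eq hu hj).symm
    · by_contra hne
      exact hdeg j hne (hX.transpose.card_eq hu.transpose hj).symm
  · have hu := F.magic_mat
    have hF := F.preserves_mat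
    exact preservesRel_of_iff fun i j k l h => or_congr (hF.iff h) ((hF.swap hu).iff h)

end Graph

/-- Every forest has the same quantum automorphism group as some tree: enlarge it so that a
common parent of the roots becomes the unique vertex of maximal degree. -/
lemma qut_mem_treeQut {V : Type} [Fintype V] [Nonempty V] (F : Forest V) : F.qut ∈ treeQut := by
  let m := Nat.card V
  have hm : 1 ≤ m := Nat.card_pos
  obtain ⟨W, _, _, F', h1, h2, h3⟩ :=
    F.exists_many_roots hm (fun v => Finite.card_subtype_le _) (m + 2)
  have ht := F'.root_addRoot
  refine ⟨Option W, inferInstance, inferInstance, F'.addRoot.graph, graph_isTree _ ht,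
    (h1.trans F'.qut_iso_qut_addRoot).trans (Qut_graph_iso ht ?_).symm⟩
  rintro (_ | i) hi
  · exact absurd rfl hi
  refine ne_of_lt (lt_of_lt_of_le ?_ (h3.trans ?_))
  · have ha := (F'.card_children_addRoot_some i).trans (h2 i)
    have hb : Nat.card {k // F'.addRoot.par (some i) k} ≤ 1 :=
      Finite.card_le_one_iff_subsingleton.2
        ⟨fun x y => Subtype.ext (F'.addRoot.uniq x.2 y.2)⟩
    have hc : Nat.card {k // F'.addRoot.graph.Adj (some i) k} ≤
        Nat.card {k // F'.addRoot.par (some i) k} + Nat.card {k // F'.addRoot.par k (some i)} :=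
      Set.ncard_union_le {k | F'.addRoot.par (some i) k} {k | F'.addRoot.par k (some i)}
    omega
  · rw [← card_children_addRoot_none]
    exact Nat.card_le_card_of_injective (fun k => ⟨k.1, .inr k.2⟩) fun x y h => by
      simpa [Subtype.ext_iff] using h

/-! ### Decomposition of a rooted forest -/

section Decomposition

variable {V : Type}

/-- A map that folds all components of a forest onto the component of `r`: it proceeds from the
roots to the leaves and maps the children of a vertex by the given bijections between the children
of equivalent vertices. -/
def fold (F : Forest V) (s : Setoid V)
    (β : ∀ i j, s i j → ({k // F.par k i} ≃ {k // F.par k j}))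
    (hβ : ∀ i j h k, s k.1 (β i j h k).1) (r : V) (hr : ∀ i, F.IsRoot i → s i r) (i : V) :
    {j // s i j} :=
  open Classical in
  if h : ∃ k, F.par i k then
    ⟨(β _ _ (fold F s β hβ r hr h.choose).2 ⟨i, h.choose_spec⟩).1,
      hβ h.choose _ (fold F s β hβ r hr h.choose).2 ⟨i, h.choose_spec⟩⟩
  else ⟨r, hr i (not_exists.1 h)⟩
termination_by F.rank i
decreasing_by exact F.rank_lt h.choose_spec

variable (F : Forest V) (s : Setoid V)
  (β : ∀ i j, s i j → ({k // F.par k i} ≃ {k // F.par k j}))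

lemma fold_of_isRoot (hβ : ∀ i j h k, s k.1 (β i j h k).1) (r : V)
    (hr : ∀ i, F.IsRoot i → s i r) {i : V} (h : F.IsRoot i) : (F.fold s β hβ r hr i).1 = r := by
  rw [fold, dif_neg (not_exists.2 h)]

lemma fold_of_par (hβ : ∀ i j h k, s k.1 (β i j h k).1) (r : V)
    (hr : ∀ i, F.IsRoot i → s i r) {i k : V} (h : F.par i k) :
    (F.fold s β hβ r hr i).1 = (β k _ (F.fold s β hβ r hr k).2 ⟨i, h⟩).1 := by
  have h' : ∃ k, F.par i k := ⟨k, h⟩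
  have key (k') (hk' : F.par i k') (e : k' = k) :
      (β k' _ (F.fold s β hβ r hr k').2 ⟨i, hk'⟩).1 =
        (β k _ (F.fold s β hβ r hr k).2 ⟨i, h⟩).1 := by
    subst e; rfl
  rw [fold, dif_pos h']
  exact key _ h'.choose_spec (F.uniq h'.choose_spec h)

variable {F}

lemma root_restrict {r : V} (i : {v // F.root v = r}) :
    (F.restrict fun v => F.root v = r).root i =
      ⟨r, (root_of_isRoot (i.2 ▸ isRoot_root i.1))⟩ := by
  induction i using (F.restrict fun v => F.root v = r).induction with
  | hr i hi =>
    rw [root_of_isRoot hi]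
    refine Subtype.ext ((root_of_isRoot fun k hk => ?_).symm.trans i.2)
    exact hi ⟨k, (root_of_par hk).symm.trans i.2⟩ hk
  | hp i k h ih => rw [root_of_par h, ih]

/-- If there is an equivalence relation for which all roots are equivalent, and equivalent vertices
have equally many children in each class, then the forest consists of copies of one tree. -/
lemma exists_equiv_copies [Finite V] (hβ : ∀ i j h k, s k.1 (β i j h k).1) {r : V}
    (hr : ∀ i, F.IsRoot i → s i r) (hroot : F.IsRoot r) :
    ∃ e : {v // F.root v = r} × Fin (Nat.card {v // F.IsRoot v}) ≃ V,
      ∀ i k a c, F.par (e (i, a)) (e (k, c)) ↔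
        a = c ∧ (F.restrict fun v => F.root v = r).par i k := by
  let g (i : V) : V := (F.fold s β hβ r hr i).1
  have g_root {i} (h : F.IsRoot i) : g i = r := F.fold_of_isRoot s β hβ r hr h
  have g_par {i k} (h : F.par i k) :
      g i = (β k (g k) (F.fold s β hβ r hr k).2 ⟨i, h⟩).1 := F.fold_of_par s β hβ r hr h
  have par_g {i k} (h : F.par i k) : F.par (g i) (g k) := by
    rw [g_par h]
    exact (β k (g k) (F.fold s β hβ r hr k).2 ⟨i, h⟩).2
  have root_g (i : V) : F.root (g i) = r := by
    induction i using F.induction with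
    | hr i hi => rw [g_root hi, root_of_isRoot hroot]
    | hp i k h ih => rw [root_of_par (par_g h), ih]
  let Φ (v : V) : {v // F.root v = r} × {v // F.IsRoot v} :=
    (⟨g v, root_g v⟩, ⟨F.root v, isRoot_root v⟩)
  have inj {v w : V} (h1 : F.root v = F.root w) (h2 : g v = g w) : v = w := by
    induction v using F.induction generalizing w with
    | hr v hv =>
      by_cases hw : F.IsRoot w
      · rwa [root_of_isRoot hv, root_of_isRoot hw] at h1
      · obtain ⟨k, hk⟩ := not_forall_not.1 hw
        have h3 := par_g hk
        rw [← h2, g_root hv] at h3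
        exact (hroot _ h3).elim
    | hp v k hvk ih =>
      by_cases hw : F.IsRoot w
      · have h3 := par_g hvk
        rw [h2, g_root hw] at h3
        exact (hroot _ h3).elim
      · obtain ⟨l, hwl⟩ := not_forall_not.1 hw
        have h3 := par_g hwl
        rw [← h2] at h3
        have hkl : k = l := ih (by rw [← root_of_par hvk, h1, root_of_par hwl])
          (F.uniq (par_g hvk) h3)
        subst hkl
        rw [g_par hvk, g_par hwl] at h2
        exact congrArg Subtype.val ((β k _ _).injective (Subtype.ext h2))
  have lift {k t : V} (h : F.par t (g k)) : ∃ i, F.par i k ∧ g i = t := by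
    let i := (β k (g k) (F.fold s β hβ r hr k).2).symm ⟨t, h⟩
    refine ⟨i.1, i.2, (g_par i.2).trans ?_⟩
    exact congrArg Subtype.val ((β k (g k) (F.fold s β hβ r hr k).2).apply_symm_apply ⟨t, h⟩)
  have surj (t : V) (a : V) (ht : F.root t = r) (ha : F.IsRoot a) :
      ∃ v, g v = t ∧ F.root v = a := by
    induction t using F.induction with
    | hr t h =>
      rw [root_of_isRoot h] at ht
      exact ⟨a, by rw [g_root ha, ht], root_of_isRoot ha⟩
    | hp t k h ih =>
      obtain ⟨w, rfl, hw⟩ := ih (by rw [← root_of_par h, ht])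
      obtain ⟨i, hi, hi'⟩ := lift h
      exact ⟨i, hi', by rw [root_of_par hi, hw]⟩
  have hΦ : Φ.Bijective := by
    constructor
    · intro v w h
      exact inj (congrArg Subtype.val (congrArg Prod.snd h))
        (congrArg Subtype.val (congrArg Prod.fst h))
    · rintro ⟨⟨t, ht⟩, ⟨a, ha⟩⟩
      obtain ⟨v, rfl, rfl⟩ := surj t a ht ha
      exact ⟨v, rfl⟩
  have key (v w : V) : F.par v w ↔ (Φ v).2 = (Φ w).2 ∧ F.par (Φ v).1.1 (Φ w).1.1 := by
    refine ⟨fun h => ⟨Subtype.ext (root_of_par h), par_g h⟩, fun ⟨h1, h2⟩ => ?_⟩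
    obtain ⟨i, hi, hi'⟩ := lift h2
    rwa [← inj ((root_of_par hi).trans (congrArg Subtype.val h1).symm) hi']
  let e' := Equiv.ofBijective Φ hΦ
  let ε := Finite.equivFin {v // F.IsRoot v}
  refine ⟨((Equiv.refl _).prodCongr ε.symm).trans e'.symm, fun i k a c => ?_⟩
  have h (x : {v // F.root v = r} × {v // F.IsRoot v}) : Φ (e'.symm x) = x :=
    e'.apply_symm_apply x
  rw [key]
  simp only [Equiv.trans_apply, Equiv.prodCongr_apply, Prod.map_apply, Equiv.refl_apply, h,
    EmbeddingLike.apply_eq_iff_eq]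
  rfl

variable [Fintype V] [Nonempty V]

/-- The equivalence relation on the vertices generated by the nonvanishing of entries of the
universal magic unitary. -/
def orbit (F : Forest V) : Setoid V := Relation.EqvGen.setoid fun i j => F.mat i j ≠ 0

lemma orbit_of_ne_zero {i j : V} (h : F.mat i j ≠ 0) : F.orbit i j := Relation.EqvGen.rel i j h

lemma card_children_orbit (F : Forest V) {i j : V} (h : F.orbit i j) (c : Quotient F.orbit) :
    Nat.card {k // F.par k i ∧ Quotient.mk F.orbit k = c} =
      Nat.card {k // F.par k j ∧ Quotient.mk F.orbit k = c} := by
  induction h with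
  | rel i j h =>
    refine F.magic_mat.card_eq h _ _ fun k l hkl => and_congr ?_ ?_
    · exact (F.preserves_mat.swap F.magic_mat).iff hkl
    · rw [Quotient.sound (orbit_of_ne_zero (right_ne_zero_of_mul hkl))]
  | refl i => rfl
  | symm i j _ ih => exact ih.symm
  | trans i j k _ _ ih ih' => exact ih.trans ih'

lemma exists_children_equiv (F : Forest V) {i j : V} (h : F.orbit i j) :
    ∃ β : {k // F.par k i} ≃ {k // F.par k j}, ∀ k, F.orbit k.1 (β k).1 := by
  have hc (c : Quotient F.orbit) :
      Nonempty ({k : {k // F.par k i} // Quotient.mk F.orbit k.1 = c} ≃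
        {k : {k // F.par k j} // Quotient.mk F.orbit k.1 = c}) := by
    refine Finite.card_eq.1 ?_
    rw [Nat.card_congr (Equiv.subtypeSubtypeEquivSubtypeInter (fun k => F.par k i)
        fun k => Quotient.mk F.orbit k = c),
      Nat.card_congr (Equiv.subtypeSubtypeEquivSubtypeInter (fun k => F.par k j)
        fun k => Quotient.mk F.orbit k = c)]
    exact F.card_children_orbit h c
  exact ⟨Equiv.ofFiberEquiv fun c => (hc c).some,
    fun k => Quotient.exact (Equiv.ofFiberEquiv_map (fun c => (hc c).some) k).symm⟩

end Decomposition

/-- Every class with the closure properties of `IsJordanClass` contains the quantum automorphism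
groups of all rooted forests. -/
lemma qut_mem_of_isJordanClass {C : Set QuantumPermutationGroup} (hC : IsJordanClass C) (n : ℕ)
    {V : Type} [Fintype V] [Nonempty V] (F : Forest V) (hn : Fintype.card V = n) : F.qut ∈ C := by
  classical
  induction n using Nat.strong_induction_on generalizing V with
  | h n ih =>
  subst hn
  let r := F.root (Classical.arbitrary V)
  have hr : F.IsRoot r := isRoot_root _
  have hrr : F.root r = r := root_of_isRoot hr
  by_cases hS : ∀ v, F.orbit (F.root v) r
  · have hS' (i : V) (hi : F.IsRoot i) : F.orbit i r := by
      have := hS i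
      rwa [root_of_isRoot hi] at this
    by_cases h1 : ∀ i, F.IsRoot i → i = r
    · by_cases h2 : ∀ i, i = r
      · have : Subsingleton V := ⟨fun i j => (h2 i).trans (h2 j).symm⟩
        exact hC.iso _ _ (one_iso_qut F) hC.one
      · -- A tree with at least two vertices: remove the root.
        obtain ⟨v, hv⟩ := not_forall.1 h2
        have : Nonempty {v // v ≠ r} := ⟨⟨v, hv⟩⟩
        refine hC.iso _ _ (qut_iso_addRoot F (F.restrict fun v => v ≠ r)
          (Equiv.optionSubtypeNe r) (fun i k => Iff.rfl) (fun i => ⟨?_, ?_⟩) hr)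
          (ih _ (Fintype.card_subtype_lt (x := r) (by simp)) _ rfl)
        · exact fun h k hk => k.2 (F.uniq hk h)
        · intro h
          obtain ⟨k, hk⟩ := not_forall_not.1 (mt (h1 i.1) i.2)
          by_cases hkr : k = r
          · subst hkr
            exact hk
          · exact (h ⟨k, hkr⟩ hk).elim
    · -- All trees are isomorphic to that of `r`, and there are at least two of them.
      push Not at h1
      obtain ⟨i, hi, hir⟩ := h1
      choose β hβ using fun i j => F.exists_children_equiv (i := i) (j := j)
      obtain ⟨e, he⟩ := exists_equiv_copies F.orbit β hβ hS' hr
      have : Nonempty {v // F.root v = r} := ⟨⟨r, hrr⟩⟩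
      have : Nonempty {v // F.IsRoot v} := ⟨⟨r, hr⟩⟩
      have : NeZero (Nat.card {v // F.IsRoot v}) := ⟨Nat.card_pos.ne'⟩
      refine hC.iso _ _ (qut_iso_freeWreath F (F.restrict fun v => F.root v = r) ⟨r, hrr⟩
        root_restrict e he) (hC.freeWreath _ _ (ih _ (Fintype.card_subtype_lt (x := i) ?_) _ rfl))
      rwa [root_of_isRoot hi]
  · -- The trees that are equivalent to that of `r` and the other trees form a free product.
    obtain ⟨v, hv⟩ := not_forall.1 hS
    let S (v : V) : Prop := F.orbit (F.root v) r
    have hpar {i k} (h : F.par i k) : S i ↔ S k := by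
      change F.orbit _ _ ↔ F.orbit _ _
      rw [root_of_par h]
    have hmat {i j} (h : F.mat i j ≠ 0) : S i ↔ S j := by
      have h' := orbit_of_ne_zero (root_ne_zero F.magic_mat F.preserves_mat h)
      exact ⟨fun hi => F.orbit.trans (F.orbit.symm h') hi, fun hj => F.orbit.trans h' hj⟩
    have hrS : S r := by
      change F.orbit _ _
      rw [hrr]
    have : Nonempty {v // S v} := ⟨⟨r, hrS⟩⟩
    have : Nonempty {v // ¬S v} := ⟨⟨v, hv⟩⟩
    refine hC.iso _ _ (qut_iso_freeProd F (F.restrict S) (F.restrict fun v => ¬S v)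
      (Equiv.sumCompl S) ?_ (fun i j => ?_) (fun i j => ?_))
      (hC.freeProd _ _ (ih _ (Fintype.card_subtype_lt (x := v) hv) _ rfl)
        (ih _ (Fintype.card_subtype_lt (x := r) (not_not.2 hrS)) _ rfl))
    · rintro (i | i) (k | k)
      · rw [Sum.liftRel_inl_inl]
        exact Iff.rfl
      · exact iff_of_false (fun h => k.2 ((hpar h).1 i.2)) Sum.not_liftRel_inl_inr
      · exact iff_of_false (fun h => i.2 ((hpar h).2 k.2)) Sum.not_liftRel_inr_inl
      · rw [Sum.liftRel_inr_inr]
        exact Iff.rfl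
    · by_contra h
      exact j.2 ((hmat h).1 i.2)
    · by_contra h
      exact i.2 ((hmat h).2 j.2)

end Forest

/-! ### The class of quantum automorphism groups of trees -/

lemma exists_forest_of_mem_treeQut {G : QuantumPermutationGroup} (hG : G ∈ treeQut) :
    ∃ (V : Type) (_ : Fintype V) (_ : Nonempty V) (F : Forest V), G.Iso F.qut := by
  obtain ⟨V, _, _, X, hX, h⟩ := hG
  exact ⟨V, inferInstance, inferInstance, Forest.ofTree X hX, h.trans (Qut_iso_ofTree hX)⟩

lemma treeQut_iso {G H : QuantumPermutationGroup} (h : G.Iso H) (hG : G ∈ treeQut) :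
    H ∈ treeQut := by
  obtain ⟨V, _, _, X, hX, h'⟩ := hG
  exact ⟨V, inferInstance, inferInstance, X, hX, h.symm.trans h'⟩

lemma isJordanClass_treeQut : IsJordanClass treeQut where
  iso _ _ := treeQut_iso
  one := treeQut_iso (Forest.one_iso_qut Forest.point).symm Forest.point.qut_mem_treeQut
  freeProd G H hG hH := by
    obtain ⟨V₁, _, _, F₁, h₁⟩ := exists_forest_of_mem_treeQut hG
    obtain ⟨V₂, _, _, F₂, h₂⟩ := exists_forest_of_mem_treeQut hH
    obtain ⟨N, hN⟩ := F₁.exists_not_hasHeight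
    obtain ⟨W, _, _, F, h, hF, -⟩ := F₂.exists_high_tree N
    exact treeQut_iso ((h₁.freeProd (h₂.trans h)).trans (F₁.qut_sum_iso F N hN hF)).symm
      (F₁.sum F).qut_mem_treeQut
  freeWreath G n _ hG := by
    obtain ⟨V, _, _, F, h⟩ := exists_forest_of_mem_treeQut hG
    exact treeQut_iso (((h.trans F.qut_iso_qut_addRoot).freeWreath _).trans
      (Forest.qut_iso_freeWreath (F.addRoot.copies n) F.addRoot none F.root_addRoot
        (Equiv.refl _) fun _ _ _ _ => Iff.rfl)).symm (F.addRoot.copies n).qut_mem_treeQut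

end QAut

end

theorem theorem1 : IsLeast {C : Set QAut.QuantumPermutationGroup | QAut.IsJordanClass C}
    QAut.treeQut := by
  refine ⟨QAut.isJordanClass_treeQut, fun C hC G hG => ?_⟩
  obtain ⟨V, _, _, F, h⟩ := QAut.exists_forest_of_mem_treeQut hG
  exact hC.iso _ _ h.symm (F.qut_mem_of_isJordanClass hC _ rfl)
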